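/- **Setting.** Let $N\ge 2$ be an integer, $0<r<\infty$, $0<t_*<\infty$, $\beta>0$, and put $\tau(t)=\dfrac{i(t_*-t)}{2\pi r^2}$ for $t\in[0,t_*)$. Let $$\vartheta_1(v;\tau)=i\sum_{n\in\mathbb Z}(-1)^n e^{\pi i\tau(n-1/2)^2}e^{\pi i v(2n-1)},\qquad \eta(\tau)=e^{\pi i\tau/12}\prod_{n\ge1}(1-e^{2\pi i n\tau}).$$ For $\mathbf x\in\mathbb R^N$ let $\overline x=\sum_{j=1}^N x_j-\kappa_N$ with $\kappa_N=\frac{\pi r}{2}(2N-3+(-1)^N)$, and let $$\check{\mathbb A}=\{\mathbf x\in\mathbb R^N:\ x_1<\dots<x_N<x_1+2\pi r,\ 0<\overline x<2\pi r\}.$$ Put $U_N(t,y)=-\log\vartheta_1(y/2\pi r;N\tau(t))$ for $0<y<2\pi r$ (with $U_N'=\partial U_N/\partial y$), and, for $\mathbf x\in\check{\mathbb A}$, $W_N(t,\mathbf x)=\sum_{j<k}U_N(t,x_k-x_j)+U_N(t,\overline x)$, $$V_N^{(\beta)}(t,\mathbf x)=\frac{\beta(\beta-2)}{8}N\Big[\sum_{j<k}U_N'(t,x_k-x_j)^2+U_N'(t,\overline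 x)^2-\frac{N-2}{N}\sum_{j<k}U_N''(t,x_k-x_j)\Big],$$ $$\mathcal L(t)u=\tfrac12\sum_j\partial_{x_j}^2u+\tfrac\beta2\sum_j\partial_{x_j}\big((\partial_{x_j}W_N)\,u\big),\qquad \mathcal H(t)u=-\tfrac12\sum_j\partial_{x_j}^2u+V_N^{(\beta)}u .$$ ($\mathcal L$ is the forward Kolmogorov operator of the elliptic Dyson model eDYS$^{(\beta)}$, $dX_j=dB_j-\frac\beta2\,\partial_{x_j}W_N(t,\mathbf X)\,dt$.) Fix $t'\in[0,t_*)$ and $\mathbf x'\in\check{\mathbb A}$. Solutions below are classical ($C^{1,2}$ on $(t',t_*)\times\check{\mathbb A}$). The condition "$u\to\delta_{\mathbf x'}$ as $t\downarrow t'$" means that $u(t,\cdot)$ is integrable on $\check{\mathbb A}$ for every $t\in(t',t_*)$ and that $u(t,\mathbf x)\,d\mathbf x$ on $\check{\mathbb A}$ converges to the point mass at $\mathbf x'$, tested against all continuous functions on $\mathbb R^N$. "$u\to0$ at $\partial\check{\mathbb A}$" means that $u(t,\mathbf x)\to0$ as $\mathbf x\to\partial\check{\mathbb A}$ from inside, locally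 uniformly in $t\in(t',t_*)$. * *Kolmogorov problem:* $[\partial_t-\mathcal L(t)]p=0$ and $p>0$ on $(t',t_*)\times\check{\mathbb A}$, $p\to\delta_{\mathbf x'}$ as $t\downarrow t'$. The transition probability density $p_N^{(\beta)}(t,\mathbf x|t',\mathbf x')$ of eDYS$^{(\beta)}$ in $\check{\mathbb A}$ is the smallest solution of this problem (the minimal fundamental solution). * *Schrödinger problem:* $[\partial_t+\mathcal H(t)]\psi=0$ and $\psi>0$ on $(t',t_*)\times\check{\mathbb A}$, $\psi\to\delta_{\mathbf x'}$ as $t\downarrow t'$, $\psi\to0$ at $\partial\check{\mathbb A}$. The function $\psi_N^{(\beta)}(t,\mathbf x|t',\mathbf x')$ is the smallest solution of this problem (so it is the only solution whenever there is only one). For $t\in[0,t_*)$ and $\mathbf x\in\mathbb R^N$ let $$h_N^r(t,\mathbf x)=\eta(N\tau(t))^{-\beta(N-1)(N-2)/4}\,\vartheta_1\Big(\frac{\overline x}{2\pi r};N\tau(t)\Big)\prod_{1\le j<k\le N}\vartheta_1\Big(\frac{x_k-x_j}{2\pi r};N\tau(t)\Big).$$ **Proposition.** (i) Let $t'\in[0,t_*)$,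 $\mathbf x'\in\check{\mathbb A}$, and put $m(t,\mathbf x)=\big(h_N^r(t,\mathbf x)/h_N^r(t',\mathbf x')\big)^{\beta/2}$. * A function $f$ is a $C^{1,2}$ solution of $[\partial_t+\mathcal H(t)]f=0$ on $(t',t_*)\times\check{\mathbb A}$ if and only if $mf$ is a $C^{1,2}$ solution of $[\partial_t-\mathcal L(t)](mf)=0$ there. * If $\psi$ is any solution of the Schrödinger problem, then $m\psi$ is a solution of the Kolmogorov problem. * If $p_N^{(\beta)}(\cdot,\cdot|t',\mathbf x')$ and $\psi_N^{(\beta)}(\cdot,\cdot|t',\mathbf x')$ are the functions defined above, then $$p_N^{(\beta)}(t,\mathbf x|t',\mathbf x')=\Big(\frac{h_N^r(t,\mathbf x)}{h_N^r(t',\mathbf x')}\Big)^{\beta/2}\psi_N^{(\beta)}(t,\mathbf x|t',\mathbf x'),\qquad t'<t<t_*,\ \mathbf x\in\check{\mathbb A},$$ and $p_N^{(\beta)}\to0$ at $\partial\check{\mathbb A}$, so that, with both functions extended by $0$, the formula holds for $\mathbf x$ in the closure of $\check{\mathbb A}$. (ii) For all $t\in[0,t_*)$ and $\mathbf x\in\mathbb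 R^N$, $$h_N^r(t,\mathbf x)=\eta(N\tau(t))^{-(\beta-2)(N-1)(N-2)/4}\Big(\frac{2\pi r}{\sqrt N}\Big)^N q_N^r(t_*-t,\mathbf v|\mathbf x),$$ where $v_j=\frac{\pi r}{2N}(4j-3+(-1)^N)$ for $1\le j\le N$, and, for $s>0$, $$q_N^r(s,\mathbf y|\mathbf x)=\det_{1\le j,k\le N}\Big[\sum_{w\in\mathbb Z}(-1)^{Nw}\,\frac{e^{-(y_j+2\pi r w-x_k)^2/2s}}{\sqrt{2\pi s}}\Big].$$ -/

import Mathlib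

open Filter Topology Set
open scoped Real

noncomputable section

namespace EllipticDyson

/-! ### Special functions -/

/-- Jacobi's theta function `ϑ₁(v; τ) = i ∑_{n ∈ ℤ} (-1)^n q^{(n-1/2)^2} z^{2n-1}`,
`q = e^{π i τ}`, `z = e^{π i v}` (the series converges for `Im τ > 0`). -/
def theta1 (v τ : ℂ) : ℂ :=
  Complex.I * ∑' n : ℤ, (-1 : ℂ) ^ n
    * Complex.exp (π * Complex.I * τ * ((n : ℂ) - 1 / 2) ^ 2)
    * Complex.exp (π * Complex.I * v * (2 * (n : ℂ) - 1))

/-- `ϑ₁(v; i s)` as a real number, for real `v` and `s`. -/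
def theta1R (v s : ℝ) : ℝ := (theta1 (v : ℂ) (Complex.I * (s : ℂ))).re

/-- The Dedekind function `η(i s)` as a real number, for real `s`. -/
def etaR (s : ℝ) : ℝ := (ModularForm.eta (Complex.I * (s : ℂ))).re

/-- At real `v` and purely imaginary `τ = i s`, `ϑ₁` is real, so nothing is lost in `theta1R`. -/
theorem ofReal_theta1R (v s : ℝ) :
    ((theta1R v s : ℝ) : ℂ) = theta1 (v : ℂ) (Complex.I * (s : ℂ)) := by
  have key : (starRingEnd ℂ) (theta1 (v : ℂ) (Complex.I * (s : ℂ)))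
      = theta1 (v : ℂ) (Complex.I * (s : ℂ)) := by
    unfold theta1
    rw [map_mul, Complex.conj_I, Complex.conj_tsum, ← (Equiv.subLeft (1 : ℤ)).tsum_eq, neg_mul,
      ← mul_neg, ← tsum_neg]
    congr 1
    refine tsum_congr fun n => ?_
    simp only [Equiv.subLeft_apply, map_mul, map_zpow₀, map_neg, map_one, ← Complex.exp_conj,
      map_pow, map_sub, Complex.conj_I, Complex.conj_ofReal, map_div₀, map_ofNat, map_intCast]
    have h1 : (-1 : ℂ) ^ (1 - n) = -(-1 : ℂ) ^ n := by
      rw [zpow_sub₀ (by norm_num), zpow_one, div_eq_mul_inv, ← inv_zpow]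
      norm_num
    rw [h1, neg_mul, neg_mul, neg_neg]
    congr 2
    · congr 1
      push_cast
      ring
    · push_cast
      ring_nf
  exact Complex.conj_eq_iff_re.mp key

/-- At purely imaginary `τ = i s`, `s > 0`, `η` is real, so nothing is lost in `etaR`. -/
theorem ofReal_etaR (s : ℝ) (hs : 0 < s) :
    ((etaR s : ℝ) : ℂ) = ModularForm.eta (Complex.I * (s : ℂ)) := by
  have hq : ∀ n : ℕ, ModularForm.eta_q n (Complex.I * (s : ℂ))
      = ((Real.exp (-(2 * π * s)) ^ (n + 1) : ℝ) : ℂ) := by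
    intro n
    rw [ModularForm.eta_q_eq_pow]
    push_cast
    congr 2
    linear_combination (2 * π * s : ℂ) * Complex.I_mul_I
  have h24 : Function.Periodic.qParam 24 (Complex.I * (s : ℂ))
      = ((Real.exp (-(2 * π * s) / 24) : ℝ) : ℂ) := by
    unfold Function.Periodic.qParam
    push_cast
    congr 1
    linear_combination (2 * π * s / 24 : ℂ) * Complex.I_mul_I
  have hlt : ‖Real.exp (-(2 * π * s))‖ < 1 := by
    rw [Real.norm_eq_abs, abs_of_pos (Real.exp_pos _), Real.exp_lt_one_iff]
    have := mul_pos (mul_pos two_pos Real.pi_pos) hs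
    linarith
  have hmul : Multipliable fun n : ℕ => (1 - Real.exp (-(2 * π * s)) ^ (n + 1) : ℝ) := by
    simp_rw [sub_eq_add_neg]
    apply multipliable_one_add_of_summable
    simpa using (summable_nat_add_iff 1).mpr
      (summable_geometric_of_lt_one (norm_nonneg _) hlt)
  have hprod : ∏' n : ℕ, (1 - ModularForm.eta_q n (Complex.I * (s : ℂ)))
      = ((∏' n : ℕ, (1 - Real.exp (-(2 * π * s)) ^ (n + 1)) : ℝ) : ℂ) := by
    have := hmul.map_tprod Complex.ofRealHom Complex.continuous_ofReal
    rw [show ((∏' n : ℕ, (1 - Real.exp (-(2 * π * s)) ^ (n + 1)) : ℝ) : ℂ)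
      = Complex.ofRealHom (∏' n : ℕ, (1 - Real.exp (-(2 * π * s)) ^ (n + 1))) from rfl, this]
    refine tprod_congr fun n => ?_
    rw [hq]
    simp
  have hval : ModularForm.eta (Complex.I * (s : ℂ))
      = ((Real.exp (-(2 * π * s) / 24)
          * ∏' n : ℕ, (1 - Real.exp (-(2 * π * s)) ^ (n + 1)) : ℝ) : ℂ) := by
    rw [ModularForm.eta, h24, hprod, Complex.ofReal_mul]
  rw [etaR, hval, Complex.ofReal_re]

/-- `Im τ(t)`, where `τ(t) = i (t_* - t) / (2 π r²)` is purely imaginary. -/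
def tauIm (r ts t : ℝ) : ℝ := (ts - t) / (2 * π * r ^ 2)

/-! ### Configurations -/

/-- The parity `σ(N) = (-1)^N`. -/
def parity (N : ℕ) : ℝ := (-1) ^ N

/-- `κ_N = (π r / 2) (2 N - 3 + (-1)^N)`. -/
def kappa (N : ℕ) (r : ℝ) : ℝ := π * r / 2 * (2 * (N : ℝ) - 3 + parity N)

/-- The shifted centre of mass `x̄ = ∑ x_j - κ_N`. -/
def bar {N : ℕ} (r : ℝ) (x : Fin N → ℝ) : ℝ := ∑ j, x j - kappa N r

/-- The alcove `{x_1 < ⋯ < x_N < x_1 + 2 π r}` restricted by `0 < x̄ < 2 π r`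
(the condition `x_N < x_1 + 2 π r` is written for all pairs, which is the same for `N ≥ 1`). -/
def alcove (N : ℕ) (r : ℝ) : Set (Fin N → ℝ) :=
  {x | StrictMono x ∧ (∀ j k, x k < x j + 2 * π * r) ∧ bar r x ∈ Ioo 0 (2 * π * r)}

/-- The equidistant configuration `v_j = (π r / 2N) (4 j - 3 + (-1)^N)`, `1 ≤ j ≤ N`;
the index `j : Fin N` stands for `j + 1`. -/
def equidistant (N : ℕ) (r : ℝ) (j : Fin N) : ℝ :=
  π * r / (2 * (N : ℝ)) * (4 * ((j : ℝ) + 1) - 3 + parity N)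

/-! ### Heat kernels -/

/-- Brownian transition density at times `t > 0`. -/
def pBM (t y x : ℝ) : ℝ := Real.exp (-(y - x) ^ 2 / (2 * t)) / Real.sqrt (2 * π * t)

/-- The (signed) wrapped heat kernel `∑_{w ∈ ℤ} σ^w p^BM(t, x + 2 π r w | x')`. -/
def pWrapped (σ r t x x' : ℝ) : ℝ := ∑' w : ℤ, σ ^ w * pBM t (x + 2 * π * r * (w : ℝ)) x'

/-- `q_N^r(t, x | x') = det [p^r_{σ(N)}(t, x_j | x'_k)]`. -/
def qDet (N : ℕ) (r t : ℝ) (x x' : Fin N → ℝ) : ℝ :=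
  Matrix.det (Matrix.of fun j k : Fin N => pWrapped (parity N) r t (x j) (x' k))

/-! ### The function `h_N^r` -/

/-- `h_N^r(t, x) = η(Nτ(t))^{-β(N-1)(N-2)/4} ϑ₁(x̄/2πr; Nτ(t)) ∏_{j<k} ϑ₁((x_k-x_j)/2πr; Nτ(t))`. -/
def hN (N : ℕ) (r ts β t : ℝ) (x : Fin N → ℝ) : ℝ :=
  etaR (N * tauIm r ts t) ^ (-β * ((N : ℝ) - 1) * ((N : ℝ) - 2) / 4)
    * theta1R (bar r x / (2 * π * r)) (N * tauIm r ts t)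
    * ∏ j : Fin N, ∏ k ∈ Finset.Ioi j,
        theta1R ((x k - x j) / (2 * π * r)) (N * tauIm r ts t)

/-! ### Potentials and operators -/

/-- `U_N(t, y) = - log ϑ₁(y / 2πr; N τ(t))`, `0 < y < 2πr`. -/
def potU (N : ℕ) (r ts t y : ℝ) : ℝ :=
  -Real.log (theta1R (y / (2 * π * r)) (N * tauIm r ts t))

/-- `W_N(t, x) = ∑_{j<k} U_N(t, x_k - x_j) + U_N(t, x̄)`. -/
def potW (N : ℕ) (r ts t : ℝ) (x : Fin N → ℝ) : ℝ :=
  (∑ j : Fin N, ∑ k ∈ Finset.Ioi j, potU N r ts t (x k - x j)) + potU N r ts t (bar r x)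

/-- The interaction `V_N^{(β)}(t, x)` of the Hamiltonian. -/
def potV (N : ℕ) (r ts β t : ℝ) (x : Fin N → ℝ) : ℝ :=
  β * (β - 2) / 8 * N *
    ((∑ j : Fin N, ∑ k ∈ Finset.Ioi j, deriv (potU N r ts t) (x k - x j) ^ 2)
      + deriv (potU N r ts t) (bar r x) ^ 2
      - ((N : ℝ) - 2) / N *
          ∑ j : Fin N, ∑ k ∈ Finset.Ioi j, deriv (deriv (potU N r ts t)) (x k - x j))

/-- The partial derivative `∂f/∂x_j`. -/
def pd {N : ℕ} (j : Fin N) (f : (Fin N → ℝ) → ℝ) (x : Fin N → ℝ) : ℝ :=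
  fderiv ℝ f x (Pi.single j 1)

/-- The (forward) Kolmogorov operator
`ℒ u = ½ ∑ ∂²u/∂x_j² + (β/2) ∑ ∂/∂x_j ((∂W_N/∂x_j) u)`, that is, the Fokker-Planck operator of
`dX_j = dB_j - (β/2) (∂W_N/∂x_j)(t, X) dt`. -/
def kolmogorovOp (N : ℕ) (r ts β t : ℝ) (u : (Fin N → ℝ) → ℝ) (x : Fin N → ℝ) : ℝ :=
  1 / 2 * ∑ j, pd j (pd j u) x
    + β / 2 * ∑ j, pd j (fun y => pd j (potW N r ts t) y * u y) x

/-- The Hamiltonian `ℋ u = -½ ∑ ∂²u/∂x_j² + V_N^{(β)} u`. -/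
def hamiltonian (N : ℕ) (r ts β t : ℝ) (u : (Fin N → ℝ) → ℝ) (x : Fin N → ℝ) : ℝ :=
  -(1 / 2) * ∑ j, pd j (pd j u) x + potV N r ts β t x * u x

/-! ### Classical solutions -/

/-- `u` is of class `C^{1,2}` (once in time, twice in space) on `(a, b) × D`. -/
structure IsC12On {N : ℕ} (u : ℝ → (Fin N → ℝ) → ℝ) (a b : ℝ) (D : Set (Fin N → ℝ)) : Prop where
  continuousOn : ContinuousOn (fun z : ℝ × (Fin N → ℝ) => u z.1 z.2) (Ioo a b ×ˢ D)
  time_differentiable : ∀ x ∈ D, DifferentiableOn ℝ (fun t => u t x) (Ioo a b)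
  space_contDiff : ∀ t ∈ Ioo a b, ContDiffOn ℝ 2 (u t) D
  time_continuousOn :
    ContinuousOn (fun z : ℝ × (Fin N → ℝ) => deriv (fun t => u t z.2) z.1) (Ioo a b ×ˢ D)
  pd_continuousOn : ∀ j,
    ContinuousOn (fun z : ℝ × (Fin N → ℝ) => pd j (u z.1) z.2) (Ioo a b ×ˢ D)
  pd2_continuousOn : ∀ j k,
    ContinuousOn (fun z : ℝ × (Fin N → ℝ) => pd k (pd j (u z.1)) z.2) (Ioo a b ×ˢ D)

/-- `u` solves `[∂/∂t - ℒ_N^{(β)}(t)] u = 0` classically on `(t', t_*) × alcove`. -/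
def SolvesKolmogorov (N : ℕ) (r ts β t' : ℝ) (u : ℝ → (Fin N → ℝ) → ℝ) : Prop :=
  IsC12On u t' ts (alcove N r) ∧
    ∀ t ∈ Ioo t' ts, ∀ x ∈ alcove N r,
      deriv (fun s => u s x) t - kolmogorovOp N r ts β t (u t) x = 0

/-- `u` solves `[∂/∂t + ℋ_N^{(β)}(t)] u = 0` classically on `(t', t_*) × alcove`. -/
def SolvesSchrodinger (N : ℕ) (r ts β t' : ℝ) (u : ℝ → (Fin N → ℝ) → ℝ) : Prop :=
  IsC12On u t' ts (alcove N r) ∧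
    ∀ t ∈ Ioo t' ts, ∀ x ∈ alcove N r,
      deriv (fun s => u s x) t + hamiltonian N r ts β t (u t) x = 0

/-- `u(t, ·)` is integrable over the alcove at every time, and
`lim_{t ↓ t'} u(t, x) dx = δ(x - x')` in the sense of weak convergence of measures. (The alcove is
bounded, so that every continuous test function is bounded there.) -/
def StartsAtDelta (N : ℕ) (r ts t' : ℝ) (x' : Fin N → ℝ) (u : ℝ → (Fin N → ℝ) → ℝ) : Prop :=
  (∀ t ∈ Ioo t' ts, MeasureTheory.IntegrableOn (u t) (alcove N r)) ∧
    ∀ φ : (Fin N → ℝ) → ℝ, Continuous φ →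
      Tendsto (fun t => ∫ x in alcove N r, φ x * u t x) (𝓝[>] t') (𝓝 (φ x'))

/-- `u > 0` on `(t', t_*) × alcove`. -/
def PositiveInside (N : ℕ) (r ts t' : ℝ) (u : ℝ → (Fin N → ℝ) → ℝ) : Prop :=
  ∀ t ∈ Ioo t' ts, ∀ x ∈ alcove N r, 0 < u t x

/-- `u(t, x) → 0` as `x` tends to the boundary of the alcove, locally uniformly in
`t ∈ (t', t_*)`; equivalently, the extension of `u` by `0` to the boundary is continuous there. -/
def VanishesAtBoundary (N : ℕ) (r ts t' : ℝ) (u : ℝ → (Fin N → ℝ) → ℝ) : Prop :=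
  ∀ t ∈ Ioo t' ts, ∀ y ∈ frontier (alcove N r),
    Tendsto (fun z : ℝ × (Fin N → ℝ) => u z.1 z.2)
      (𝓝[Ioo t' ts ×ˢ alcove N r] (t, y)) (𝓝 0)

/-- Positive solutions of the forward Kolmogorov equation started at `δ(x - x')` at time `t'`. -/
structure IsKolmogorovSolution (N : ℕ) (r ts β t' : ℝ) (x' : Fin N → ℝ)
    (p : ℝ → (Fin N → ℝ) → ℝ) : Prop where
  equation : SolvesKolmogorov N r ts β t' p
  initial : StartsAtDelta N r ts t' x' p
  positive : PositiveInside N r ts t' p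

/-- Solutions of the Schrödinger-type equation with the initial condition `δ(x - x')` at time
`t'`, positive in the alcove and vanishing at its boundary. -/
structure IsSchrodingerSolution (N : ℕ) (r ts β t' : ℝ) (x' : Fin N → ℝ)
    (ψ : ℝ → (Fin N → ℝ) → ℝ) : Prop where
  equation : SolvesSchrodinger N r ts β t' ψ
  initial : StartsAtDelta N r ts t' x' ψ
  positive : PositiveInside N r ts t' ψ
  boundary : VanishesAtBoundary N r ts t' ψ

/-- The transition probability density `p_N^{(β)}(·, · | t', x')` of the diffusion in the alcove
with forward Kolmogorov operator `ℒ_N^{(β)}`: the minimal positive fundamental solution of the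
forward Kolmogorov equation. It is the only solution whenever there is only one. -/
def IsTransitionDensity (N : ℕ) (r ts β t' : ℝ) (x' : Fin N → ℝ)
    (p : ℝ → (Fin N → ℝ) → ℝ) : Prop :=
  IsKolmogorovSolution N r ts β t' x' p ∧
    ∀ p₂, IsKolmogorovSolution N r ts β t' x' p₂ →
      ∀ t ∈ Ioo t' ts, ∀ x ∈ alcove N r, p t x ≤ p₂ t x

/-- The function `ψ_N^{(β)}(·, · | t', x')`: the minimal solution of the Schrödinger-type problem.
It is the only solution whenever there is only one. -/
def IsPsi (N : ℕ) (r ts β t' : ℝ) (x' : Fin N → ℝ) (ψ : ℝ → (Fin N → ℝ) → ℝ) : Prop :=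
  IsSchrodingerSolution N r ts β t' x' ψ ∧
    ∀ ψ₂, IsSchrodingerSolution N r ts β t' x' ψ₂ →
      ∀ t ∈ Ioo t' ts, ∀ x ∈ alcove N r, ψ t x ≤ ψ₂ t x

/-- The multiplier `(h_N^r(t, x) / h_N^r(t', x'))^{β/2}`. -/
def multiplier (N : ℕ) (r ts β t' : ℝ) (x' : Fin N → ℝ) (t : ℝ) (x : Fin N → ℝ) : ℝ :=
  (hN N r ts β t x / hN N r ts β t' x') ^ (β / 2)

end EllipticDyson

end

noncomputable section

namespace EllipticDyson

/-! ### Jacobi's triple product -/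

/-! Part (ii) compares two alternating functions of x: the product of theta functions and the
determinant of wrapped heat kernels based at the equidistant points v_j. In each single variable
both lie in the space of theta functions of degree N with the same multipliers (`thetaProd_slice`,
`latticeKernel_mem`). The quasi-periodicity links the Fourier coefficients n and n + N, so N
coefficients determine an element on the real line. Hence the two functions are proportional
(`alternating_mul_det_eq`), and the constant is found at x = v. There the kernel matrix is
diagonalised by a discrete Fourier transform, and its eigenvalues as well as the theta values are
evaluated by Jacobi's triple product (`jacobi_triple_product`, `sq_theta1R_half_mul_prod`). The
power of η is what remains.

Part (i) is a gauge transformation. Inside the alcove the multiplier m is a function of t times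
exp(-(β/2) W_N), so conjugating the Fokker-Planck operator removes the first-order terms and leaves
a potential containing |∇W_N|². The cross terms of |∇W_N|² need no theta identities: by (ii),
exp(-W_N) is a power of η(Nτ(t)) times a constant multiple of a determinant solving the backward
heat equation, which expresses |∇W_N|² through ∂_t W_N, ΔW_N and the logarithmic derivative of η
(`deriv_potW_time`). The latter cancels against the η-power in m. What is left is V_N^{(β)}, because
each theta factor solves its own heat equation, with diffusivity N/2 (`potV_eq`).

The identity of p and mψ follows from the two minimality properties. Since mψ solves the Kolmogorov
problem, p ≤ mψ. Then f = p/m satisfies 0 < f ≤ ψ, so f vanishes at the boundary; it also starts at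
the point mass (`StartsAtDelta.of_le`). Thus f solves the Schrödinger problem and ψ ≤ f. -/

/-- The `q`-Pochhammer symbol `(q; q)_n`. -/
def qPoch (q : ℂ) (n : ℕ) : ℂ := ∏ i ∈ Finset.range n, (1 - q ^ (i + 1))

/-- `1 / (q; q)_n`, extended by `0` to negative `n`. -/
def qPochInv (q : ℂ) (n : ℤ) : ℂ := if n < 0 then 0 else (qPoch q n.toNat)⁻¹

theorem one_sub_pow_succ_ne_zero {q : ℂ} (hq : ‖q‖ < 1) (n : ℕ) : 1 - q ^ (n + 1) ≠ 0 := by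
  intro h
  have h1 : ‖q ^ (n + 1)‖ < 1 := by
    rw [norm_pow]; exact pow_lt_one₀ (norm_nonneg _) hq (Nat.succ_ne_zero n)
  rw [← sub_eq_zero.mp h, norm_one] at h1
  exact lt_irrefl _ h1

theorem qPoch_ne_zero {q : ℂ} (hq : ‖q‖ < 1) (n : ℕ) : qPoch q n ≠ 0 :=
  Finset.prod_ne_zero_iff.mpr fun i _ => one_sub_pow_succ_ne_zero hq i

/-- The extension by 0 is consistent with the recursion: at n = 0 the factor 1 - q^0 vanishes. No
case distinction on the index is needed afterwards. -/
theorem qPochInv_sub_one {q : ℂ} (hq : ‖q‖ < 1) (n : ℤ) :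
    qPochInv q (n - 1) = (1 - q ^ n) * qPochInv q n := by
  rcases lt_trichotomy n 0 with h | h | h
  · simp [qPochInv, h, show n - 1 < 0 by omega]
  · subst h; simp [qPochInv]
  · obtain ⟨m, rfl⟩ : ∃ m : ℕ, n = m + 1 := ⟨(n - 1).toNat, by omega⟩
    have h1 := one_sub_pow_succ_ne_zero hq m
    have h2 := qPoch_ne_zero hq m
    have e : qPoch q (m + 1) = qPoch q m * (1 - q ^ (m + 1)) := Finset.prod_range_succ _ _
    have e2 : q ^ ((m : ℤ) + 1) = q ^ (m + 1) := by exact_mod_cast zpow_natCast q (m + 1)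
    have e3 : ((m : ℤ) + 1).toNat = m + 1 := by omega
    simp only [qPochInv, add_sub_cancel_right, Int.toNat_natCast,
      if_neg (show ¬ (m : ℤ) < 0 by omega), if_neg (show ¬ (m : ℤ) + 1 < 0 by omega), e2, e3, e]
    field_simp

/-- The Laurent coefficients of the finite triple product. -/
def tripleCoeff (q : ℂ) (m : ℕ) (k : ℤ) : ℂ :=
  q ^ (k ^ 2) * qPoch (q ^ 2) (2 * m) * qPochInv (q ^ 2) (m + k) * qPochInv (q ^ 2) (m - k)

theorem norm_sq_lt_one {q : ℂ} (hq : ‖q‖ < 1) : ‖q ^ 2‖ < 1 := by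
  rw [norm_pow]; exact pow_lt_one₀ (norm_nonneg _) hq two_ne_zero

/-- This is the coefficient of z^k after multiplying by the next pair of factors, since (1 +
q^{2m+1} z)(1 + q^{2m+1}/z) = 1 + q^{4m+2} + q^{2m+1}(z + 1/z). -/
theorem tripleCoeff_succ {q : ℂ} (hq : ‖q‖ < 1) (hq0 : q ≠ 0) (m : ℕ) (k : ℤ) :
    tripleCoeff q (m + 1) k = (1 + q ^ (4 * m + 2)) * tripleCoeff q m k
      + q ^ (2 * m + 1) * (tripleCoeff q m (k - 1) + tripleCoeff q m (k + 1)) := by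
  have hQ := norm_sq_lt_one hq
  have R := qPochInv_sub_one hQ
  set Q := q ^ 2 with hQd
  have hQ0 : Q ≠ 0 := pow_ne_zero _ hq0
  -- All reciprocals that occur are polynomial multiples of the two at the largest index, `G` and
  -- `G'`, so the recursion reduces to a polynomial identity.
  set G := qPochInv Q (m + 1 + k)
  set G' := qPochInv Q (m + 1 - k)
  have g1 : qPochInv Q (m + k) = (1 - Q ^ ((m : ℤ) + 1 + k)) * G := by
    rw [← R]; congr 1; ring
  have g2 : qPochInv Q (m - k) = (1 - Q ^ ((m : ℤ) + 1 - k)) * G' := by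
    rw [← R]; congr 1; ring
  have g3 : qPochInv Q (m + (k - 1)) = (1 - Q ^ ((m : ℤ) + k)) * qPochInv Q (m + k) := by
    rw [← R]; congr 1; ring
  have g4 : qPochInv Q (m - (k + 1)) = (1 - Q ^ ((m : ℤ) - k)) * qPochInv Q (m - k) := by
    rw [← R]; congr 1; ring
  have g5 : qPochInv Q (m - (k - 1)) = G' := by congr 1; ring
  have g6 : qPochInv Q (m + (k + 1)) = G := by congr 1; ring
  have p1 : qPoch Q (2 * (m + 1))
      = qPoch Q (2 * m) * (1 - Q * (Q ^ m) ^ 2) * (1 - Q ^ 2 * (Q ^ m) ^ 2) := by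
    rw [show 2 * (m + 1) = 2 * m + 1 + 1 by ring, qPoch, Finset.prod_range_succ,
      Finset.prod_range_succ, ← qPoch]
    ring
  have z1 : q ^ ((k - 1) ^ 2) = q ^ (k ^ 2) * (q * (Q ^ k)⁻¹) := by
    rw [hQd, ← zpow_natCast, ← zpow_mul, ← zpow_neg, ← zpow_one_add₀ hq0, ← zpow_add₀ hq0]
    congr 1; push_cast; ring
  have z2 : q ^ ((k + 1) ^ 2) = q ^ (k ^ 2) * (q * Q ^ k) := by
    rw [hQd, ← zpow_natCast, ← zpow_mul, ← zpow_one_add₀ hq0, ← zpow_add₀ hq0]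
    congr 1; push_cast; ring
  have e1 : q ^ (4 * m + 2) = Q * (Q ^ m) ^ 2 := by rw [hQd]; ring
  have e2 : q ^ (2 * m + 1) = q * Q ^ m := by rw [hQd]; ring
  have hk0 : Q ^ k ≠ 0 := zpow_ne_zero _ hQ0
  simp only [tripleCoeff, ← hQd, g5, g6, g3, g4, g1, g2, z1, z2, p1, e1, e2, Nat.cast_add,
    Nat.cast_one, zpow_add₀ hQ0, zpow_sub₀ hQ0, zpow_natCast, zpow_one]
  change _ * _ * G * G' = _
  have hq2 : q * q = Q := by rw [hQd]; ring
  field_simp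
  generalize Q ^ k = b
  generalize Q ^ m = a
  linear_combination (q ^ (k ^ 2) * qPoch Q (2 * m) * G * G') *
    (-(a * (a*b-1) * (Q*a*b -1)) * b- a * (b - a) * (b - Q * a) * b) * hq2

/-- The finite form of the triple product, by induction on m. As a `HasSum` over ℤ it needs no
bookkeeping of the range |k| ≤ m, outside of which the coefficients vanish. -/
theorem hasSum_tripleCoeff {q z : ℂ} (hq : ‖q‖ < 1) (hq0 : q ≠ 0) (hz : z ≠ 0) (m : ℕ) :
    HasSum (fun k : ℤ => tripleCoeff q m k * z ^ k)
      (∏ j ∈ Finset.range m, ((1 + q ^ (2 * j + 1) * z) * (1 + q ^ (2 * j + 1) * z⁻¹))) := by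
  induction m with
  | zero =>
    have : (fun k : ℤ => tripleCoeff q 0 k * z ^ k) = fun k => if k = 0 then 1 else 0 := by
      funext k
      by_cases hk : k = 0
      · subst hk; simp [tripleCoeff, qPochInv, qPoch]
      · rw [if_neg hk]
        rcases lt_or_gt_of_ne hk with h | h
        · simp [tripleCoeff, qPochInv, h]
        · simp [tripleCoeff, qPochInv, h]
    rw [this, Finset.range_zero, Finset.prod_empty]
    exact hasSum_ite_eq 0 1
  | succ m ih =>
    have h1 : HasSum (fun k : ℤ => tripleCoeff q m (k - 1) * z ^ k)
        (z * ∏ j ∈ Finset.range m, ((1 + q ^ (2 * j + 1) * z) * (1 + q ^ (2 * j + 1) * z⁻¹))) := by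
      have := ((Equiv.subRight (1 : ℤ)).hasSum_iff.mpr ih).mul_left z
      refine this.congr_fun fun k => ?_
      simp only [Function.comp, Equiv.subRight_apply, zpow_sub_one₀ hz]
      field_simp
    have h2 : HasSum (fun k : ℤ => tripleCoeff q m (k + 1) * z ^ k)
        (z⁻¹ * ∏ j ∈ Finset.range m, ((1 + q ^ (2 * j + 1) * z) * (1 + q ^ (2 * j + 1) * z⁻¹))) := by
      have := ((Equiv.addRight (1 : ℤ)).hasSum_iff.mpr ih).mul_left z⁻¹
      refine this.congr_fun fun k => ?_
      simp only [Function.comp, Equiv.coe_addRight, zpow_add_one₀ hz]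
      field_simp
    have := (ih.mul_left (1 + q ^ (4 * m + 2))).add ((h1.add h2).mul_left (q ^ (2 * m + 1)))
    rw [Finset.prod_range_succ]
    generalize (∏ j ∈ Finset.range m, ((1 + q ^ (2 * j + 1) * z) * (1 + q ^ (2 * j + 1) * z⁻¹))) = A
      at this
    have e : A * ((1 + q ^ (2 * m + 1) * z) * (1 + q ^ (2 * m + 1) * z⁻¹))
        = (1 + q ^ (4 * m + 2)) * A + q ^ (2 * m + 1) * (z * A + z⁻¹ * A) := by
      field_simp
      ring
    rw [e]
    refine this.congr_fun fun k => ?_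
    rw [tripleCoeff_succ hq hq0]; ring

theorem exists_norm_le_of_tendsto {u : ℕ → ℂ} {a : ℂ} (h : Tendsto u atTop (𝓝 a)) :
    ∃ C, 0 ≤ C ∧ ∀ n, ‖u n‖ ≤ C := by
  obtain ⟨C, hC⟩ := (Metric.isBounded_range_of_tendsto u h).exists_norm_le
  exact ⟨C, (norm_nonneg _).trans (hC _ ⟨0, rfl⟩), fun n => hC _ ⟨n, rfl⟩⟩

theorem tendsto_qPoch {q : ℂ} (hq : ‖q‖ < 1) :
    Tendsto (qPoch q) atTop (𝓝 (∏' n : ℕ, (1 - q ^ (n + 1)))) :=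
  (ModularForm.multipliable_one_sub_pow hq).hasProd.tendsto_prod_nat

theorem tprod_one_sub_pow_ne_zero {q : ℂ} (hq : ‖q‖ < 1) : ∏' n : ℕ, (1 - q ^ (n + 1)) ≠ 0 := by
  simp_rw [sub_eq_add_neg]
  refine tprod_one_add_ne_zero_of_summable (fun n => ?_) ?_
  · rw [← sub_eq_add_neg]; exact one_sub_pow_succ_ne_zero hq n
  · simpa using (summable_nat_add_iff 1).mpr
      (summable_geometric_of_lt_one (norm_nonneg _) hq)

theorem tendsto_qPochInv {q : ℂ} (hq : ‖q‖ < 1) {f : ℕ → ℤ} (hf : Tendsto f atTop atTop) :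
    Tendsto (fun m => qPochInv q (f m)) atTop (𝓝 (∏' n : ℕ, (1 - q ^ (n + 1)))⁻¹) := by
  have h1 : Tendsto (fun m => (qPoch q (f m).toNat)⁻¹) atTop
      (𝓝 (∏' n : ℕ, (1 - q ^ (n + 1)))⁻¹) := by
    refine ((tendsto_qPoch hq).inv₀ (tprod_one_sub_pow_ne_zero hq)).comp ?_
    refine tendsto_atTop.mpr fun b => ?_
    filter_upwards [hf.eventually_ge_atTop (b : ℤ)] with m hm
    omega
  refine h1.congr' ?_
  filter_upwards [hf.eventually_ge_atTop 0] with m hm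
  rw [qPochInv, if_neg (by omega)]

theorem exists_norm_qPochInv_le {q : ℂ} (hq : ‖q‖ < 1) : ∃ C, 0 ≤ C ∧ ∀ n, ‖qPochInv q n‖ ≤ C := by
  obtain ⟨C, hC0, hC⟩ := exists_norm_le_of_tendsto
    ((tendsto_qPoch hq).inv₀ (tprod_one_sub_pow_ne_zero hq))
  refine ⟨C, hC0, fun n => ?_⟩
  rw [qPochInv]
  split_ifs
  · simpa using hC0
  · exact hC _

/-- With q = e^{πiτ} and z = e^{2πiw} these are the terms of `jacobiTheta₂`, and |q| < 1 says that
Im τ > 0. -/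
theorem summable_norm_zpow_sq_mul {q z : ℂ} (hq : ‖q‖ < 1) (hq0 : q ≠ 0) (hz : z ≠ 0) :
    Summable fun k : ℤ => ‖q ^ (k ^ 2) * z ^ k‖ := by
  set τ := Complex.log q / (π * Complex.I) with hτ
  set w := Complex.log z / (2 * π * Complex.I) with hw
  have hpi : (π : ℂ) ≠ 0 := by exact_mod_cast Real.pi_ne_zero
  have him : 0 < τ.im := by
    have h1 : τ = -(Complex.I * Complex.log q) / π := by
      rw [hτ]; field_simp; rw [Complex.I_sq]; ring
    have : τ.im = - Real.log ‖q‖ / π := by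
      rw [h1, Complex.div_ofReal_im]
      simp [Complex.log_re]
    rw [this]
    exact div_pos (neg_pos.mpr (Real.log_neg (norm_pos_iff.mpr hq0) hq)) Real.pi_pos
  refine ((summable_jacobiTheta₂_term_iff w τ).mpr him).norm.congr fun k => ?_
  congr 1
  have e1 : 2 * π * Complex.I * k * w + π * Complex.I * k ^ 2 * τ
      = ((k ^ 2 : ℤ) : ℂ) * Complex.log q + k * Complex.log z := by
    rw [hτ, hw]; push_cast; field_simp; ring
  rw [jacobiTheta₂_term, e1, Complex.exp_add, Complex.exp_int_mul, Complex.exp_int_mul,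
    Complex.exp_log hq0, Complex.exp_log hz]

theorem multipliable_one_add_odd_pow_mul {q : ℂ} (hq : ‖q‖ < 1) (z : ℂ) :
    Multipliable fun n : ℕ => 1 + q ^ (2 * n + 1) * z := by
  refine multipliable_one_add_of_summable ?_
  have : (fun n : ℕ => ‖q ^ (2 * n + 1) * z‖) = fun n => (‖q‖ ^ 2) ^ n * (‖q‖ * ‖z‖) := by
    funext n; rw [norm_mul, norm_pow]; ring
  rw [this]
  refine (summable_geometric_of_lt_one (by positivity) ?_).mul_right _
  exact pow_lt_one₀ (norm_nonneg _) hq two_ne_zero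

/-- **Jacobi's triple product identity.** -/
theorem jacobi_triple_product {q z : ℂ} (hq : ‖q‖ < 1) (hq0 : q ≠ 0) (hz : z ≠ 0) :
    ∑' k : ℤ, q ^ (k ^ 2) * z ^ k = (∏' n : ℕ, (1 - (q ^ 2) ^ (n + 1)))
      * ((∏' n : ℕ, (1 + q ^ (2 * n + 1) * z)) * ∏' n : ℕ, (1 + q ^ (2 * n + 1) * z⁻¹)) := by
  have hQ := norm_sq_lt_one hq
  have hP := tprod_one_sub_pow_ne_zero hQ
  obtain ⟨C₁, hC₁, h₁⟩ := exists_norm_le_of_tendsto (tendsto_qPoch hQ)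
  obtain ⟨C₂, hC₂, h₂⟩ := exists_norm_qPochInv_le hQ
  have hlim : Tendsto (fun m : ℕ => ∑' k : ℤ, tripleCoeff q m k * z ^ k) atTop
      (𝓝 (∑' k : ℤ, (∏' n : ℕ, (1 - (q ^ 2) ^ (n + 1)))⁻¹ * (q ^ (k ^ 2) * z ^ k))) := by
    -- Letting m → ∞: the Pochhammer symbols and their reciprocals are bounded uniformly in the
    -- index, so the limit series itself, up to a constant, dominates.
    refine tendsto_tsum_of_dominated_convergence
      (bound := fun k => (C₁ * C₂ * C₂) * ‖q ^ (k ^ 2) * z ^ k‖)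
      ((summable_norm_zpow_sq_mul hq hq0 hz).mul_left _) (fun k => ?_) (Eventually.of_forall ?_)
    · have t1 : Tendsto (fun m : ℕ => qPoch (q ^ 2) (2 * m)) atTop
          (𝓝 (∏' n : ℕ, (1 - (q ^ 2) ^ (n + 1)))) :=
        (tendsto_qPoch hQ).comp (tendsto_id.const_mul_atTop' two_pos)
      have t2 := tendsto_qPochInv hQ (f := fun m : ℕ => (m : ℤ) + k)
        (tendsto_atTop_add_const_right _ _ tendsto_natCast_atTop_atTop)
      have t3 := tendsto_qPochInv hQ (f := fun m : ℕ => (m : ℤ) - k)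
        (tendsto_atTop_add_const_right _ _ tendsto_natCast_atTop_atTop)
      have := (((t1.const_mul (q ^ (k ^ 2))).mul t2).mul t3).mul_const (z ^ k)
      convert this using 2
      · rfl
      · field_simp
    · intro m k
      rw [tripleCoeff]
      calc ‖q ^ k ^ 2 * qPoch (q ^ 2) (2 * m) * qPochInv (q ^ 2) (m + k)
              * qPochInv (q ^ 2) (m - k) * z ^ k‖
          = ‖qPoch (q ^ 2) (2 * m)‖ * ‖qPochInv (q ^ 2) (m + k)‖
              * ‖qPochInv (q ^ 2) (m - k)‖ * ‖q ^ k ^ 2 * z ^ k‖ := by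
            simp only [norm_mul]; ring
        _ ≤ _ := by
            gcongr
            · exact h₁ _
            · exact h₂ _
            · exact h₂ _
  have hlim2 : Tendsto (fun m : ℕ => ∑' k : ℤ, tripleCoeff q m k * z ^ k) atTop
      (𝓝 ((∏' n : ℕ, (1 + q ^ (2 * n + 1) * z)) * ∏' n : ℕ, (1 + q ^ (2 * n + 1) * z⁻¹))) := by
    simp_rw [(hasSum_tripleCoeff hq hq0 hz _).tsum_eq, Finset.prod_mul_distrib]
    exact (multipliable_one_add_odd_pow_mul hq z).hasProd.tendsto_prod_nat.mul
      (multipliable_one_add_odd_pow_mul hq z⁻¹).hasProd.tendsto_prod_nat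
  rw [← tendsto_nhds_unique hlim hlim2, tsum_mul_left, mul_inv_cancel_left₀ hP]

/-! ### Product formulas -/

theorem ofReal_tprod_nat {f : ℕ → ℝ} (hf : Multipliable f) :
    ((∏' n, f n : ℝ) : ℂ) = ∏' n, (f n : ℂ) :=
  hf.map_tprod Complex.ofRealHom Complex.continuous_ofReal

theorem multipliable_one_add_pow_succ_mul {q : ℂ} (hq : ‖q‖ < 1) (z : ℂ) :
    Multipliable fun n : ℕ => 1 + q ^ (n + 1) * z := by
  refine multipliable_one_add_of_summable ?_
  have : (fun n : ℕ => ‖q ^ (n + 1) * z‖) = fun n => ‖q‖ ^ n * (‖q‖ * ‖z‖) := by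
    funext n; rw [norm_mul, norm_pow]; ring
  rw [this]
  exact (summable_geometric_of_lt_one (norm_nonneg _) hq).mul_right _

/-- The product formula for `ϑ₁(v; i s)`, with `w = e^{2 π i v}`. -/
theorem theta1_eq_tprod (v : ℂ) {s : ℝ} (hs : 0 < s) :
    theta1 v (Complex.I * (s : ℂ)) = 2 * Complex.exp (-(π * s / 4)) * Complex.sin (π * v)
      * (∏' n : ℕ, (1 - Complex.exp (-(2 * π * s)) ^ (n + 1)))
      * ((∏' n : ℕ, (1 + Complex.exp (-(2 * π * s)) ^ (n + 1) * -Complex.exp (2 * π * Complex.I * v)))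
        * ∏' n : ℕ, (1 + Complex.exp (-(2 * π * s)) ^ (n + 1)
            * -(Complex.exp (2 * π * Complex.I * v))⁻¹)) := by
  set q := Complex.exp (-(π * s)) with hqd
  set w := Complex.exp (2 * π * Complex.I * v) with hw
  have hw0 : w ≠ 0 := Complex.exp_ne_zero _
  have hq0 : q ≠ 0 := Complex.exp_ne_zero _
  have hq : ‖q‖ < 1 := by
    rw [hqd, Complex.norm_exp]
    simpa using mul_pos Real.pi_pos hs
  have hQ : Complex.exp (-(2 * π * s)) = q ^ 2 := by
    rw [hqd, ← Complex.exp_nat_mul]; congr 1; push_cast; ring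
  have hQ1 := norm_sq_lt_one hq
  -- The triple product is taken at z = -w/q: expanding (n - 1/2)² leaves the linear term e^{πsn} =
  -- q^{-n}, which is absorbed into z.
  have hz : -(q⁻¹ * w) ≠ 0 := neg_ne_zero.mpr (mul_ne_zero (inv_ne_zero hq0) hw0)
  have key := jacobi_triple_product hq hq0 hz
  have e1 : theta1 v (Complex.I * (s : ℂ)) = Complex.I * Complex.exp (-(π * s / 4))
      * Complex.exp (-(π * Complex.I * v)) * ∑' k : ℤ, q ^ (k ^ 2) * (-(q⁻¹ * w)) ^ k := by
    have term : ∀ n : ℤ, (-1 : ℂ) ^ n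
        * Complex.exp (π * Complex.I * (Complex.I * (s : ℂ)) * ((n : ℂ) - 1 / 2) ^ 2)
        * Complex.exp (π * Complex.I * v * (2 * (n : ℂ) - 1))
        = Complex.exp (-(π * s / 4)) * Complex.exp (-(π * Complex.I * v))
          * (q ^ (n ^ 2) * (-(q⁻¹ * w)) ^ n) := by
      intro n
      have t1 : (-(q⁻¹ * w)) ^ n = (-1 : ℂ) ^ n * (Complex.exp (n * (π * s))
          * Complex.exp (n * (2 * π * Complex.I * v))) := by
        rw [neg_eq_neg_one_mul, mul_zpow, mul_zpow, hqd, ← Complex.exp_neg, neg_neg, hw,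
          Complex.exp_int_mul, Complex.exp_int_mul]
      have t2 : q ^ (n ^ 2) = Complex.exp (n ^ 2 * -(π * s)) := by
        rw [hqd, ← Complex.exp_int_mul]; push_cast; rfl
      have t3 : Complex.exp (π * Complex.I * (Complex.I * (s : ℂ)) * ((n : ℂ) - 1 / 2) ^ 2)
          = Complex.exp (-(π * s / 4)) * Complex.exp (n ^ 2 * -(π * s))
            * Complex.exp (n * (π * s)) := by
        rw [← Complex.exp_add, ← Complex.exp_add]
        congr 1
        linear_combination (π * s * (n - 1 / 2) ^ 2 : ℂ) * Complex.I_sq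
      have t4 : Complex.exp (π * Complex.I * v * (2 * (n : ℂ) - 1))
          = Complex.exp (-(π * Complex.I * v)) * Complex.exp (n * (2 * π * Complex.I * v)) := by
        rw [← Complex.exp_add]; congr 1; ring
      rw [t1, t2, t3, t4]
      ring
    rw [theta1, tsum_congr term, tsum_mul_left]
    ring
  -- The first factor 1 - w is split off; together with the prefactor it becomes 2 sin(πv) in `e4`.
  have e2 : ∏' n : ℕ, (1 + q ^ (2 * n + 1) * -(q⁻¹ * w))
      = (1 - w) * ∏' n : ℕ, (1 + (q ^ 2) ^ (n + 1) * -w) := by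
    have h0 : (fun n : ℕ => 1 + q ^ (2 * n + 1) * -(q⁻¹ * w)) = fun n => 1 + (q ^ 2) ^ n * -w := by
      funext n
      rw [← pow_mul, pow_succ]; field_simp
    rw [h0, tprod_eq_zero_mul' (f := fun n : ℕ => 1 + (q ^ 2) ^ n * -w)
      (multipliable_one_add_pow_succ_mul hQ1 (-w)), pow_zero, one_mul, sub_eq_add_neg]
  have e3 : (fun n : ℕ => 1 + q ^ (2 * n + 1) * (-(q⁻¹ * w))⁻¹)
      = fun n => 1 + (q ^ 2) ^ (n + 1) * -w⁻¹ := by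
    funext n
    rw [← pow_mul, inv_neg, mul_inv, inv_inv]; ring
  have e4 : Complex.I * Complex.exp (-(π * Complex.I * v)) * (1 - w) = 2 * Complex.sin (π * v) := by
    have : w = Complex.exp (π * Complex.I * v) * Complex.exp (π * Complex.I * v) := by
      rw [hw, ← Complex.exp_add]; congr 1; ring
    have h2 : Complex.exp (-(π * Complex.I * v)) * Complex.exp (π * Complex.I * v) = 1 := by
      rw [← Complex.exp_add]; simp
    rw [Complex.sin, this, show -(π * v) * Complex.I = -(π * Complex.I * v) by ring,
      show π * v * Complex.I = π * Complex.I * v by ring]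
    linear_combination (-Complex.I * Complex.exp (π * Complex.I * v)) * h2
  rw [e1, key, e2, e3, hQ]
  linear_combination (Complex.exp (-(π * s / 4)) * (∏' n : ℕ, (1 - (q ^ 2) ^ (n + 1)))
      * ((∏' n : ℕ, (1 + (q ^ 2) ^ (n + 1) * -w)) * ∏' n : ℕ, (1 + (q ^ 2) ^ (n + 1) * -w⁻¹))) * e4

/-- The factors of the infinite product for `ϑ₁`. -/
def thetaFactor (Q v : ℝ) (n : ℕ) : ℝ := 1 - 2 * Q ^ (n + 1) * Real.cos (2 * π * v) + (Q ^ (n + 1)) ^ 2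

theorem summable_pow_succ {Q : ℝ} (h0 : 0 < Q) (h1 : Q < 1) : Summable fun n : ℕ => Q ^ (n + 1) :=
  (summable_nat_add_iff 1).mpr (summable_geometric_of_lt_one h0.le h1)

theorem pow_succ_lt_one {Q : ℝ} (h0 : 0 < Q) (h1 : Q < 1) (n : ℕ) : Q ^ (n + 1) < 1 :=
  pow_lt_one₀ h0.le h1 (Nat.succ_ne_zero n)

/-- With x = Q^{n+1} the factor is (1 - x)² + 2x(1 - cos 2πv). -/
theorem thetaFactor_pos {Q : ℝ} (h0 : 0 < Q) (h1 : Q < 1) (v : ℝ) (n : ℕ) :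
    0 < thetaFactor Q v n := by
  have h3 := pow_succ_lt_one h0 h1 n
  have h4 := pow_pos h0 (n + 1)
  have h5 := Real.cos_le_one (2 * π * v)
  rw [thetaFactor]
  nlinarith [mul_pos (sub_pos.mpr h3) (sub_pos.mpr h3), mul_nonneg h4.le (sub_nonneg.mpr h5)]

theorem summable_abs_thetaFactor_sub_one {Q : ℝ} (h0 : 0 < Q) (h1 : Q < 1) (v : ℝ) :
    Summable fun n => ‖thetaFactor Q v n - 1‖ := by
  refine Summable.of_nonneg_of_le (fun _ => norm_nonneg _) (fun n => ?_)
    ((summable_pow_succ h0 h1).mul_left 3)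
  have h3 := pow_succ_lt_one h0 h1 n
  have h4 := pow_pos h0 (n + 1)
  rw [Real.norm_eq_abs, thetaFactor, abs_le]
  have h5 := Real.cos_le_one (2 * π * v)
  have h6 := Real.neg_one_le_cos (2 * π * v)
  constructor <;> nlinarith

theorem multipliable_of_summable_sub_one {f : ℕ → ℝ} (hf : Summable fun n => ‖f n - 1‖) :
    Multipliable f := by
  have := multipliable_one_add_of_summable hf
  simpa using this

/-- The product is nonnegative as a limit of positive partial products, and absolute convergence
excludes the value 0. -/
theorem tprod_pos_of_summable_sub_one {f : ℕ → ℝ} (hf : Summable fun n => ‖f n - 1‖)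
    (hpos : ∀ n, 0 < f n) : 0 < ∏' n, f n := by
  have h1 : ∏' n, f n ≠ 0 := by
    have := tprod_one_add_ne_zero_of_summable (f := fun n => f n - 1)
      (fun n => by simpa using (hpos n).ne') hf
    simpa using this
  refine lt_of_le_of_ne ?_ h1.symm
  exact ge_of_tendsto' (multipliable_of_summable_sub_one hf).hasProd.tendsto_prod_nat
    fun n => Finset.prod_nonneg fun i _ => (hpos i).le

theorem multipliable_thetaFactor {Q : ℝ} (h0 : 0 < Q) (h1 : Q < 1) (v : ℝ) :
    Multipliable (thetaFactor Q v) :=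
  multipliable_of_summable_sub_one (summable_abs_thetaFactor_sub_one h0 h1 v)

theorem summable_abs_one_sub_pow {Q : ℝ} (h0 : 0 < Q) (h1 : Q < 1) :
    Summable fun n : ℕ => ‖(1 - Q ^ (n + 1)) - 1‖ := by
  simpa using (summable_pow_succ h0 h1).norm

theorem multipliable_one_sub_pow_real {Q : ℝ} (h0 : 0 < Q) (h1 : Q < 1) :
    Multipliable fun n : ℕ => 1 - Q ^ (n + 1) :=
  multipliable_of_summable_sub_one (summable_abs_one_sub_pow h0 h1)

/-- Euler's product `∏ (1 - Q^n)`. -/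
def eulerProd (Q : ℝ) : ℝ := ∏' n : ℕ, (1 - Q ^ (n + 1))

theorem eulerProd_pos {Q : ℝ} (h0 : 0 < Q) (h1 : Q < 1) : 0 < eulerProd Q :=
  tprod_pos_of_summable_sub_one (summable_abs_one_sub_pow h0 h1)
    fun n => sub_pos.mpr (pow_succ_lt_one h0 h1 n)

theorem exp_neg_two_pi_lt_one {s : ℝ} (hs : 0 < s) : Real.exp (-(2 * π * s)) < 1 := by
  rw [Real.exp_lt_one_iff]
  have := mul_pos (mul_pos two_pos Real.pi_pos) hs
  linarith

/-- The real form pairs the conjugate factors 1 - Q^{n+1} w and 1 - Q^{n+1}/w. -/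
theorem theta1R_eq_tprod (v : ℝ) {s : ℝ} (hs : 0 < s) :
    theta1R v s = 2 * Real.exp (-(π * s / 4)) * Real.sin (π * v) * eulerProd (Real.exp (-(2 * π * s)))
      * ∏' n, thetaFactor (Real.exp (-(2 * π * s))) v n := by
  have h1 := exp_neg_two_pi_lt_one hs
  set Q := Real.exp (-(2 * π * s)) with hQ
  have h0 : 0 < Q := Real.exp_pos _
  have hQc : Complex.exp (-(2 * π * s)) = (Q : ℂ) := by rw [hQ]; push_cast; rfl
  have hQn : ‖(Q : ℂ)‖ < 1 := by
    rwa [Complex.norm_real, Real.norm_eq_abs, abs_of_pos h0]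
  have : ((theta1R v s : ℝ) : ℂ) = ((2 * Real.exp (-(π * s / 4)) * Real.sin (π * v) * eulerProd Q
      * ∏' n, thetaFactor Q v n : ℝ) : ℂ) := by
    rw [ofReal_theta1R, theta1_eq_tprod _ hs, hQc,
      ← (multipliable_one_add_pow_succ_mul hQn _).tprod_mul
        (multipliable_one_add_pow_succ_mul hQn _)]
    simp only [Complex.ofReal_mul, eulerProd, ofReal_tprod_nat (multipliable_thetaFactor h0 h1 v),
      ofReal_tprod_nat (multipliable_one_sub_pow_real h0 h1)]
    push_cast
    congr 1
    refine tprod_congr fun n => ?_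
    rw [thetaFactor]
    push_cast
    have e : Complex.exp (2 * π * Complex.I * v) * (Complex.exp (2 * π * Complex.I * v))⁻¹ = 1 :=
      mul_inv_cancel₀ (Complex.exp_ne_zero _)
    have e2 : 2 * Complex.cos (2 * π * v)
        = Complex.exp (2 * π * Complex.I * v) + (Complex.exp (2 * π * Complex.I * v))⁻¹ := by
      rw [Complex.cos, ← Complex.exp_neg]; ring_nf
    linear_combination ((Q : ℂ) ^ (n + 1)) ^ 2 * e + (Q : ℂ) ^ (n + 1) * e2
  exact_mod_cast this

/-- In the product formula only sin(πv) can change sign. This positivity makes the logarithms in U_N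
genuine on the alcove. -/
theorem theta1R_pos {v s : ℝ} (hs : 0 < s) (hv : 0 < v) (hv1 : v < 1) : 0 < theta1R v s := by
  rw [theta1R_eq_tprod v hs]
  have h1 := exp_neg_two_pi_lt_one hs
  have h2 : 0 < Real.sin (π * v) :=
    Real.sin_pos_of_pos_of_lt_pi (mul_pos Real.pi_pos hv) (by nlinarith [Real.pi_pos])
  have h3 := eulerProd_pos (Real.exp_pos _) h1
  have h4 := tprod_pos_of_summable_sub_one (summable_abs_thetaFactor_sub_one (Real.exp_pos _) h1 v)
    (thetaFactor_pos (Real.exp_pos _) h1 v)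
  positivity

theorem etaR_eq_eulerProd {s : ℝ} (hs : 0 < s) :
    etaR s = Real.exp (-(π * s / 12)) * eulerProd (Real.exp (-(2 * π * s))) := by
  have h1 := exp_neg_two_pi_lt_one hs
  have hq : ∀ n : ℕ, ModularForm.eta_q n (Complex.I * (s : ℂ))
      = ((Real.exp (-(2 * π * s)) ^ (n + 1) : ℝ) : ℂ) := by
    intro n
    rw [ModularForm.eta_q_eq_pow]
    push_cast
    congr 2
    linear_combination (2 * π * s : ℂ) * Complex.I_mul_I
  have h24 : Function.Periodic.qParam 24 (Complex.I * (s : ℂ))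
      = ((Real.exp (-(π * s / 12)) : ℝ) : ℂ) := by
    unfold Function.Periodic.qParam
    push_cast
    congr 1
    linear_combination (2 * π * s / 24 : ℂ) * Complex.I_mul_I
  have : ((etaR s : ℝ) : ℂ)
      = ((Real.exp (-(π * s / 12)) * eulerProd (Real.exp (-(2 * π * s))) : ℝ) : ℂ) := by
    rw [ofReal_etaR s hs, ModularForm.eta, h24, Complex.ofReal_mul, eulerProd,
      ofReal_tprod_nat (multipliable_one_sub_pow_real (Real.exp_pos _) h1)]
    simp only [hq]
    push_cast
    rfl
  exact_mod_cast this

theorem etaR_pos {s : ℝ} (hs : 0 < s) : 0 < etaR s := by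
  rw [etaR_eq_eulerProd hs]
  exact mul_pos (Real.exp_pos _) (eulerProd_pos (Real.exp_pos _) (exp_neg_two_pi_lt_one hs))

/-! ### Special values of theta functions -/

/-- Evaluation of X^N - 1 = ∏(X - ζ^d) at 1/x. -/
theorem prod_one_sub_mul_zeta_pow {N : ℕ} (hN : 0 < N) {ζ : ℂ} (hζ : IsPrimitiveRoot ζ N)
    {x : ℂ} (hx : x ≠ 0) : ∏ d ∈ Finset.range N, (1 - x * ζ ^ d) = 1 - x ^ N := by
  have h := X_pow_sub_C_eq_prod hζ hN (one_pow N)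
  apply_fun Polynomial.eval x⁻¹ at h
  simp only [Polynomial.eval_sub, Polynomial.eval_pow, Polynomial.eval_X, Polynomial.eval_C,
    Polynomial.eval_prod, mul_one] at h
  have h2 : ∏ d ∈ Finset.range N, (1 - x * ζ ^ d)
      = x ^ N * ∏ d ∈ Finset.range N, (x⁻¹ - ζ ^ d) := by
    rw [← Finset.card_range N, ← Finset.prod_const, Finset.card_range, ← Finset.prod_mul_distrib]
    refine Finset.prod_congr rfl fun d _ => ?_
    field_simp
  rw [h2, ← h, mul_sub, ← mul_pow, mul_inv_cancel₀ hx, one_pow, mul_one]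

/-- Each quadratic factors as (1 - xζ^d)(1 - xζ^{-d}), and ζ and ζ^{-1} are both primitive N-th
roots of unity. -/
theorem prod_thetaFactor {N : ℕ} (hN : 0 < N) {x : ℝ} (hx : x ≠ 0) :
    ∏ d ∈ Finset.range N, (1 - 2 * x * Real.cos (2 * π * ((d : ℝ) / N)) + x ^ 2)
      = (1 - x ^ N) ^ 2 := by
  have hζ := Complex.isPrimitiveRoot_exp N hN.ne'
  set ζ := Complex.exp (2 * π * Complex.I / N) with hζd
  have hxc : (x : ℂ) ≠ 0 := by exact_mod_cast hx
  have h : ((∏ d ∈ Finset.range N, (1 - 2 * x * Real.cos (2 * π * ((d : ℝ) / N)) + x ^ 2) : ℝ) : ℂ)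
      = (((1 - x ^ N) ^ 2 : ℝ) : ℂ) := by
    push_cast
    rw [sq (1 - (x : ℂ) ^ N)]
    nth_rewrite 1 [← prod_one_sub_mul_zeta_pow hN hζ hxc]
    rw [← prod_one_sub_mul_zeta_pow hN hζ.inv hxc, ← Finset.prod_mul_distrib]
    refine Finset.prod_congr rfl fun d _ => ?_
    have e0 : ζ ^ d = Complex.exp (2 * π * (d / N) * Complex.I) := by
      rw [hζd, ← Complex.exp_nat_mul]; congr 1; ring
    have e : ζ ^ d * ζ⁻¹ ^ d = 1 := by
      rw [← mul_pow, mul_inv_cancel₀ (Complex.exp_ne_zero _), one_pow]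
    have e2 : 2 * Complex.cos (2 * π * (d / N)) = ζ ^ d + ζ⁻¹ ^ d := by
      rw [Complex.cos, inv_pow, e0, ← Complex.exp_neg]; ring_nf
    linear_combination (-(x : ℂ) ^ 2) * e - (x : ℂ) * e2
  exact_mod_cast h

/-- The norm of ∏(1 - ζ^{d+1}) = N, where |1 - e^{2πia}| = 2 sin(πa) for 0 ≤ a ≤ 1. -/
theorem prod_two_mul_sin {N : ℕ} (hN : 0 < N) :
    ∏ d ∈ Finset.range (N - 1), (2 * Real.sin (π * (((d : ℝ) + 1) / N))) = N := by
  obtain ⟨n, rfl⟩ : ∃ n, N = n + 1 := ⟨N - 1, by omega⟩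
  have hζ := Complex.isPrimitiveRoot_exp (n + 1) hN.ne'
  have h := congrArg norm hζ.prod_one_sub_pow_eq_order
  rw [norm_prod] at h
  have h3 : ‖(n : ℂ) + 1‖ = ((n + 1 : ℕ) : ℝ) := by
    rw [← Nat.cast_succ, Complex.norm_natCast]
  rw [h3] at h
  refine Eq.trans ?_ h
  rw [Nat.add_sub_cancel]
  refine Finset.prod_congr rfl fun d hd => ?_
  have hd' : (d : ℝ) + 1 ≤ n := by exact_mod_cast Finset.mem_range.mp hd
  have e0 : Complex.exp (2 * π * Complex.I / (n + 1 : ℕ)) ^ (d + 1)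
      = Complex.exp (Complex.I * ((2 * π * (((d : ℝ) + 1) / (n + 1 : ℕ)) : ℝ) : ℂ)) := by
    rw [← Complex.exp_nat_mul]; congr 1; push_cast; ring
  rw [e0, norm_sub_rev, Complex.norm_exp_I_mul_ofReal_sub_one, Real.norm_eq_abs, abs_of_nonneg]
  · congr 2; ring
  · have hle : ((d : ℝ) + 1) / (n + 1 : ℕ) ≤ 1 := by
      rw [div_le_one (by positivity)]; push_cast; linarith
    have hge : 0 ≤ ((d : ℝ) + 1) / (n + 1 : ℕ) := by positivity
    refine mul_nonneg zero_le_two (Real.sin_nonneg_of_nonneg_of_le_pi ?_ ?_)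
    · have := mul_nonneg Real.pi_pos.le hge; linarith
    · nlinarith [Real.pi_pos]

theorem prod_tprod_thetaFactor {N : ℕ} (hN : 0 < N) {Q : ℝ} (h0 : 0 < Q) (h1 : Q < 1) :
    ∏ d ∈ Finset.range N, ∏' n, thetaFactor Q ((d : ℝ) / N) n = eulerProd (Q ^ N) ^ 2 := by
  have hQN1 : Q ^ N < 1 := pow_lt_one₀ h0.le h1 hN.ne'
  have hm := multipliable_one_sub_pow_real (pow_pos h0 N) hQN1
  rw [← Multipliable.tprod_finsetProd (fun d _ => multipliable_thetaFactor h0 h1 _), sq, eulerProd,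
    ← hm.tprod_mul hm]
  refine tprod_congr fun n => ?_
  simp only [thetaFactor]
  rw [prod_thetaFactor hN (pow_pos h0 _).ne', sq, ← pow_mul, ← pow_mul, mul_comm N]

theorem tprod_thetaFactor_zero {Q : ℝ} (h0 : 0 < Q) (h1 : Q < 1) :
    ∏' n, thetaFactor Q 0 n = eulerProd Q ^ 2 := by
  have := prod_tprod_thetaFactor one_pos h0 h1
  simpa using this

/-- `∏_{d=1}^{N-1} ϑ₁(d/N; i s)` in terms of Euler products. -/
theorem prod_theta1R_div {N : ℕ} (hN : 0 < N) {s : ℝ} (hs : 0 < s) :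
    (∏ d ∈ Finset.range (N - 1), theta1R (((d : ℝ) + 1) / N) s)
        * eulerProd (Real.exp (-(2 * π * s))) ^ 2
      = N * Real.exp (-(π * s / 4)) ^ (N - 1) * eulerProd (Real.exp (-(2 * π * s))) ^ (N - 1)
        * eulerProd (Real.exp (-(2 * π * s)) ^ N) ^ 2 := by
  have h1 := exp_neg_two_pi_lt_one hs
  have h0 := Real.exp_pos (-(2 * π * s))
  have hsin := prod_two_mul_sin hN
  rw [← prod_tprod_thetaFactor hN h0 h1]
  obtain ⟨n, rfl⟩ : ∃ n, N = n + 1 := ⟨N - 1, by omega⟩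
  -- The residue d = 0 is split off. Its product is the squared Euler product that appears as an
  -- extra factor on the left.
  rw [Finset.prod_range_succ', Nat.add_sub_cancel]
  simp only [Nat.cast_zero, zero_div]
  rw [tprod_thetaFactor_zero h0 h1]
  rw [Nat.add_sub_cancel, Finset.prod_mul_distrib, Finset.prod_const, Finset.card_range] at hsin
  simp only [theta1R_eq_tprod _ hs, Finset.prod_mul_distrib, Finset.prod_const, Finset.card_range]
  generalize (∏ d ∈ Finset.range n, Real.sin (π * (((d : ℝ) + 1) / ((n + 1 : ℕ) : ℝ)))) = S at *
  simp only [Nat.cast_succ]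
  simp only [Nat.cast_succ] at hsin
  rw [← hsin]
  ring

/-! ### The value at 1/2 and products of Gaussian sums over residues modulo N -/

/-- `∏ (1 + Q^n)`. -/
def eulerProdPlus (Q : ℝ) : ℝ := ∏' n : ℕ, (1 + Q ^ (n + 1))

theorem multipliable_one_add_const_mul_pow {Q : ℝ} (h0 : 0 < Q) (h1 : Q < 1) (c : ℝ) :
    Multipliable fun n : ℕ => 1 + c * Q ^ n :=
  multipliable_of_summable_sub_one (by
    simpa using ((summable_geometric_of_lt_one h0.le h1).mul_left c).norm)

theorem multipliable_one_add_pow_succ_real {Q : ℝ} (h0 : 0 < Q) (h1 : Q < 1) :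
    Multipliable fun n : ℕ => 1 + Q ^ (n + 1) := by
  simpa only [pow_succ'] using multipliable_one_add_const_mul_pow h0 h1 Q

theorem theta1R_half {s : ℝ} (hs : 0 < s) :
    theta1R (1 / 2) s = 2 * Real.exp (-(π * s / 4)) * eulerProd (Real.exp (-(2 * π * s)))
      * eulerProdPlus (Real.exp (-(2 * π * s))) ^ 2 := by
  have h1 := exp_neg_two_pi_lt_one hs
  have h0 := Real.exp_pos (-(2 * π * s))
  have hm := multipliable_one_add_pow_succ_real h0 h1
  rw [theta1R_eq_tprod _ hs, sq, eulerProdPlus, ← hm.tprod_mul hm,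
    show π * (1 / 2) = π / 2 by ring, Real.sin_pi_div_two, mul_one]
  congr 1
  refine tprod_congr fun n => ?_
  rw [thetaFactor, show 2 * π * (1 / 2) = π by ring, Real.cos_pi]
  ring

/-- Jacobi's triple product for real parameters. -/
theorem tsum_exp_neg_sq {s : ℝ} (hs : 0 < s) (α : ℝ) :
    ∑' m : ℤ, Real.exp (-(π * s) * (α + m) ^ 2)
      = Real.exp (-(π * s) * α ^ 2) * (eulerProd (Real.exp (-(2 * π * s)))
        * ((∏' n : ℕ, (1 + Real.exp (-(2 * π * s) * (1 / 2 + α)) * Real.exp (-(2 * π * s)) ^ n))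
          * ∏' n : ℕ, (1 + Real.exp (-(2 * π * s) * (1 / 2 - α)) * Real.exp (-(2 * π * s)) ^ n))) := by
  have h1 := exp_neg_two_pi_lt_one hs
  have h0 := Real.exp_pos (-(2 * π * s))
  set q := Complex.exp (-(π * s)) with hqd
  have hq0 : q ≠ 0 := Complex.exp_ne_zero _
  have hq : ‖q‖ < 1 := by
    rw [hqd, Complex.norm_exp]
    simpa using mul_pos Real.pi_pos hs
  have key := jacobi_triple_product hq hq0 (Complex.exp_ne_zero (-(2 * π * s * α)))
  have hterm : ∀ m : ℤ, ((Real.exp (-(π * s) * (α + m) ^ 2) : ℝ) : ℂ)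
      = (Real.exp (-(π * s) * α ^ 2) : ℝ)
        * (q ^ (m ^ 2) * Complex.exp (-(2 * π * s * α)) ^ m) := by
    intro m
    rw [hqd, ← Complex.exp_int_mul, ← Complex.exp_int_mul, Complex.ofReal_exp, Complex.ofReal_exp,
      ← Complex.exp_add, ← Complex.exp_add]
    congr 1; push_cast; ring
  have hodd : ∀ n : ℕ, q ^ (2 * n + 1) = Complex.exp (-(2 * π * s) * (1 / 2))
      * Complex.exp (-(2 * π * s)) ^ n := by
    intro n
    rw [hqd, ← Complex.exp_nat_mul, ← Complex.exp_nat_mul, ← Complex.exp_add]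
    congr 1; push_cast; ring
  refine Complex.ofReal_injective ?_
  · rw [Complex.ofReal_tsum, tsum_congr hterm, tsum_mul_left, key]
    refine Eq.trans ?_ (Complex.ofReal_mul _ _).symm
    congr 1
    rw [Complex.ofReal_mul, Complex.ofReal_mul, eulerProd,
      ofReal_tprod_nat (multipliable_one_sub_pow_real h0 h1),
      ofReal_tprod_nat (multipliable_one_add_const_mul_pow h0 h1 _),
      ofReal_tprod_nat (multipliable_one_add_const_mul_pow h0 h1 _)]
    congr 1
    · refine tprod_congr fun n => ?_
      push_cast
      rw [hqd, ← Complex.exp_nat_mul]; congr 3; push_cast; ring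
    · congr 1
      · refine tprod_congr fun n => ?_
        rw [hodd]
        push_cast
        rw [mul_add (-(2 * (π : ℂ) * s)), Complex.exp_add]
        ring_nf
      · refine tprod_congr fun n => ?_
        rw [hodd, ← Complex.exp_neg]
        push_cast
        rw [mul_sub (-(2 * (π : ℂ) * s)), sub_eq_add_neg, Complex.exp_add]
        ring_nf

/-- The single product over n is regrouped by residues modulo N. -/
theorem prod_tprod_one_add {N : ℕ} (hN : 0 < N) {Q : ℝ} (h0 : 0 < Q) (h1 : Q < 1) (c : ℝ) :
    ∏ i ∈ Finset.range N, ∏' n : ℕ, (1 + c * Q ^ i * (Q ^ N) ^ n) = ∏' n : ℕ, (1 + c * Q ^ n) := by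
  have : NeZero N := ⟨hN.ne'⟩
  have hQN1 : Q ^ N < 1 := pow_lt_one₀ h0.le h1 hN.ne'
  have hm := multipliable_one_add_const_mul_pow h0 h1 c
  have hm2 := (Nat.divModEquiv N).symm.multipliable_iff.mpr hm
  have hfib : ∀ i : Fin N, Multipliable fun n : ℕ => 1 + c * Q ^ (i : ℕ) * (Q ^ N) ^ n := fun i =>
    multipliable_one_add_const_mul_pow (pow_pos h0 N) hQN1 _
  rw [← (Nat.divModEquiv N).symm.tprod_eq, ← (Equiv.prodComm _ _).tprod_eq,
    Multipliable.tprod_prod']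
  · rw [tprod_fintype, Finset.prod_range]
    refine Finset.prod_congr rfl fun i _ => tprod_congr fun n => ?_
    simp [pow_add, pow_mul, mul_comm, mul_assoc]
  · exact (Equiv.prodComm _ _).multipliable_iff.mpr hm2
  · intro i
    refine (hfib i).congr fun n => ?_
    simp [pow_add, pow_mul, mul_comm, mul_assoc]

theorem sum_range_sq_centered (N : ℕ) (hN : 0 < N) :
    ∑ i ∈ Finset.range N, (((i : ℝ) + 1) / N - 1 / 2) ^ 2 * N = (N : ℝ) ^ 2 / 12 + 1 / 6 := by
  have h : ∀ M : ℕ, ∑ i ∈ Finset.range M, (((i : ℝ) + 1) / N - 1 / 2) ^ 2 * N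
      = ((M : ℝ) * (M + 1) * (2 * M + 1) / 6 - N * (M * (M + 1) / 2) + N ^ 2 * M / 4) / N := by
    intro M
    induction M with
    | zero => simp
    | succ M ih =>
      rw [Finset.sum_range_succ, ih]
      push_cast
      field_simp
      ring
  rw [h]
  field_simp
  ring

/-- The product of the eigenvalues of the wrapped heat kernel on the equidistant lattice. -/
theorem prod_tsum_exp_neg_sq {N : ℕ} (hN : 0 < N) {s : ℝ} (hs : 0 < s) :
    ∏ i ∈ Finset.range N, ∑' m : ℤ, Real.exp (-(π * (N * s)) * ((((i : ℝ) + 1) / N - 1 / 2) + m) ^ 2)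
      = Real.exp (-(π * s) * ((N : ℝ) ^ 2 / 12 + 1 / 6))
        * eulerProd (Real.exp (-(2 * π * s)) ^ N) ^ N
        * (2 * eulerProdPlus (Real.exp (-(2 * π * s))) ^ 2) := by
  have h1 := exp_neg_two_pi_lt_one hs
  have h0 := Real.exp_pos (-(2 * π * s))
  have hNR : (0 : ℝ) < N := by exact_mod_cast hN
  have hQN : Real.exp (-(2 * π * (N * s))) = Real.exp (-(2 * π * s)) ^ N := by
    rw [← Real.exp_nat_mul]; congr 1; ring
  simp only [tsum_exp_neg_sq (mul_pos hNR hs), Finset.prod_mul_distrib, Finset.prod_const,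
    Finset.card_range, hQN]
  have f1 : ∏ i ∈ Finset.range N, Real.exp (-(π * (N * s)) * (((i : ℝ) + 1) / N - 1 / 2) ^ 2)
      = Real.exp (-(π * s) * ((N : ℝ) ^ 2 / 12 + 1 / 6)) := by
    rw [← Real.exp_sum, ← sum_range_sq_centered N hN, Finset.mul_sum]
    congr 1
    refine Finset.sum_congr rfl fun i _ => by ring
  have f2 : ∏ i ∈ Finset.range N, ∏' n : ℕ,
      (1 + Real.exp (-(2 * π * (N * s)) * (1 / 2 + (((i : ℝ) + 1) / N - 1 / 2)))
        * (Real.exp (-(2 * π * s)) ^ N) ^ n) = eulerProdPlus (Real.exp (-(2 * π * s))) := by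
    have := prod_tprod_one_add hN h0 h1 (Real.exp (-(2 * π * s)))
    simp only [← pow_succ'] at this
    rw [eulerProdPlus, ← this]
    refine Finset.prod_congr rfl fun i _ => tprod_congr fun n => ?_
    congr 2
    rw [← Real.exp_nat_mul]
    congr 1
    push_cast
    field_simp
    ring
  -- Here the exponents are (N - 1 - i)/N, so after reflection they start at 0: the first factor of
  -- the regrouped product is 1 + 1, the source of the 2. In `f2` they start at 1.
  have f3 : ∏ i ∈ Finset.range N, ∏' n : ℕ,
      (1 + Real.exp (-(2 * π * (N * s)) * (1 / 2 - (((i : ℝ) + 1) / N - 1 / 2)))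
        * (Real.exp (-(2 * π * s)) ^ N) ^ n) = 2 * eulerProdPlus (Real.exp (-(2 * π * s))) := by
    have := prod_tprod_one_add hN h0 h1 1
    have e : ∏' n : ℕ, (1 + 1 * Real.exp (-(2 * π * s)) ^ n)
        = 2 * eulerProdPlus (Real.exp (-(2 * π * s))) := by
      rw [tprod_eq_zero_mul' (f := fun n : ℕ => 1 + 1 * Real.exp (-(2 * π * s)) ^ n)
        (by simpa using multipliable_one_add_pow_succ_real h0 h1), eulerProdPlus]
      simp only [one_mul, pow_zero]
      norm_num
    rw [← e, ← this, ← Finset.prod_range_reflect]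
    refine Finset.prod_congr rfl fun i hi => tprod_congr fun n => ?_
    have hi' := Finset.mem_range.mp hi
    congr 2
    rw [one_mul, ← Real.exp_nat_mul]
    congr 1
    rw [show N - 1 - i = N - (1 + i) by omega, Nat.cast_sub (by omega)]
    push_cast
    field_simp
    ring
  rw [f1, f2, f3]
  ring

/-- The identity behind the normalising constant: both sides reduce to Euler products, and it
remains to match the exponents of e^{-πs}, of P and of PN. It is a statement about squares because
only the squared Vandermonde-type product at the lattice is a pure power. -/
theorem sq_theta1R_half_mul_prod {N : ℕ} (hN : 2 ≤ N) {s : ℝ} (hs : 0 < s) :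
    theta1R (1 / 2) s ^ 2 * (∏ d ∈ Finset.range (N - 1), theta1R (((d : ℝ) + 1) / N) s) ^ N
      = etaR s ^ ((N - 1) * (N - 2)) * (N : ℝ) ^ N
        * (∏ i ∈ Finset.range N,
            ∑' m : ℤ, Real.exp (-(π * (N * s)) * ((((i : ℝ) + 1) / N - 1 / 2) + m) ^ 2)) ^ 2 := by
  have hN0 : 0 < N := by omega
  have h1 := exp_neg_two_pi_lt_one hs
  have h0 := Real.exp_pos (-(2 * π * s))
  have hP := eulerProd_pos h0 h1
  have hA := prod_theta1R_div hN0 hs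
  rw [prod_tsum_exp_neg_sq hN0 hs, theta1R_half hs, etaR_eq_eulerProd hs]
  -- The factor P^{2N} supplies one P² for each of the N copies of A, as `prod_theta1R_div`
  -- requires.
  refine mul_right_cancel₀ (pow_ne_zero (2 * N) hP.ne') ?_
  set P := eulerProd (Real.exp (-(2 * π * s)))
  set A := ∏ d ∈ Finset.range (N - 1), theta1R (((d : ℝ) + 1) / N) s
  set PN := eulerProd (Real.exp (-(2 * π * s)) ^ N)
  set R := eulerProdPlus (Real.exp (-(2 * π * s)))
  have hA2 : A ^ N * P ^ (2 * N) = (A * P ^ 2) ^ N := by rw [mul_pow, ← pow_mul]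
  have hexp : Real.exp (-(π * s / 4)) ^ 2 * (Real.exp (-(π * s / 4)) ^ (N - 1)) ^ N
      = Real.exp (-(π * s / 12)) ^ ((N - 1) * (N - 2))
        * Real.exp (-(π * s) * ((N : ℝ) ^ 2 / 12 + 1 / 6)) ^ 2 := by
    simp only [← Real.exp_nat_mul, ← Real.exp_add]
    congr 1
    obtain ⟨n, rfl⟩ : ∃ n, N = n + 2 := ⟨N - 2, by omega⟩
    simp only [show n + 2 - 1 = n + 1 by omega, Nat.add_sub_cancel]
    push_cast
    ring
  have hpow : P ^ 2 * (P ^ (N - 1)) ^ N = P ^ ((N - 1) * (N - 2)) * P ^ (2 * N) := by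
    rw [← pow_mul, ← pow_add, ← pow_add]
    congr 1
    obtain ⟨n, rfl⟩ : ∃ n, N = n + 2 := ⟨N - 2, by omega⟩
    simp only [show n + 2 - 1 = n + 1 by omega, Nat.add_sub_cancel]
    ring
  rw [mul_assoc, hA2, hA, mul_pow _ (PN ^ 2) N, mul_pow _ (P ^ (N - 1)) N, mul_pow (N : ℝ) _ N]
  rw [mul_pow _ P ((N - 1) * (N - 2)), ← pow_mul PN 2 N]
  linear_combination (4 * R ^ 4 * (N : ℝ) ^ N * PN ^ (2 * N)) * (P ^ 2 * (P ^ (N - 1)) ^ N) * hexp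
    + (4 * R ^ 4 * (N : ℝ) ^ N * PN ^ (2 * N)) * (Real.exp (-(π * s / 12)) ^ ((N - 1) * (N - 2))
        * Real.exp (-(π * s) * ((N : ℝ) ^ 2 / 12 + 1 / 6)) ^ 2) * hpow

/-! ### Gaussian Fourier series -/

/-- The terms `(i k)^m e^{-s k² + i k y}`, `k = n + a`. -/
def gaussTerm (a : ℝ) (m : ℕ) (n : ℤ) (p : ℂ × ℂ) : ℂ :=
  (Complex.I * (n + a)) ^ m * Complex.exp (-p.2 * ((n : ℂ) + a) ^ 2 + Complex.I * (n + a) * p.1)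

/-- The series `∑ (i k)^m e^{-s k² + i k y}` over `k ∈ ℤ + a`. -/
def gaussSeries (a : ℝ) (m : ℕ) (p : ℂ × ℂ) : ℂ := ∑' n : ℤ, gaussTerm a m n p

/-- A summable bound of `gaussTerm` on `|Im y| < R`, `Re s > c`. -/
def gaussBound (a : ℝ) (m : ℕ) (R c : ℝ) (n : ℤ) : ℝ :=
  m.factorial * Real.exp ((R + 1) ^ 2 / (2 * c)) * Real.exp (c * a ^ 2 / 2)
    * Real.exp (-c / 4 * n ^ 2)

theorem summable_exp_neg_mul_int_sq {c : ℝ} (hc : 0 < c) :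
    Summable fun n : ℤ => Real.exp (-c * n ^ 2) := by
  have := summable_pow_mul_jacobiTheta₂_term_bound 0 (T := c / π) (div_pos hc Real.pi_pos) 0
  refine this.congr fun n => ?_
  rw [pow_zero, one_mul]
  congr 1
  have := Real.pi_ne_zero
  field_simp
  ring

theorem summable_gaussBound (a : ℝ) (m : ℕ) (R : ℝ) {c : ℝ} (hc : 0 < c) :
    Summable (gaussBound a m R c) := by
  have := summable_exp_neg_mul_int_sq (c := c / 4) (by positivity)
  simp only [← neg_div] at this
  exact this.mul_left _

/-- The polynomial factor is at most m! e^{|k|}, and half of c k² absorbs (R + 1)|k| by completing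
the square. The bound is uniform in p on the region, which allows termwise differentiation. -/
theorem norm_gaussTerm_le (a : ℝ) (m : ℕ) {R c : ℝ} (hc : 0 < c) (n : ℤ) {p : ℂ × ℂ}
    (h1 : |p.1.im| ≤ R) (h2 : c ≤ p.2.re) : ‖gaussTerm a m n p‖ ≤ gaussBound a m R c n := by
  set k : ℝ := n + a with hk
  have hkc : (n : ℂ) + a = (k : ℂ) := by rw [hk]; push_cast; rfl
  have hre : (-p.2 * (k : ℂ) ^ 2 + Complex.I * k * p.1).re = -p.2.re * k ^ 2 - k * p.1.im := by
    rw [← Complex.ofReal_pow, mul_comm Complex.I, mul_assoc, Complex.add_re,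
      Complex.re_ofReal_mul, Complex.re_mul_ofReal]
    simp [sub_eq_add_neg]
  rw [gaussTerm, hkc, norm_mul, norm_pow, norm_mul, Complex.norm_I, one_mul, Complex.norm_real,
    Complex.norm_exp, hre, gaussBound, Real.norm_eq_abs]
  have e1 : |k| ^ m ≤ m.factorial * Real.exp |k| := by
    have := Real.pow_div_factorial_le_exp |k| (abs_nonneg k) m
    rwa [div_le_iff₀ (by positivity), mul_comm] at this
  have e2 : -p.2.re * k ^ 2 - k * p.1.im ≤ -c * k ^ 2 + R * |k| := by
    have a1 : -(k * p.1.im) ≤ |k| * R :=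
      (neg_le_abs _).trans (by rw [abs_mul]; exact mul_le_mul_of_nonneg_left h1 (abs_nonneg k))
    nlinarith [sq_nonneg k]
  have e3 : |k| + (-c * k ^ 2 + R * |k|)
      ≤ (R + 1) ^ 2 / (2 * c) + c * a ^ 2 / 2 + -c / 4 * n ^ 2 := by
    have b1 : (R + 1) * |k| ≤ (R + 1) ^ 2 / (2 * c) + c / 2 * k ^ 2 := by
      rw [← sub_nonneg]
      have : (R + 1) ^ 2 / (2 * c) + c / 2 * k ^ 2 - (R + 1) * |k|
          = (R + 1 - c * |k|) ^ 2 / (2 * c) := by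
        rw [← sq_abs k]; field_simp; ring
      rw [this]; positivity
    have b2 : (n : ℝ) ^ 2 / 2 - a ^ 2 ≤ k ^ 2 := by
      rw [hk]; nlinarith [sq_nonneg ((n : ℝ) + 2 * a)]
    nlinarith
  calc |k| ^ m * Real.exp (-p.2.re * k ^ 2 - k * p.1.im)
      ≤ m.factorial * Real.exp |k| * Real.exp (-c * k ^ 2 + R * |k|) := by gcongr
    _ = m.factorial * Real.exp (|k| + (-c * k ^ 2 + R * |k|)) := by rw [Real.exp_add |k|]; ring
    _ ≤ m.factorial * Real.exp ((R + 1) ^ 2 / (2 * c) + c * a ^ 2 / 2 + -c / 4 * n ^ 2) := by gcongr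
    _ = _ := by rw [Real.exp_add, Real.exp_add]; ring

theorem summable_gaussTerm (a : ℝ) (m : ℕ) {p : ℂ × ℂ} (hp : 0 < p.2.re) :
    Summable fun n => gaussTerm a m n p :=
  Summable.of_norm_bounded (summable_gaussBound a m |p.1.im| hp)
    fun n => norm_gaussTerm_le a m hp n le_rfl le_rfl

/-- Differentiation in y raises m by 1 and in s by 2, because -k² = (ik)². Every heat equation below
for theta functions and kernels rests on this. -/
theorem hasFDerivAt_gaussTerm (a : ℝ) (m : ℕ) (n : ℤ) (p : ℂ × ℂ) :
    HasFDerivAt (gaussTerm a m n) (gaussTerm a (m + 1) n p • ContinuousLinearMap.fst ℂ ℂ ℂ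
      + gaussTerm a (m + 2) n p • ContinuousLinearMap.snd ℂ ℂ ℂ) p := by
  have h1 : HasFDerivAt (fun q : ℂ × ℂ => q.1) (ContinuousLinearMap.fst ℂ ℂ ℂ) p := hasFDerivAt_fst
  have h2 : HasFDerivAt (fun q : ℂ × ℂ => q.2) (ContinuousLinearMap.snd ℂ ℂ ℂ) p := hasFDerivAt_snd
  have h := (((h2.mul_const (-((n : ℂ) + a) ^ 2)).add
    (h1.const_mul (Complex.I * (n + a)))).cexp).const_mul ((Complex.I * ((n : ℂ) + a)) ^ m)
  have e : gaussTerm a m n = fun q : ℂ × ℂ => (Complex.I * ((n : ℂ) + a)) ^ m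
      * Complex.exp (q.2 * (-((n : ℂ) + a) ^ 2) + Complex.I * (n + a) * q.1) := by
    funext q; rw [gaussTerm]; ring_nf
  rw [e]
  refine h.congr_fderiv ?_
  have e3 : gaussTerm a (m + 1) n p = (Complex.I * ((n : ℂ) + a)) ^ m * (Complex.exp
      (p.2 * (-((n : ℂ) + a) ^ 2) + Complex.I * (n + a) * p.1) * (Complex.I * (n + a))) := by
    rw [gaussTerm]; ring_nf
  have e2 : gaussTerm a (m + 2) n p = (Complex.I * ((n : ℂ) + a)) ^ m * (Complex.exp
      (p.2 * (-((n : ℂ) + a) ^ 2) + Complex.I * (n + a) * p.1) * (-((n : ℂ) + a) ^ 2)) := by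
    rw [gaussTerm, pow_add, mul_pow Complex.I _ 2, Complex.I_sq]; ring_nf
  rw [e2, e3]
  ext <;> simp

theorem hasFDerivAt_gaussSeries (a : ℝ) (m : ℕ) {p : ℂ × ℂ} (hp : 0 < p.2.re) :
    HasFDerivAt (gaussSeries a m) (gaussSeries a (m + 1) p • ContinuousLinearMap.fst ℂ ℂ ℂ
      + gaussSeries a (m + 2) p • ContinuousLinearMap.snd ℂ ℂ ℂ) p := by
  -- A convex, hence preconnected, neighbourhood of p on which |Im y| is bounded and Re s is bounded
  -- away from 0.
  set R := |p.1.im| + 1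
  set c := p.2.re / 2 with hcd
  have hc : 0 < c := by positivity
  set U : Set (ℂ × ℂ) := {q | -R < q.1.im ∧ q.1.im < R ∧ c < q.2.re} with hU
  have ho : IsOpen U := by
    refine (isOpen_lt continuous_const (Complex.continuous_im.comp continuous_fst)).inter
      ((isOpen_lt (Complex.continuous_im.comp continuous_fst) continuous_const).inter
        (isOpen_lt continuous_const (Complex.continuous_re.comp continuous_snd)))
  have hconv : Convex ℝ U := by
    refine Convex.inter ?_ (Convex.inter ?_ ?_)
    · exact convex_halfSpace_gt (f := fun q : ℂ × ℂ => q.1.im)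
        ⟨fun x y => by simp, fun c x => by simp⟩ _
    · exact convex_halfSpace_lt (f := fun q : ℂ × ℂ => q.1.im)
        ⟨fun x y => by simp, fun c x => by simp⟩ _
    · exact convex_halfSpace_gt (f := fun q : ℂ × ℂ => q.2.re)
        ⟨fun x y => by simp, fun c x => by simp⟩ _
  have hpU : p ∈ U := ⟨by linarith [neg_abs_le p.1.im], by linarith [le_abs_self p.1.im],
    by simp only [hcd]; linarith⟩
  have hb : ∀ (j : ℕ) (n : ℤ) q, q ∈ U → ‖gaussTerm a j n q‖ ≤ gaussBound a j R c n :=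
    fun j n q hq => norm_gaussTerm_le a j hc n (abs_le.mpr ⟨hq.1.le, hq.2.1.le⟩) hq.2.2.le
  have := hasFDerivAt_tsum_of_isPreconnected (𝕜 := ℂ) (u := fun n => gaussBound a (m + 1) R c n
      + gaussBound a (m + 2) R c n)
    ((summable_gaussBound a (m + 1) R hc).add (summable_gaussBound a (m + 2) R hc)) ho
    hconv.isPreconnected (f := gaussTerm a m) (f' := fun n q =>
      gaussTerm a (m + 1) n q • ContinuousLinearMap.fst ℂ ℂ ℂ
        + gaussTerm a (m + 2) n q • ContinuousLinearMap.snd ℂ ℂ ℂ)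
    (fun n q _ => hasFDerivAt_gaussTerm a m n q) (fun n q hq => ?_) hpU
    (summable_gaussTerm a m hp) hpU
  · refine this.congr_fderiv ?_
    rw [Summable.tsum_add, (summable_gaussTerm a (m + 1) hp).tsum_smul_const,
      (summable_gaussTerm a (m + 2) hp).tsum_smul_const]
    · rfl
    · exact (summable_gaussTerm a (m + 1) hp).smul_const _
    · exact (summable_gaussTerm a (m + 2) hp).smul_const _
  · refine (norm_add_le _ _).trans (add_le_add ?_ ?_)
    · rw [norm_smul]
      exact (mul_le_of_le_one_right (norm_nonneg _) (ContinuousLinearMap.norm_fst_le ..)).trans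
        (hb _ _ _ hq)
    · rw [norm_smul]
      exact (mul_le_of_le_one_right (norm_nonneg _) (ContinuousLinearMap.norm_snd_le ..)).trans
        (hb _ _ _ hq)

theorem isOpen_re_snd_pos : IsOpen {p : ℂ × ℂ | 0 < p.2.re} :=
  isOpen_lt continuous_const (Complex.continuous_re.comp continuous_snd)

/-- The partial derivatives are again series of the same family, so the induction on the order runs
over all m simultaneously. -/
theorem contDiffOn_gaussSeries (a : ℝ) (n : ℕ) :
    ∀ m : ℕ, ContDiffOn ℂ n (gaussSeries a m) {p : ℂ × ℂ | 0 < p.2.re} := by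
  have hd : ∀ m, DifferentiableOn ℂ (gaussSeries a m) {p : ℂ × ℂ | 0 < p.2.re} := fun m p hp =>
    (hasFDerivAt_gaussSeries a m hp).differentiableAt.differentiableWithinAt
  induction n with
  | zero => exact fun m => contDiffOn_zero.mpr (hd m).continuousOn
  | succ n ih =>
    intro m
    rw [Nat.cast_succ, contDiffOn_succ_iff_fderiv_of_isOpen isOpen_re_snd_pos]
    refine ⟨hd m, by simp, ?_⟩
    refine (((ih (m + 1)).smul contDiffOn_const).add ((ih (m + 2)).smul contDiffOn_const)).congr
      fun p hp => (hasFDerivAt_gaussSeries a m hp).fderiv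

theorem hasDerivAt_gaussSeries_fst (a : ℝ) (m : ℕ) (y : ℂ) {s : ℂ} (hs : 0 < s.re) :
    HasDerivAt (fun z => gaussSeries a m (z, s)) (gaussSeries a (m + 1) (y, s)) y := by
  have h := (hasFDerivAt_gaussSeries a m (p := (y, s)) hs).comp_hasDerivAt y
    ((hasDerivAt_id y).prodMk (hasDerivAt_const y s))
  exact h.congr_deriv (by simp)

theorem hasDerivAt_gaussSeries_snd (a : ℝ) (m : ℕ) (y : ℂ) {s : ℂ} (hs : 0 < s.re) :
    HasDerivAt (fun z => gaussSeries a m (y, z)) (gaussSeries a (m + 2) (y, s)) s := by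
  have h := (hasFDerivAt_gaussSeries a m (p := (y, s)) hs).comp_hasDerivAt s
    ((hasDerivAt_const s y).prodMk (hasDerivAt_id s))
  exact h.congr_deriv (by simp)

/-- The sign (-1)^n is absorbed by the shift of y by π, since e^{iπ(n-1/2)} = -i(-1)^n. -/
theorem theta1_eq_gaussSeries (v s : ℂ) :
    theta1 v (Complex.I * s) = -gaussSeries (-1 / 2) 0 (2 * π * v + π, π * s) := by
  rw [theta1, gaussSeries, ← tsum_mul_left, ← tsum_neg]
  refine tsum_congr fun n => ?_
  have h1 : Complex.exp (-(π * s) * ((n : ℂ) + ((-1 / 2 : ℝ) : ℂ)) ^ 2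
      + Complex.I * (n + ((-1 / 2 : ℝ) : ℂ)) * (2 * π * v + π))
      = Complex.exp (π * Complex.I * (Complex.I * s) * ((n : ℂ) - 1 / 2) ^ 2)
        * Complex.exp (π * Complex.I * v * (2 * (n : ℂ) - 1)) * Complex.exp (n * (π * Complex.I))
        * Complex.exp (-(π / 2 * Complex.I)) := by
    rw [← Complex.exp_add, ← Complex.exp_add, ← Complex.exp_add]
    congr 1
    push_cast
    linear_combination (-(π * s * (n - 1 / 2) ^ 2 : ℂ)) * Complex.I_sq
  rw [gaussTerm, h1, pow_zero, one_mul, Complex.exp_int_mul, Complex.exp_pi_mul_I, Complex.exp_neg,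
    Complex.exp_pi_div_two_mul_I, Complex.inv_I]
  ring

/-- The shift by the quasi-period `2 i s`, `M` times. -/
theorem gaussSeries_add_quasiPeriod (a : ℝ) (M : ℤ) (y s : ℂ) :
    gaussSeries a 0 (y + 2 * Complex.I * M * s, s)
      = Complex.exp (M ^ 2 * s - Complex.I * M * y) * gaussSeries a 0 (y, s) := by
  rw [gaussSeries, gaussSeries, ← tsum_mul_left, ← (Equiv.addRight M).tsum_eq fun n =>
    Complex.exp (M ^ 2 * s - Complex.I * M * y) * gaussTerm a 0 n (y, s)]
  refine tsum_congr fun n => ?_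
  simp only [gaussTerm, pow_zero, one_mul, Equiv.coe_addRight, ← Complex.exp_add]
  congr 1
  push_cast
  linear_combination (2 * M * s * (n + a) : ℂ) * Complex.I_sq

theorem gaussSeries_add_two_pi (a : ℝ) (y s : ℂ) :
    gaussSeries a 0 (y + 2 * π, s)
      = Complex.exp (2 * π * Complex.I * a) * gaussSeries a 0 (y, s) := by
  rw [gaussSeries, gaussSeries, ← tsum_mul_left]
  refine tsum_congr fun n => ?_
  simp only [gaussTerm, pow_zero, one_mul, ← Complex.exp_add]
  refine (Complex.exp_periodic.int_mul n _).symm.trans ?_ |>.symm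
  congr 1
  ring

/-- The frequencies ℤ - N/2 are symmetric: n ↦ N - n reverses their sign. -/
theorem gaussSeries_neg (N : ℕ) (y s : ℂ) :
    gaussSeries (-(N / 2)) 0 (-y, s) = gaussSeries (-(N / 2)) 0 (y, s) := by
  rw [gaussSeries, gaussSeries, ← (Equiv.subLeft (N : ℤ)).tsum_eq]
  refine tsum_congr fun n => ?_
  simp only [gaussTerm, pow_zero, one_mul, Equiv.subLeft_apply]
  congr 1
  push_cast
  ring

theorem gaussSeries_half_neg (y s : ℂ) :
    gaussSeries (-1 / 2) 0 (-y, s) = gaussSeries (-1 / 2) 0 (y, s) := by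
  have := gaussSeries_neg 1 y s
  rwa [Nat.cast_one, show -((1 : ℝ) / 2) = -1 / 2 by ring] at this

/-- Poisson summation for the wrapped heat kernel. -/
theorem ofReal_pWrapped (N : ℕ) {r t : ℝ} (hr : 0 < r) (ht : 0 < t) (x x' : ℝ) :
    ((pWrapped (parity N) r t x x' : ℝ) : ℂ) = 1 / (2 * π * r)
      * gaussSeries (-(N / 2)) 0 (((x : ℂ) - x') / r, t / (2 * r ^ 2)) := by
  have hpi := Real.pi_pos
  have hpic : (π : ℂ) ≠ 0 := by exact_mod_cast hpi.ne'
  have hrc : (r : ℂ) ≠ 0 := by exact_mod_cast hr.ne'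
  have htc : (t : ℂ) ≠ 0 := by exact_mod_cast ht.ne'
  set a : ℝ := 2 * π * r ^ 2 / t with ha
  have ha0 : 0 < a := by positivity
  -- In Poisson summation the sign (-1)^{Nw} enters as the imaginary part N/2 of b, and this shifts
  -- the dual frequencies to n - N/2.
  set X : ℂ := (x : ℂ) - x' with hX
  set b : ℂ := -(r * X / t) + Complex.I * N / 2 with hb
  have P := Complex.tsum_exp_neg_quadratic (a := (a : ℂ)) (by simpa using ha0) b
  have hsqrt : (a : ℂ) ^ (1 / 2 : ℂ) = (Real.sqrt a : ℂ) := by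
    rw [Real.sqrt_eq_rpow, Complex.ofReal_cpow ha0.le]; push_cast; rfl
  have hprod : Real.sqrt a * Real.sqrt (2 * π * t) = 2 * π * r := by
    rw [← Real.sqrt_mul ha0.le, ha, show 2 * π * r ^ 2 / t * (2 * π * t) = (2 * π * r) ^ 2 by
      field_simp]
    exact Real.sqrt_sq (by positivity)
  have hprodc : (Real.sqrt a : ℂ) * Real.sqrt (2 * π * t) = 2 * π * r := by exact_mod_cast hprod
  have hs1 : (Real.sqrt a : ℂ) ≠ 0 := by exact_mod_cast (Real.sqrt_pos.mpr ha0).ne'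
  have hs2 : (Real.sqrt (2 * π * t) : ℂ) ≠ 0 := by
    exact_mod_cast (Real.sqrt_pos.mpr (by positivity)).ne'
  have hac : (a : ℂ) = 2 * π * r ^ 2 / t := by rw [ha]; push_cast; rfl
  have h1 : ∀ w : ℤ, ((parity N ^ w * pBM t (x + 2 * π * r * (w : ℝ)) x' : ℝ) : ℂ)
      = Complex.exp (-X ^ 2 / (2 * t)) / Real.sqrt (2 * π * t)
        * Complex.exp (-π * a * w ^ 2 + 2 * π * b * w) := by
    intro w
    have e1 : ((parity N ^ w : ℝ) : ℂ) = Complex.exp (w * (N * (π * Complex.I))) := by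
      rw [Complex.exp_int_mul, Complex.exp_nat_mul, Complex.exp_pi_mul_I, parity]; push_cast; rfl
    have e2 : ((pBM t (x + 2 * π * r * (w : ℝ)) x' : ℝ) : ℂ)
        = Complex.exp (-(X + 2 * π * r * w) ^ 2 / (2 * t)) / Real.sqrt (2 * π * t) := by
      rw [pBM, hX]; push_cast; ring_nf
    rw [Complex.ofReal_mul, e1, e2, mul_div_assoc', div_mul_eq_mul_div, ← Complex.exp_add,
      ← Complex.exp_add]
    congr 2
    rw [hac, hb]
    field_simp
    ring
  have h2 : ∀ n : ℤ, Complex.exp (-π / a * (n + Complex.I * b) ^ 2)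
      = Complex.exp (X ^ 2 / (2 * t)) * gaussTerm (-(N / 2)) 0 n (X / r, t / (2 * r ^ 2)) := by
    intro n
    rw [gaussTerm, pow_zero, one_mul, ← Complex.exp_add]
    congr 1
    rw [hac, hb]
    have : (n : ℂ) + Complex.I * (-(r * X / t) + Complex.I * N / 2)
        = (n - N / 2) - Complex.I * (r * X / t) := by
      linear_combination ((N : ℂ) / 2) * Complex.I_sq
    rw [this, sub_sq, mul_pow, Complex.I_sq]
    push_cast
    field_simp
    ring
  rw [pWrapped, Complex.ofReal_tsum, tsum_congr h1, tsum_mul_left, P, tsum_congr h2, tsum_mul_left,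
    hsqrt, gaussSeries, ← hprodc]
  have hexp : Complex.exp (-X ^ 2 / (2 * t)) * Complex.exp (X ^ 2 / (2 * t)) = 1 := by
    rw [← Complex.exp_add, neg_div, neg_add_cancel, Complex.exp_zero]
  generalize Complex.exp (-X ^ 2 / (2 * t)) = E₁ at hexp ⊢
  generalize Complex.exp (X ^ 2 / (2 * t)) = E₂ at hexp ⊢
  generalize (∑' n : ℤ, gaussTerm (-(N / 2)) 0 n (X / r, t / (2 * r ^ 2))) = S
  field_simp
  linear_combination S * hexp

/-! ### Theta functions of degree `N` -/

/-- Entire functions with the quasi-periods `2 π` and `2 i N κ` of the theta functions of degree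
`N`. -/
def thetaSpace (N : ℕ) (κ : ℝ) : Submodule ℂ (ℂ → ℂ) where
  carrier := {f | Differentiable ℂ f ∧ (∀ y, f (y + 2 * π) = (-1) ^ N * f y) ∧
    ∀ y, f (y + 2 * N * κ * Complex.I)
      = (-1) ^ (N + 1) * Complex.exp (N ^ 2 * κ - Complex.I * N * y) * f y}
  add_mem' := by
    rintro f g ⟨hf1, hf2, hf3⟩ ⟨hg1, hg2, hg3⟩
    refine ⟨hf1.add hg1, fun y => ?_, fun y => ?_⟩
    · simp only [Pi.add_apply, hf2, hg2]; ring
    · simp only [Pi.add_apply, hf3, hg3]; ring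
  zero_mem' := ⟨differentiable_const 0, fun y => by simp, fun y => by simp⟩
  smul_mem' := by
    rintro c f ⟨hf1, hf2, hf3⟩
    refine ⟨hf1.const_smul c, fun y => ?_, fun y => ?_⟩
    · simp only [Pi.smul_apply, smul_eq_mul, hf2]; ring
    · simp only [Pi.smul_apply, smul_eq_mul, hf3]; ring

/-- The Fourier coefficient at the frequency `n - N/2`. -/
def thetaCoeff (N : ℕ) (n : ℤ) (f : ℂ → ℂ) : ℂ :=
  ∫ y in (0 : ℝ)..2 * π, f y * Complex.exp (-(Complex.I * (n - N / 2) * y))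

/-- Cauchy's theorem on a rectangle whose vertical sides cancel by periodicity. -/
theorem integral_add_eq_of_periodic {g : ℂ → ℂ} (hg : Differentiable ℂ g)
    (hper : ∀ y, g (y + 2 * π) = g y) (Y : ℝ) :
    ∫ x in (0 : ℝ)..2 * π, g (x + Y * Complex.I) = ∫ x in (0 : ℝ)..2 * π, g x := by
  have h := Complex.integral_boundary_rect_eq_zero_of_differentiableOn g 0
    ((2 * π : ℝ) + Y * Complex.I) hg.differentiableOn
  simp only [Complex.zero_re, Complex.zero_im, Complex.add_re, Complex.ofReal_re, Complex.mul_re,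
    Complex.I_re, mul_zero, Complex.ofReal_im, Complex.I_im, mul_one, sub_self, add_zero,
    Complex.add_im, Complex.mul_im, zero_add, zero_mul, Complex.ofReal_zero] at h
  have e : ∀ y : ℝ, g ((2 * π : ℝ) + y * Complex.I) = g (y * Complex.I) := by
    intro y
    rw [← hper (y * Complex.I)]; congr 1; push_cast; ring
  simp only [e] at h
  rw [add_sub_cancel_right, sub_eq_zero] at h
  exact h.symm

/-- Shifting the contour by the quasi-period 2iNκ multiplies the integrand by e^{-iNy} up to a
nonzero constant, which moves the frequency n to n + N. -/
theorem thetaCoeff_eq_mul {N : ℕ} {κ : ℝ} {f : ℂ → ℂ} (hf : f ∈ thetaSpace N κ) (n : ℤ) :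
    thetaCoeff N n f = (-1) ^ (N + 1) * Complex.exp (N ^ 2 * κ + 2 * N * κ * (n - N / 2))
      * thetaCoeff N (n + N) f := by
  obtain ⟨h1, h2, h3⟩ := hf
  set g : ℂ → ℂ := fun z => f z * Complex.exp (-(Complex.I * (n - N / 2) * z)) with hg
  have hgd : Differentiable ℂ g := h1.mul (by fun_prop)
  have hper : ∀ y, g (y + 2 * π) = g y := by
    intro y
    have e : Complex.exp (-(Complex.I * (n - N / 2) * (y + 2 * π)))
        = (-1) ^ N * Complex.exp (-(Complex.I * (n - N / 2) * y)) := by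
      rw [← Complex.exp_pi_mul_I, ← Complex.exp_nat_mul, ← Complex.exp_add]
      refine (Complex.exp_periodic.int_mul n _).symm.trans ?_
      congr 1
      ring
    have e2 : ((-1 : ℂ) ^ N) * (-1) ^ N = 1 := by rw [← mul_pow]; simp
    simp only [hg, h2, e]
    linear_combination (f y * Complex.exp (-(Complex.I * (n - N / 2) * y))) * e2
  have key := integral_add_eq_of_periodic hgd hper (2 * N * κ)
  rw [thetaCoeff, thetaCoeff, ← intervalIntegral.integral_const_mul]
  refine key.symm.trans (intervalIntegral.integral_congr fun x _ => ?_)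
  have e : Complex.exp (N ^ 2 * κ - Complex.I * N * x)
      * Complex.exp (-(Complex.I * (n - N / 2) * (x + 2 * N * κ * Complex.I)))
      = Complex.exp (N ^ 2 * κ + 2 * N * κ * (n - N / 2))
        * Complex.exp (-(Complex.I * ((n + N : ℤ) - N / 2) * x)) := by
    rw [← Complex.exp_add, ← Complex.exp_add]
    congr 1
    push_cast
    linear_combination (-(2 * N * κ * (n - N / 2)) : ℂ) * Complex.I_sq
  simp only [hg]
  push_cast at e ⊢
  rw [h3]
  linear_combination ((-1) ^ (N + 1) * f x) * e

/-- The upper bound N on the dimension: the recursion propagates zeros along each residue class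
modulo N, in both directions. -/
theorem thetaCoeff_eq_zero {N : ℕ} (hN : 0 < N) {κ : ℝ} {f : ℂ → ℂ} (hf : f ∈ thetaSpace N κ)
    (h : ∀ i : Fin N, thetaCoeff N (i : ℕ) f = 0) (n : ℤ) : thetaCoeff N n f = 0 := by
  have step : ∀ m : ℤ, thetaCoeff N m f = 0 ↔ thetaCoeff N (m + N) f = 0 := by
    intro m
    rw [thetaCoeff_eq_mul hf m]
    simp [Complex.exp_ne_zero]
  have hNz : (N : ℤ) ≠ 0 := by omega
  have hr : thetaCoeff N (n % N) f = 0 := by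
    have h1 := Int.emod_nonneg n hNz
    have h2 := Int.emod_lt_of_pos n (show (0 : ℤ) < N by omega)
    have := h ⟨(n % N).toNat, by omega⟩
    simpa [Int.toNat_of_nonneg h1] using this
  have hq : ∀ q : ℤ, thetaCoeff N (n % N + N * q) f = 0 := by
    intro q
    induction q with
    | zero => simpa using hr
    | succ i ih =>
      have := (step _).mp ih
      rwa [show n % N + N * (i : ℤ) + N = n % N + N * ((i : ℤ) + 1) by ring] at this
    | pred i ih =>
      refine (step _).mpr ?_
      rwa [show n % N + N * (-(i : ℤ) - 1) + N = n % N + N * -(i : ℤ) by ring]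
  have := hq (n / N)
  rwa [Int.emod_add_mul_ediv] at this

theorem eq_zero_of_thetaCoeff_eq_zero {N : ℕ} {κ : ℝ} {f : ℂ → ℂ} (hf : f ∈ thetaSpace N κ)
    (h : ∀ n, thetaCoeff N n f = 0) (x : ℝ) : f x = 0 := by
  obtain ⟨h1, h2, -⟩ := hf
  have : Fact (0 < 2 * π) := ⟨Real.two_pi_pos⟩
  -- The factor e^{iNx/2} compensates the sign (-1)^N and makes F a function on the circle. A zero
  -- coefficient sequence is summable, so the Fourier series converges to F pointwise.
  set F : ℝ → ℂ := fun x => f x * Complex.exp (Complex.I * (N / 2) * x) with hF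
  have hFc : Continuous F :=
    (h1.continuous.comp Complex.continuous_ofReal).mul (by fun_prop)
  have hFp : Function.Periodic F (2 * π) := by
    intro y
    have e : Complex.exp (Complex.I * (N / 2) * (y + 2 * π))
        = (-1) ^ N * Complex.exp (Complex.I * (N / 2) * y) := by
      rw [← Complex.exp_pi_mul_I, ← Complex.exp_nat_mul, ← Complex.exp_add]
      congr 1
      ring
    have e2 : ((-1 : ℂ) ^ N) * (-1) ^ N = 1 := by rw [← mul_pow]; simp
    simp only [hF]
    push_cast
    rw [h2, e]
    linear_combination (f y * Complex.exp (Complex.I * (N / 2) * y)) * e2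
  let G : C(AddCircle (2 * π), ℂ) := ⟨hFp.lift, continuous_coinduced_dom.mpr hFc⟩
  have hG : fourierCoeff G = 0 := by
    funext n
    rw [fourierCoeff_eq_intervalIntegral _ n 0, zero_add, Pi.zero_apply]
    have : ∫ x in (0 : ℝ)..2 * π, (fourier (-n)) (x : AddCircle (2 * π)) • G x
        = thetaCoeff N n f := by
      rw [thetaCoeff]
      refine intervalIntegral.integral_congr fun x _ => ?_
      have e : Complex.exp (2 * π * Complex.I * ((-n : ℤ) : ℂ) * x / (2 * π : ℝ))
          * Complex.exp (Complex.I * (N / 2) * x)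
          = Complex.exp (-(Complex.I * (n - N / 2) * x)) := by
        rw [← Complex.exp_add]
        congr 1
        have := Real.pi_ne_zero
        push_cast
        field_simp
        ring
      change (fourier (-n)) (x : AddCircle (2 * π)) • F x = _
      rw [fourier_coe_apply, smul_eq_mul, hF]
      linear_combination (f x) * e
    rw [this, h n, smul_zero]
  have hs : Summable (fourierCoeff G) := by rw [hG]; exact summable_zero
  have := has_pointwise_sum_fourier_series_of_summable hs (x : AddCircle (2 * π))
  simp only [hG, Pi.zero_apply, zero_smul] at this
  have h0 : F x = 0 := this.unique hasSum_zero
  exact (mul_eq_zero.mp h0).resolve_right (Complex.exp_ne_zero _)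

theorem intervalIntegrable_thetaCoeff {N : ℕ} {κ : ℝ} {f : ℂ → ℂ} (hf : f ∈ thetaSpace N κ) (n : ℤ) :
    IntervalIntegrable (fun y : ℝ => f y * Complex.exp (-(Complex.I * (n - N / 2) * y)))
      MeasureTheory.volume 0 (2 * π) :=
  ((hf.1.continuous.comp Complex.continuous_ofReal).mul (by fun_prop)).intervalIntegrable _ _

/-- The first `N` Fourier coefficients. -/
def thetaCoeffs (N : ℕ) (κ : ℝ) : thetaSpace N κ →ₗ[ℂ] (Fin N → ℂ) where
  toFun f i := thetaCoeff N (i : ℕ) f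
  map_add' f g := by
    funext i
    simp only [Submodule.coe_add, Pi.add_apply, thetaCoeff, add_mul]
    exact intervalIntegral.integral_add (intervalIntegrable_thetaCoeff f.2 _)
      (intervalIntegrable_thetaCoeff g.2 _)
  map_smul' c f := by
    funext i
    simp only [Submodule.coe_smul, Pi.smul_apply, thetaCoeff, smul_eq_mul, mul_assoc,
      intervalIntegral.integral_const_mul, RingHom.id_apply]

/-- Interpolation: `N` functions of `thetaSpace N κ` which are unisolvent at `N` real points span the
space, as functions on the real line. -/
theorem exists_eq_sum_of_mem_thetaSpace {N : ℕ} (hN : 0 < N) {κ : ℝ} {P : Fin N → ℂ → ℂ}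
    (hP : ∀ j, P j ∈ thetaSpace N κ) {v : Fin N → ℝ}
    (hdet : (Matrix.of fun j k => P j (v k)).det ≠ 0) {f : ℂ → ℂ} (hf : f ∈ thetaSpace N κ) :
    ∃ a : Fin N → ℂ, ∀ x : ℝ, f x = ∑ j, a j * P j x := by
  set Pt : Fin N → thetaSpace N κ := fun j => ⟨P j, hP j⟩
  set comb : (Fin N → ℂ) →ₗ[ℂ] thetaSpace N κ := Fintype.linearCombination ℂ Pt
  have hcomb : ∀ (a : Fin N → ℂ) (z : ℂ), (comb a : ℂ → ℂ) z = ∑ j, a j * P j z := by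
    intro a z
    simp [comb, Fintype.linearCombination_apply, Pt, Finset.sum_apply]
  have hzero : ∀ g : thetaSpace N κ, thetaCoeffs N κ g = 0 → ∀ x : ℝ, (g : ℂ → ℂ) x = 0 :=
    fun g hg => eq_zero_of_thetaCoeff_eq_zero g.2
      (thetaCoeff_eq_zero hN g.2 fun i => congrFun hg i)
  -- A combination with vanishing coefficients vanishes at the points v, so unisolvence gives
  -- injectivity. Between spaces of dimension N this is surjectivity, and some combination has the
  -- same first N coefficients as f.
  have hinj : Function.Injective ((thetaCoeffs N κ).comp comb) := by
    rw [← LinearMap.ker_eq_bot, LinearMap.ker_eq_bot']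
    intro b hb
    have h0 := hzero _ hb
    by_contra hne
    refine hdet (Matrix.exists_vecMul_eq_zero_iff.mp ⟨b, hne, ?_⟩)
    funext k
    have := h0 (v k)
    rw [hcomb] at this
    simpa [Matrix.vecMul, dotProduct] using this
  obtain ⟨a, ha⟩ := LinearMap.injective_iff_surjective.mp hinj (thetaCoeffs N κ ⟨f, hf⟩)
  refine ⟨a, fun x => ?_⟩
  have := hzero (⟨f, hf⟩ - comb a) (by
    rw [map_sub, sub_eq_zero]; exact ha.symm) x
  rw [← hcomb]
  exact sub_eq_zero.mp (by simpa using this)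

/-- Interpolation in one coordinate after another. The number n of coordinates is separated from the
number N of nodes for the sake of the induction. -/
theorem eq_sum_of_slices {N n : ℕ} (v : Fin N → ℝ) (e : Fin N → ℝ → ℂ) (F : (Fin n → ℝ) → ℂ)
    (h : ∀ j x, F x = ∑ i, e i (x j) * F (Function.update x j (v i))) (x : Fin n → ℝ) :
    F x = ∑ i : Fin n → Fin N, (∏ j, e (i j) (x j)) * F (v ∘ i) := by
  induction n with
  | zero => simp [Subsingleton.elim x (v ∘ default)]
  | succ n ih =>
    rw [h 0 x, ← (Fin.consEquiv fun _ => Fin N).sum_comp, Fintype.sum_prod_type]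
    refine Finset.sum_congr rfl fun i _ => ?_
    have hx : Function.update x 0 (v i) = Fin.cons (v i) (Fin.tail x) := by
      rw [← Fin.update_cons_zero (x 0), Fin.cons_self_tail]
    rw [hx, ih (fun y => F (Fin.cons (v i) y)) (fun j y => ?_) (Fin.tail x), Finset.mul_sum]
    · refine Finset.sum_congr rfl fun i' _ => ?_
      rw [Fin.prod_univ_succ]
      have : v ∘ (Fin.cons i i' : Fin (n + 1) → Fin N)
          = (Fin.cons (v i) (v ∘ i') : Fin (n + 1) → ℝ) := by
        funext k
        refine Fin.cases ?_ (fun k => ?_) k <;> simp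
      change _ = _ * F (v ∘ (Fin.cons i i' : Fin (n + 1) → Fin N))
      rw [this]
      simp only [Fin.consEquiv_apply, Fin.cons_zero, Fin.cons_succ, Fin.tail]
      ring
    · have := h j.succ (Fin.cons (v i) y)
      simpa only [Fin.cons_succ, Fin.cons_update] using this

/-- An alternating function whose slices are interpolated at `v` is a determinant. -/
theorem eq_mul_det_of_slices {N : ℕ} (v : Fin N → ℝ) (e : Fin N → ℝ → ℂ) (F : (Fin N → ℝ) → ℂ)
    (h : ∀ j x, F x = ∑ i, e i (x j) * F (Function.update x j (v i)))
    (halt : ∀ (σ : Equiv.Perm (Fin N)) x, F (x ∘ σ) = (σ.sign : ℤ) * F x) (x : Fin N → ℝ) :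
    F x = F v * (Matrix.of fun i j => e i (x j)).det := by
  rw [eq_sum_of_slices v e F h x, Matrix.det_apply', Finset.mul_sum]
  symm
  refine Fintype.sum_of_injective (fun σ : Equiv.Perm (Fin N) => (σ : Fin N → Fin N))
    DFunLike.coe_injective _ _ (fun i hi => ?_) (fun σ => ?_)
  -- A repeated node contributes nothing: swapping the two equal arguments fixes the point but
  -- changes the sign of F.
  · have hni : ¬ Function.Injective i := fun hinj =>
      hi ⟨Equiv.ofBijective i (Finite.injective_iff_bijective.mp hinj), rfl⟩
    obtain ⟨a, b, hab, hne⟩ := Function.not_injective_iff.mp hni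
    have h1 := halt (Equiv.swap a b) (v ∘ i)
    have h2 : (v ∘ i) ∘ Equiv.swap a b = v ∘ i := by
      funext k
      simp only [Function.comp]
      by_cases hka : k = a
      · rw [hka, Equiv.swap_apply_left, hab]
      · by_cases hkb : k = b
        · rw [hkb, Equiv.swap_apply_right, hab]
        · rw [Equiv.swap_apply_of_ne_of_ne hka hkb]
    rw [h2, Equiv.Perm.sign_swap hne] at h1
    have : F (v ∘ i) = 0 := by
      push_cast at h1
      linear_combination h1 / 2
    rw [this, mul_zero]
  · rw [halt σ v]
    simp only [Matrix.of_apply]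
    ring

/-- Two alternating functions with slices in `thetaSpace N κ` are proportional. -/
theorem alternating_mul_det_eq {N : ℕ} (hN : 0 < N) {κ : ℝ} {P : Fin N → ℂ → ℂ}
    (hP : ∀ j, P j ∈ thetaSpace N κ) {v : Fin N → ℝ}
    (hdet : (Matrix.of fun j k => P j (v k)).det ≠ 0) (F : (Fin N → ℝ) → ℂ)
    (halt : ∀ (σ : Equiv.Perm (Fin N)) x, F (x ∘ σ) = (σ.sign : ℤ) * F x)
    (hslice : ∀ x, ∃ f ∈ thetaSpace N κ, ∀ t : ℝ, F (Function.update x ⟨0, hN⟩ t) = f t)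
    (x : Fin N → ℝ) :
    F x * (Matrix.of fun j k => P j (v k)).det = F v * (Matrix.of fun j k => P j (x k)).det := by
  set M := Matrix.of fun j k => P j (v k) with hM
  have hu : IsUnit M.det := isUnit_iff_ne_zero.mpr hdet
  -- The cardinal functions of the interpolation at v, obtained by inverting the matrix of values.
  set e : Fin N → ℝ → ℂ := fun i t => ∑ j, M⁻¹ i j * P j t with he
  have hinterp : ∀ f ∈ thetaSpace N κ, ∀ t : ℝ, f t = ∑ i, e i t * f (v i) := by
    intro f hf t
    obtain ⟨a, ha⟩ := exists_eq_sum_of_mem_thetaSpace hN hP hdet hf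
    have h1 : ∀ j, ∑ i, e i t * P j (v i) = P j t := by
      intro j
      have : ∑ i, e i t * P j (v i) = (M * (M⁻¹ * Matrix.of fun j (_ : Unit) => P j t)) j () := by
        rw [Matrix.mul_apply]
        refine Finset.sum_congr rfl fun i _ => ?_
        rw [Matrix.mul_apply, mul_comm]
        rfl
      rw [this, Matrix.mul_nonsing_inv_cancel_left _ _ hu]
      rfl
    simp only [ha, Finset.mul_sum]
    rw [Finset.sum_comm]
    refine Finset.sum_congr rfl fun j _ => ?_
    rw [← h1 j, Finset.mul_sum]
    refine Finset.sum_congr rfl fun i _ => by ring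
  -- Slices are controlled in coordinate 0 only; antisymmetry transports this to coordinate j by a
  -- transposition.
  have hall : ∀ j x, F x = ∑ i, e i (x j) * F (Function.update x j (v i)) := by
    intro j x
    set σ := Equiv.swap (⟨0, hN⟩ : Fin N) j with hσ
    have hup : ∀ t, Function.update x j t = Function.update (x ∘ σ) ⟨0, hN⟩ t ∘ σ := by
      intro t
      funext k
      simp only [Function.comp, Function.update_apply]
      by_cases hk : k = j
      · subst hk; simp [hσ]
      · have : σ k ≠ ⟨0, hN⟩ := by
          intro h
          apply hk
          have := congrArg σ h
          simpa [hσ] using this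
        rw [if_neg hk, if_neg this]
        simp [hσ]
    obtain ⟨f, hf, hfe⟩ := hslice (x ∘ σ)
    have hF : ∀ t : ℝ, F (Function.update x j t) = (σ.sign : ℤ) * f t := by
      intro t
      rw [hup, halt, hfe]
    have h0 := hF (x j)
    rw [Function.update_eq_self] at h0
    rw [h0, hinterp f hf, Finset.mul_sum]
    refine Finset.sum_congr rfl fun i _ => ?_
    rw [hF]
    ring
  rw [eq_mul_det_of_slices v e F hall halt x]
  have : (Matrix.of fun i j => e i (x j)) = M⁻¹ * Matrix.of fun j k => P j (x k) := by
    ext i j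
    rw [Matrix.mul_apply]
    rfl
  rw [this, Matrix.det_mul, Matrix.det_nonsing_inv]
  have := Ring.inverse_mul_cancel M.det hu
  linear_combination (F v * (Matrix.of fun j k => P j (x k)).det) * this

/-! ### The determinantal formula -/

/-- `ϑ₁(z / 2π; i s)`. -/
def thetaFn (s : ℝ) (z : ℂ) : ℂ := theta1 (z / (2 * π)) (Complex.I * (s : ℂ))

theorem thetaFn_eq (s : ℝ) (z : ℂ) : thetaFn s z = -gaussSeries (-1 / 2) 0 (z + π, π * s) := by
  have : (π : ℂ) ≠ 0 := by exact_mod_cast Real.pi_ne_zero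
  rw [thetaFn, theta1_eq_gaussSeries]
  congr 3
  field_simp

theorem thetaFn_ofReal (s y : ℝ) : thetaFn s (y : ℂ) = theta1R (y / (2 * π)) s := by
  rw [ofReal_theta1R, thetaFn]; push_cast; rfl

theorem differentiable_gaussSeries_fst (a : ℝ) (m : ℕ) {s : ℂ} (hs : 0 < s.re) :
    Differentiable ℂ fun z => gaussSeries a m (z, s) := fun y =>
  (hasDerivAt_gaussSeries_fst a m y hs).differentiableAt

theorem differentiable_thetaFn {s : ℝ} (hs : 0 < s) : Differentiable ℂ (thetaFn s) := by
  have h : thetaFn s = fun z => -gaussSeries (-1 / 2) 0 (z + π, π * s) := funext (thetaFn_eq s)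
  rw [h]
  have hre : 0 < ((π : ℂ) * s).re := by
    rw [← Complex.ofReal_mul, Complex.ofReal_re]; positivity
  exact ((differentiable_gaussSeries_fst _ _ hre).comp (differentiable_id.add_const (π : ℂ))).neg

theorem thetaFn_add_two_pi (s : ℝ) (z : ℂ) : thetaFn s (z + 2 * π) = -thetaFn s z := by
  rw [thetaFn_eq, thetaFn_eq, show z + 2 * π + π = z + π + 2 * π by ring, gaussSeries_add_two_pi]
  have : Complex.exp (2 * π * Complex.I * ((-1 / 2 : ℝ) : ℂ)) = -1 := by
    rw [← Complex.exp_neg_pi_mul_I]; congr 1; push_cast; ring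
  rw [this]; ring

theorem thetaFn_sub_two_pi (s : ℝ) (z : ℂ) : thetaFn s (z - 2 * π) = -thetaFn s z := by
  have := thetaFn_add_two_pi s (z - 2 * π)
  rw [sub_add_cancel] at this
  rw [this, neg_neg]

theorem thetaFn_neg (s : ℝ) (z : ℂ) : thetaFn s (-z) = -thetaFn s z := by
  rw [← thetaFn_sub_two_pi, thetaFn_eq, thetaFn_eq, ← gaussSeries_half_neg]
  congr 3
  ring

theorem thetaFn_add_quasiPeriod (s : ℝ) (z : ℂ) :
    thetaFn s (z + 2 * π * s * Complex.I)
      = -Complex.exp (π * s - Complex.I * z) * thetaFn s z := by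
  have h := gaussSeries_add_quasiPeriod (-1 / 2) 1 (z + π) (π * s)
  rw [thetaFn_eq, thetaFn_eq, show z + 2 * π * s * Complex.I + π
    = z + π + 2 * Complex.I * (1 : ℤ) * (π * s) by push_cast; ring, h]
  have : Complex.exp (((1 : ℤ) : ℂ) ^ 2 * (π * s) - Complex.I * ((1 : ℤ) : ℂ) * (z + π))
      = -Complex.exp (π * s - Complex.I * z) := by
    rw [← mul_neg_one, ← Complex.exp_neg_pi_mul_I, ← Complex.exp_add]
    congr 1; push_cast; ring
  rw [this]; ring

theorem thetaFn_sub_quasiPeriod (s : ℝ) (z : ℂ) :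
    thetaFn s (z - 2 * π * s * Complex.I)
      = -Complex.exp (π * s + Complex.I * z) * thetaFn s z := by
  rw [← neg_neg (z - _), thetaFn_neg, show -(z - 2 * π * s * Complex.I)
    = -z + 2 * π * s * Complex.I by ring, thetaFn_add_quasiPeriod, thetaFn_neg]
  ring_nf

theorem theta1R_neg (v s : ℝ) : theta1R (-v) s = -theta1R v s := by
  have hpi := Real.pi_pos
  have h := thetaFn_neg s ((2 * π * v : ℝ) : ℂ)
  rw [← Complex.ofReal_neg, thetaFn_ofReal, thetaFn_ofReal] at h
  have e1 : -(2 * π * v) / (2 * π) = -v := by field_simp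
  have e2 : 2 * π * v / (2 * π) = v := by field_simp
  rw [e1, e2] at h
  exact_mod_cast h

theorem theta1R_one_sub (v s : ℝ) : theta1R (1 - v) s = theta1R v s := by
  have hpi := Real.pi_pos
  have h := thetaFn_add_two_pi s ((-(2 * π * v) : ℝ) : ℂ)
  have e0 : ((-(2 * π * v) : ℝ) : ℂ) + 2 * π = ((2 * π * (1 - v) : ℝ) : ℂ) := by
    push_cast; ring
  rw [e0, thetaFn_ofReal, thetaFn_ofReal] at h
  have e1 : 2 * π * (1 - v) / (2 * π) = 1 - v := by field_simp
  have e2 : -(2 * π * v) / (2 * π) = -v := by field_simp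
  rw [e1, e2, theta1R_neg, Complex.ofReal_neg, neg_neg] at h
  exact_mod_cast h

/-- `κ_N / r`. -/
def kappaUnit (N : ℕ) : ℝ := π / 2 * (2 * (N : ℝ) - 3 + parity N)

theorem parity_even {N : ℕ} (h : Even N) : parity N = 1 := by rw [parity, h.neg_one_pow]

theorem parity_odd {N : ℕ} (h : Odd N) : parity N = -1 := by rw [parity, h.neg_one_pow]

/-- κ_N/r is an odd multiple of π for either parity. The resulting sign gives the slices of the
theta product the same multiplier as the lattice kernels. -/
theorem exp_kappaUnit (N : ℕ) : Complex.exp (Complex.I * (kappaUnit N : ℂ)) = -1 := by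
  rcases N.even_or_odd with h | h
  · have := parity_even h
    obtain ⟨m, rfl⟩ := h
    rw [kappaUnit, this, ← Complex.exp_pi_mul_I]
    refine Complex.exp_eq_exp_iff_exists_int.mpr ⟨m - 1, ?_⟩
    push_cast; ring
  · have := parity_odd h
    obtain ⟨m, rfl⟩ := h
    rw [kappaUnit, this, ← Complex.exp_pi_mul_I]
    refine Complex.exp_eq_exp_iff_exists_int.mpr ⟨m - 1, ?_⟩
    push_cast; ring

/-- The equidistant configuration in units of `r`. -/
def equidistantUnit (N : ℕ) (j : Fin N) : ℝ :=
  π / (2 * (N : ℝ)) * (4 * ((j : ℝ) + 1) - 3 + parity N)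

/-- N times a lattice point is congruent modulo 2π to π for even N and to 0 for odd N, independently
of j. Hence all kernels based on the lattice share one quasi-period multiplier. -/
theorem exp_equidistantUnit {N : ℕ} (j : Fin N) :
    Complex.exp (Complex.I * N * (equidistantUnit N j : ℂ)) = (-1) ^ (N + 1) := by
  have hN : (N : ℂ) ≠ 0 := by
    exact_mod_cast (Nat.pos_of_ne_zero (by rintro rfl; exact j.elim0)).ne'
  have e : Complex.I * N * (equidistantUnit N j : ℂ)
      = Complex.I * (π / 2 * (4 * ((j : ℂ) + 1) - 3 + (parity N : ℂ))) := by
    rw [equidistantUnit]; push_cast; field_simp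
  rw [e]
  rcases N.even_or_odd with h | h
  · rw [parity_even h, h.add_one.neg_one_pow, ← Complex.exp_pi_mul_I]
    refine Complex.exp_eq_exp_iff_exists_int.mpr ⟨j, ?_⟩
    push_cast; ring
  · rw [parity_odd h, h.add_one.neg_one_pow]
    refine Eq.trans ?_ Complex.exp_zero
    refine Complex.exp_eq_exp_iff_exists_int.mpr ⟨j, ?_⟩
    push_cast; ring

/-- The wrapped heat kernel at the equidistant point `j`. -/
def latticeKernel (N : ℕ) (T : ℝ) (j : Fin N) (z : ℂ) : ℂ :=
  gaussSeries (-(N / 2)) 0 (z - equidistantUnit N j, π * T)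

theorem re_pi_mul_pos {T : ℝ} (hT : 0 < T) : 0 < ((π : ℂ) * T).re := by
  rw [← Complex.ofReal_mul, Complex.ofReal_re]
  exact mul_pos Real.pi_pos hT

theorem latticeKernel_mem {N : ℕ} {T : ℝ} (hT : 0 < T) (j : Fin N) :
    latticeKernel N T j ∈ thetaSpace N (π * T) := by
  refine ⟨(differentiable_gaussSeries_fst _ _ (re_pi_mul_pos hT)).comp
    (differentiable_id.sub_const _), fun y => ?_, fun y => ?_⟩
  · rw [latticeKernel, latticeKernel, add_sub_right_comm, gaussSeries_add_two_pi]
    congr 1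
    have : ((-1 : ℂ)) ^ N = (-1)⁻¹ ^ N := by norm_num
    rw [this, ← Complex.exp_pi_mul_I, ← Complex.exp_neg, ← Complex.exp_nat_mul]
    congr 1; push_cast; ring
  · have h := gaussSeries_add_quasiPeriod (-(N / 2)) N (y - equidistantUnit N j) (π * T)
    rw [latticeKernel, latticeKernel, show y + 2 * N * (π * T : ℝ) * Complex.I - equidistantUnit N j
      = y - equidistantUnit N j + 2 * Complex.I * (N : ℤ) * (π * T) by push_cast; ring, h]
    congr 1
    rw [← exp_equidistantUnit j, ← Complex.exp_add]
    congr 1; push_cast; ring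

/-- `ϑ₁(x̄) ∏ ϑ₁(x_k - x_j)` in units of `r`. -/
def thetaProd (N : ℕ) (T : ℝ) (y : Fin N → ℝ) : ℝ :=
  theta1R ((∑ j, y j - kappaUnit N) / (2 * π)) (N * T)
    * ∏ j : Fin N, ∏ k ∈ Finset.Ioi j, theta1R ((y k - y j) / (2 * π)) (N * T)

/-- The sum is symmetric and ϑ₁ is odd, so the product over pairs changes like a Vandermonde
determinant. -/
theorem thetaProd_comp_perm {N : ℕ} (T : ℝ) (σ : Equiv.Perm (Fin N)) (y : Fin N → ℝ) :
    thetaProd N T (y ∘ σ) = (σ.sign : ℤ) * thetaProd N T y := by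
  have h1 : ∑ j, (y ∘ σ) j = ∑ j, y j := Equiv.sum_comp σ y
  have h2 := σ.prod_Ioi_comp_eq_sign_mul_prod
    (f := fun j k => theta1R ((y k - y j) / (2 * π)) (N * T)) (fun i j => by
      rw [← theta1R_neg]; congr 1; ring)
  rw [thetaProd, thetaProd, h1]
  simp only [Function.comp]
  rw [h2]
  ring

/-- Exactly N = n + 1 factors involve coordinate 0: the centre of mass and n differences. The
remaining ones form the constant `D`. -/
theorem thetaProd_slice {n : ℕ} {T : ℝ} (hT : 0 < T) (y : Fin (n + 1) → ℝ) :
    ∃ f ∈ thetaSpace (n + 1) (π * T),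
      ∀ t : ℝ, ((thetaProd (n + 1) T (Function.update y 0 t) : ℝ) : ℂ) = f t := by
  set s : ℝ := ((n + 1 : ℕ) : ℝ) * T with hs
  have hs0 : 0 < s := by positivity
  set c : ℂ := (((∑ k : Fin n, y k.succ) - kappaUnit (n + 1) : ℝ) : ℂ) with hc
  set D : ℂ := ((∏ j : Fin n, ∏ k ∈ Finset.Ioi j,
    theta1R ((y k.succ - y j.succ) / (2 * π)) s : ℝ) : ℂ)
  have hquasi : ∀ z : ℂ, z + 2 * ((n + 1 : ℕ) : ℂ) * ((π * T : ℝ) : ℂ) * Complex.I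
      = z + 2 * π * s * Complex.I := by
    intro z; rw [hs]; push_cast; ring
  refine ⟨fun z => thetaFn s (z + c) * (∏ k : Fin n, thetaFn s (y k.succ - z)) * D,
    ⟨?_, fun z => ?_, fun z => ?_⟩, fun t => ?_⟩
  · have := differentiable_thetaFn hs0
    refine ((this.comp (differentiable_id.add_const c)).mul ?_).mul_const D
    refine Differentiable.fun_finsetProd fun k _ => ?_
    exact this.comp (differentiable_id.const_sub _)
  · have h1 : ∀ k : Fin n, thetaFn s (y k.succ - (z + 2 * π)) = -1 * thetaFn s (y k.succ - z) := by
      intro k; rw [← sub_sub, thetaFn_sub_two_pi]; ring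
    simp only [h1, Finset.prod_mul_distrib, Finset.prod_const, Finset.card_univ, Fintype.card_fin,
      add_right_comm z _ c, thetaFn_add_two_pi]
    ring
  · have h1 : ∀ k : Fin n, thetaFn s (y k.succ - (z + 2 * π * s * Complex.I))
        = -1 * Complex.exp (π * s + Complex.I * (y k.succ - z)) * thetaFn s (y k.succ - z) := by
      intro k; rw [← sub_sub, thetaFn_sub_quasiPeriod]; ring
    simp only [hquasi, h1, Finset.prod_mul_distrib, Finset.prod_const, Finset.card_univ,
      Fintype.card_fin, add_right_comm z _ c, thetaFn_add_quasiPeriod, ← Complex.exp_sum]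
    -- The other coordinates cancel between the centre of mass and the differences. Only κ_N
    -- survives, as a factor -1; this is the purpose of the x̄ factor.
    have e : Complex.exp (π * s - Complex.I * (z + c))
        * Complex.exp (∑ k : Fin n, ((π : ℂ) * s + Complex.I * (y k.succ - z)))
        = -Complex.exp (((n + 1 : ℕ) : ℂ) ^ 2 * ((π * T : ℝ) : ℂ)
          - Complex.I * ((n + 1 : ℕ) : ℂ) * z) := by
      rw [← Complex.exp_add, ← neg_one_mul, ← exp_kappaUnit (n + 1), ← Complex.exp_add]
      congr 1
      rw [Finset.sum_add_distrib, ← Finset.mul_sum Finset.univ _ Complex.I, Finset.sum_sub_distrib,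
        Finset.sum_const, Finset.sum_const, Finset.card_univ, Fintype.card_fin, hc, hs]
      push_cast
      simp only [nsmul_eq_mul]
      ring
    linear_combination (-(-1) ^ n * thetaFn s (z + c)
      * (∏ k : Fin n, thetaFn s (y k.succ - z)) * D) * e
  · have e : (t : ℂ) + c = ((∑ j, Function.update y 0 t j - kappaUnit (n + 1) : ℝ) : ℂ) := by
      rw [Fin.sum_univ_succ, hc]; push_cast; simp; ring
    have e2 : ∀ k : Fin n, (y k.succ : ℂ) - t = ((y k.succ - t : ℝ) : ℂ) := by
      intro k; push_cast; rfl
    simp only [e, e2, thetaFn_ofReal, D]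
    rw [thetaProd, Fin.prod_univ_succ, Fin.prod_Ioi_zero]
    simp only [Fin.prod_Ioi_succ]
    push_cast
    simp [hs, mul_assoc]

theorem thetaProd_mul_det {N : ℕ} (hN : 0 < N) {T : ℝ} (hT : 0 < T)
    (hdet : (Matrix.of fun j k => latticeKernel N T j (equidistantUnit N k)).det ≠ 0)
    (y : Fin N → ℝ) :
    (thetaProd N T y : ℂ) * (Matrix.of fun j k => latticeKernel N T j (equidistantUnit N k)).det
      = thetaProd N T (equidistantUnit N) * (Matrix.of fun j k => latticeKernel N T j (y k)).det := by
  refine alternating_mul_det_eq hN (fun j => latticeKernel_mem hT j) hdet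
    (fun y => (thetaProd N T y : ℂ)) (fun σ y => ?_) (fun y => ?_) y
  · rw [thetaProd_comp_perm]; push_cast; rfl
  · obtain ⟨n, rfl⟩ : ∃ n, N = n + 1 := ⟨N - 1, by omega⟩
    exact thetaProd_slice hT y

/-! ### Diagonalisation of the heat kernel matrix on the equidistant lattice -/

/-- The eigenvalues of the wrapped heat kernel on the equidistant lattice. -/
def latticeEigenvalue (N : ℕ) (T : ℝ) (i : ℕ) : ℝ :=
  ∑' m : ℤ, Real.exp (-(π * (N * (N * T))) * ((((i : ℝ) + 1) / N - 1 / 2) + m) ^ 2)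

/-- Needed for the unisolvence of the kernels at the lattice; the triple product displays the sum as
a product of positive factors. -/
theorem latticeEigenvalue_pos {N : ℕ} (hN : 0 < N) {T : ℝ} (hT : 0 < T) (i : ℕ) :
    0 < latticeEigenvalue N T i := by
  have hNR : (0 : ℝ) < N := by exact_mod_cast hN
  have hs : 0 < N * (N * T) := by positivity
  have h1 := exp_neg_two_pi_lt_one hs
  have h0 := Real.exp_pos (-(2 * π * (N * (N * T))))
  rw [latticeEigenvalue, tsum_exp_neg_sq hs]
  have hp : ∀ c : ℝ, 0 < c → 0 < ∏' n : ℕ, (1 + c * Real.exp (-(2 * π * (N * (N * T)))) ^ n) :=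
    fun c hc => tprod_pos_of_summable_sub_one (by
      simpa using ((summable_geometric_of_lt_one h0.le h1).mul_left c).norm) fun n => by positivity
  have := eulerProd_pos h0 h1
  have := hp _ (Real.exp_pos (-(2 * π * (N * (N * T))) * (1 / 2 + (((i : ℝ) + 1) / N - 1 / 2))))
  have := hp _ (Real.exp_pos (-(2 * π * (N * (N * T))) * (1 / 2 - (((i : ℝ) + 1) / N - 1 / 2))))
  positivity

/-- The matrix of the discrete Fourier transform. -/
def dft (N : ℕ) : Matrix (Fin N) (Fin N) ℂ :=
  Matrix.of fun i k => Complex.exp (2 * π * Complex.I * ((((i : ℂ) + 1) / N - 1 / 2) * k))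

theorem dft_mul_conjTranspose {N : ℕ} (hN : 0 < N) :
    dft N * (dft N).conjTranspose = (N : ℂ) • (1 : Matrix (Fin N) (Fin N) ℂ) := by
  have hNc : (N : ℂ) ≠ 0 := by exact_mod_cast hN.ne'
  have hζ := Complex.isPrimitiveRoot_exp N hN.ne'
  set ζ := Complex.exp (2 * π * Complex.I / N) with hζd
  have hζ0 : ζ ≠ 0 := Complex.exp_ne_zero _
  ext i l
  have hterm : ∀ k : Fin N, dft N i k * (dft N).conjTranspose k l = (ζ ^ (i : ℕ) / ζ ^ (l : ℕ)) ^ (k : ℕ) := by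
    intro k
    rw [Matrix.conjTranspose_apply, dft, Matrix.of_apply, Matrix.of_apply, hζd,
      ← Complex.exp_nat_mul, ← Complex.exp_nat_mul, ← Complex.exp_sub, ← Complex.exp_nat_mul,
      ← starRingEnd_apply, ← Complex.exp_conj, ← Complex.exp_add]
    congr 1
    simp only [map_mul, map_sub, map_div₀, map_add, map_one, map_natCast, map_ofNat,
      Complex.conj_I, Complex.conj_ofReal]
    field_simp
    ring
  rw [Matrix.mul_apply, Finset.sum_congr rfl fun k _ => hterm k,
    Fin.sum_univ_eq_sum_range (fun k => (ζ ^ (i : ℕ) / ζ ^ (l : ℕ)) ^ k) N]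
  by_cases h : i = l
  · subst h
    simp [hζ0]
  · have hne : ζ ^ (i : ℕ) / ζ ^ (l : ℕ) ≠ 1 := by
      intro h1
      rw [div_eq_one_iff_eq (pow_ne_zero _ hζ0)] at h1
      exact h (Fin.ext (hζ.pow_inj i.2 l.2 h1))
    rw [geom_sum_eq hne, div_pow, ← pow_mul, ← pow_mul, mul_comm (i : ℕ), mul_comm (l : ℕ),
      pow_mul, pow_mul, hζ.pow_eq_one]
    simp [h]

/-- The entries depend only on the difference of lattice points, 2π(k - j)/N, so the matrix is
circulant up to a twist. Collecting frequencies modulo N diagonalises it. -/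
theorem latticeKernel_equidistant {N : ℕ} (hN : 0 < N) {T : ℝ} (hT : 0 < T) :
    (Matrix.of fun j k => latticeKernel N T j (equidistantUnit N k))
      = (dft N).conjTranspose * Matrix.diagonal (fun i : Fin N => (latticeEigenvalue N T i : ℂ)) * dft N := by
  have hNR : (N : ℝ) ≠ 0 := by exact_mod_cast hN.ne'
  have hNc : (N : ℂ) ≠ 0 := by exact_mod_cast hN.ne'
  have : NeZero N := ⟨hN.ne'⟩
  ext j k
  rw [Matrix.mul_assoc, Matrix.mul_apply]
  simp only [Matrix.diagonal_mul, Matrix.of_apply, Matrix.conjTranspose_apply]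
  rw [latticeKernel, gaussSeries]
  have hu : (equidistantUnit N k : ℂ) - equidistantUnit N j = 2 * π * ((k : ℂ) - j) / N := by
    rw [equidistantUnit, equidistantUnit]; push_cast; field_simp; ring
  have hs := summable_gaussTerm (-(N / 2)) 0
    (p := ((equidistantUnit N k : ℂ) - equidistantUnit N j, (π : ℂ) * T)) (re_pi_mul_pos hT)
  -- Frequencies are written as mN + i + 1. The shift by 1 matches the residues (i + 1)/N - 1/2 used
  -- for the eigenvalues.
  set E : ℤ × Fin N ≃ ℤ := (Int.divModEquiv N).symm.trans (Equiv.addRight 1) with hE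
  have hEv : ∀ m i, ((E (m, i) : ℤ) : ℂ) = m * N + i + 1 := by
    intro m i; simp [hE]
  set G : ℤ → ℂ := fun n => gaussTerm (-(N / 2)) 0 n
    ((equidistantUnit N k : ℂ) - equidistantUnit N j, (π : ℂ) * T) with hG
  have hsum : ∑' n, G n = ∑' (i : Fin N) (m : ℤ), G (E (m, i)) := by
    rw [← E.tsum_eq, ← (Equiv.prodComm _ _).tsum_eq]
    exact Summable.tsum_prod (f := fun p : Fin N × ℤ => G (E (p.2, p.1)))
      ((Equiv.prodComm _ _).summable_iff.mpr (E.summable_iff.mpr hs))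
  rw [hsum, tsum_fintype]
  refine Finset.sum_congr rfl fun i _ => ?_
  have hterm : ∀ m : ℤ, G (E (m, i)) = star (dft N i j) * dft N i k
        * (Real.exp (-(π * (N * (N * T))) * ((((i : ℝ) + 1) / N - 1 / 2) + m) ^ 2) : ℝ) := by
    intro m
    simp only [hG, gaussTerm, pow_zero, one_mul]
    rw [hEv, hu, dft,
      Matrix.of_apply, Matrix.of_apply, ← starRingEnd_apply, ← Complex.exp_conj, Complex.ofReal_exp,
      ← Complex.exp_add, ← Complex.exp_add]
    -- The phases agree only modulo 2πi; the discrepancy m(k - j) comes from the multiple mN of the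
    -- period.
    refine Complex.exp_eq_exp_iff_exists_int.mpr ⟨m * ((k : ℤ) - j), ?_⟩
    simp only [map_mul, map_sub, map_div₀, map_add, map_one, map_natCast, map_ofNat,
      Complex.conj_I, Complex.conj_ofReal]
    push_cast
    field_simp
    ring
  rw [tsum_congr hterm, tsum_mul_left, latticeEigenvalue, Complex.ofReal_tsum]
  ring

theorem det_latticeKernel_equidistant {N : ℕ} (hN : 0 < N) {T : ℝ} (hT : 0 < T) :
    (Matrix.of fun j k => latticeKernel N T j (equidistantUnit N k)).det
      = ((N : ℝ) ^ N * ∏ i ∈ Finset.range N, latticeEigenvalue N T i : ℝ) := by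
  have h := congrArg Matrix.det (dft_mul_conjTranspose hN)
  rw [Matrix.det_mul, Matrix.det_smul, Matrix.det_one, mul_one, Fintype.card_fin] at h
  rw [latticeKernel_equidistant hN hT, Matrix.det_mul, Matrix.det_mul, Matrix.det_diagonal,
    Finset.prod_range]
  push_cast
  rw [← h]
  ring

/-! ### The theta product at the equidistant configuration -/

theorem prod_Iio_sub {N : ℕ} (f : ℕ → ℝ) :
    ∏ j : Fin N, ∏ k ∈ Finset.Ioi j, f (k - j) = ∏ m ∈ Finset.range N, ∏ d ∈ Finset.range m, f (d + 1) := by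
  rw [Finset.prod_range, Finset.prod_comm' (t' := Finset.univ) (s' := fun k => Finset.Iio k) (by simp)]
  refine Finset.prod_congr rfl fun k _ => ?_
  rw [← Finset.prod_range_reflect]
  have : ∏ j ∈ Finset.Iio k, f ((k : ℕ) - j) = ∏ j ∈ (Finset.Iio k).map Fin.valEmbedding, f ((k : ℕ) - j) := by
    rw [Finset.prod_map]; rfl
  rw [this, Fin.map_valEmbedding_Iio, Nat.Iio_eq_range]
  refine Finset.prod_congr rfl fun d hd => ?_
  have := Finset.mem_range.mp hd
  congr 1
  omega

/-- In the square, the row m is paired with the row N - 1 - m. By the symmetry d ↦ N - d the second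
row supplies exactly the factors missing from the first. -/
theorem sq_prod_range_prod_range {N : ℕ} (f : ℕ → ℝ) (hf : ∀ d, d ≤ N → f (N - d) = f d) :
    (∏ m ∈ Finset.range N, ∏ d ∈ Finset.range m, f (d + 1)) ^ 2
      = (∏ d ∈ Finset.range (N - 1), f (d + 1)) ^ N := by
  rw [sq]
  nth_rewrite 2 [← Finset.prod_range_reflect]
  rw [← Finset.prod_mul_distrib, Finset.prod_congr rfl, Finset.prod_const, Finset.card_range]
  intro m hm
  have hm' := Finset.mem_range.mp hm
  have : ∏ d ∈ Finset.range (N - 1 - m), f (d + 1) = ∏ d ∈ Finset.Ico m (N - 1), f (d + 1) := by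
    rw [Finset.prod_Ico_eq_prod_range, ← Finset.prod_range_reflect]
    refine Finset.prod_congr rfl fun d hd => ?_
    have hd' := Finset.mem_range.mp hd
    rw [← hf _ (by omega)]
    congr 1
    omega
  rw [this, Finset.prod_range_mul_prod_Ico _ (by omega)]

/-- The lattice is placed so that its shifted centre of mass is half a period, which is where the
value ϑ₁(1/2) comes from. -/
theorem sum_equidistantUnit {N : ℕ} (hN : 0 < N) :
    ∑ j, equidistantUnit N j - kappaUnit N = π := by
  have hNR : (N : ℝ) ≠ 0 := by exact_mod_cast hN.ne'
  have h1 : ∑ j : Fin N, ((j : ℕ) : ℝ) = N * (N - 1) / 2 := by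
    rw [Fin.sum_univ_eq_sum_range (fun j => (j : ℝ)) N]
    have : ∀ M : ℕ, ∑ j ∈ Finset.range M, (j : ℝ) = M * (M - 1) / 2 := by
      intro M
      induction M with
      | zero => simp
      | succ M ih => rw [Finset.sum_range_succ, ih]; push_cast; ring
    exact this N
  simp only [equidistantUnit, ← Finset.mul_sum, Finset.sum_add_distrib, Finset.sum_sub_distrib, h1,
    Finset.sum_const, Finset.card_univ, Fintype.card_fin, nsmul_eq_mul]
  rw [kappaUnit]
  field_simp
  ring

theorem thetaProd_equidistant {N : ℕ} (hN : 0 < N) (T : ℝ) :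
    thetaProd N T (equidistantUnit N) = theta1R (1 / 2) (N * T)
      * ∏ m ∈ Finset.range N, ∏ d ∈ Finset.range m, theta1R (((d : ℝ) + 1) / N) (N * T) := by
  have hNR : (N : ℝ) ≠ 0 := by exact_mod_cast hN.ne'
  have hpi := Real.pi_ne_zero
  have h := prod_Iio_sub (N := N) fun d => theta1R ((d : ℝ) / N) (N * T)
  push_cast at h
  rw [thetaProd, sum_equidistantUnit hN, ← h, show π / (2 * π) = 1 / 2 by field_simp]
  congr 1
  refine Finset.prod_congr rfl fun j _ => Finset.prod_congr rfl fun k hk => ?_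
  have hjk : (j : ℕ) ≤ k := (Finset.mem_Ioi.mp hk).le
  congr 1
  rw [Nat.cast_sub hjk, equidistantUnit, equidistantUnit]
  field_simp
  ring

theorem sq_thetaProd_equidistant {N : ℕ} (hN : 2 ≤ N) {T : ℝ} (hT : 0 < T) :
    0 < thetaProd N T (equidistantUnit N) ∧
    thetaProd N T (equidistantUnit N) ^ 2 = etaR (N * T) ^ ((N - 1) * (N - 2)) * (N : ℝ) ^ N
        * (∏ i ∈ Finset.range N, latticeEigenvalue N T i) ^ 2 := by
  have hN0 : 0 < N := by omega
  have hNR : (0 : ℝ) < N := by exact_mod_cast hN0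
  have hs : 0 < N * T := by positivity
  rw [thetaProd_equidistant hN0]
  constructor
  · refine mul_pos (theta1R_pos hs (by norm_num) (by norm_num)) (Finset.prod_pos fun m hm =>
      Finset.prod_pos fun d hd => theta1R_pos hs (by positivity) ?_)
    have := Finset.mem_range.mp hm
    have := Finset.mem_range.mp hd
    rw [div_lt_one hNR]
    exact_mod_cast (by omega : d + 1 < N)
  · have h := sq_prod_range_prod_range (N := N) (fun d => theta1R ((d : ℝ) / N) (N * T))
      (fun d hd => by
        rw [Nat.cast_sub hd, sub_div, div_self hNR.ne', theta1R_one_sub])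
    push_cast at h
    rw [mul_pow, h, sq_theta1R_half_mul_prod hN hs]
    rfl

/-- The square root of the preceding identity is unambiguous because both sides are positive. -/
theorem thetaProd_equidistant_eq {N : ℕ} (hN : 2 ≤ N) {T : ℝ} (hT : 0 < T) :
    thetaProd N T (equidistantUnit N) = etaR (N * T) ^ (((N : ℝ) - 1) * ((N : ℝ) - 2) / 2)
      * Real.sqrt N ^ N * ∏ i ∈ Finset.range N, latticeEigenvalue N T i := by
  have hN0 : 0 < N := by omega
  have hNR : (0 : ℝ) < N := by exact_mod_cast hN0
  have hη : 0 < etaR (N * T) := etaR_pos (by positivity)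
  obtain ⟨h1, h2⟩ := sq_thetaProd_equidistant hN hT
  have hL : 0 < ∏ i ∈ Finset.range N, latticeEigenvalue N T i :=
    Finset.prod_pos fun i _ => latticeEigenvalue_pos hN0 hT i
  refine (sq_eq_sq₀ h1.le (by positivity)).mp ?_
  have hsq : (Real.sqrt N ^ N) ^ 2 = (N : ℝ) ^ N := by
    rw [← pow_mul, mul_comm N 2, pow_mul, Real.sq_sqrt hNR.le]
  rw [h2, mul_pow, mul_pow, hsq, ← Real.rpow_mul_natCast hη.le, ← Real.rpow_natCast (etaR _)]
  congr 3
  push_cast [Nat.cast_sub (show 1 ≤ N by omega), Nat.cast_sub hN]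
  ring

theorem qDet_eq_det {N : ℕ} {r t : ℝ} (hr : 0 < r) (ht : 0 < t) (x : Fin N → ℝ) :
    ((qDet N r t (equidistant N r) x : ℝ) : ℂ) = (1 / (2 * π * r)) ^ N
      * (Matrix.of fun j k => latticeKernel N (t / (2 * π * r ^ 2)) j ((x k / r : ℝ) : ℂ)).det := by
  have hrc : (r : ℂ) ≠ 0 := by exact_mod_cast hr.ne'
  have hpi : (π : ℂ) ≠ 0 := by exact_mod_cast Real.pi_ne_zero
  have hmap : ((qDet N r t (equidistant N r) x : ℝ) : ℂ)
      = (Complex.ofRealHom.mapMatrix (Matrix.of fun j k : Fin N =>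
          pWrapped (parity N) r t (equidistant N r j) (x k))).det := by
    rw [← RingHom.map_det]; rfl
  have hsm : (Complex.ofRealHom.mapMatrix (Matrix.of fun j k : Fin N =>
          pWrapped (parity N) r t (equidistant N r j) (x k)))
      = ((1 : ℂ) / (2 * π * r)) • Matrix.of fun j k =>
          latticeKernel N (t / (2 * π * r ^ 2)) j ((x k / r : ℝ) : ℂ) := by
    ext j k
    simp only [RingHom.mapMatrix_apply, Matrix.map_apply, Matrix.of_apply, Matrix.smul_apply,
      smul_eq_mul, Complex.ofRealHom_eq_coe]
    -- Reflection is needed because the wrapped kernel has the lattice point as its first argument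
    -- and `latticeKernel` subtracts it.
    rw [ofReal_pWrapped N hr ht, latticeKernel, ← gaussSeries_neg]
    congr 3
    · rw [equidistant, equidistantUnit]; push_cast; field_simp; ring
    · push_cast; field_simp
  rw [hmap, hsm, Matrix.det_smul, Fintype.card_fin]

theorem qDet_ofReal_mul {N : ℕ} {r t : ℝ} (hr : 0 < r) (ht : 0 < t) (x : Fin N → ℝ) :
    (Matrix.of fun j k => latticeKernel N (t / (2 * π * r ^ 2)) j ((x k / r : ℝ) : ℂ)).det
      = (((2 * π * r) ^ N * qDet N r t (equidistant N r) x : ℝ) : ℂ) := by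
  have h : (2 * π * r : ℂ) ≠ 0 := by
    exact_mod_cast (mul_pos Real.two_pi_pos hr).ne'
  rw [Complex.ofReal_mul, Complex.ofReal_pow, show ((2 * π * r : ℝ) : ℂ) = 2 * π * r by push_cast; rfl,
    qDet_eq_det hr ht, ← mul_assoc, ← mul_pow, mul_one_div_cancel h, one_pow, one_mul]

/-- `ϑ₁(x̄) ∏ ϑ₁(x_k - x_j) = η^{(N-1)(N-2)/2} (2 π r / √N)^N q_N`. -/
theorem thetaProd_eq_qDet {N : ℕ} (hN : 2 ≤ N) {r t : ℝ} (hr : 0 < r) (ht : 0 < t)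
    (x : Fin N → ℝ) :
    thetaProd N (t / (2 * π * r ^ 2)) (fun j => x j / r)
      = etaR (N * (t / (2 * π * r ^ 2))) ^ (((N : ℝ) - 1) * ((N : ℝ) - 2) / 2)
        * (2 * π * r / Real.sqrt N) ^ N * qDet N r t (equidistant N r) x := by
  have hpi := Real.pi_pos
  set T := t / (2 * π * r ^ 2) with hTd
  have hT : 0 < T := by positivity
  have hN0 : 0 < N := by omega
  have hNR : (0 : ℝ) < N := by exact_mod_cast hN0
  have hL : 0 < ∏ i ∈ Finset.range N, latticeEigenvalue N T i :=
    Finset.prod_pos fun i _ => latticeEigenvalue_pos hN0 hT i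
  have hD := det_latticeKernel_equidistant hN0 hT
  have h := thetaProd_mul_det hN0 hT (by
    rw [hD]; exact_mod_cast (mul_pos (pow_pos hNR N) hL).ne') fun j => x j / r
  rw [hD, qDet_ofReal_mul hr ht, thetaProd_equidistant_eq hN hT] at h
  have h' : thetaProd N T (fun j => x j / r) * ((N : ℝ) ^ N * ∏ i ∈ Finset.range N, latticeEigenvalue N T i)
      = etaR (N * T) ^ (((N : ℝ) - 1) * ((N : ℝ) - 2) / 2) * Real.sqrt N ^ N
        * (∏ i ∈ Finset.range N, latticeEigenvalue N T i)
        * ((2 * π * r) ^ N * qDet N r t (equidistant N r) x) := by exact_mod_cast h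
  have hsq : (N : ℝ) ^ N = Real.sqrt N ^ N * Real.sqrt N ^ N := by
    rw [← mul_pow, Real.mul_self_sqrt hNR.le]
  have hs0 : 0 < Real.sqrt N ^ N := pow_pos (Real.sqrt_pos.mpr hNR) N
  rw [hsq] at h'
  rw [div_pow]
  generalize (∏ i ∈ Finset.range N, latticeEigenvalue N T i) = L at h' hL
  refine mul_right_cancel₀ (mul_pos (mul_pos hs0 hs0) hL).ne' ?_
  have hdiv : (2 * π * r) ^ N / Real.sqrt N ^ N * Real.sqrt N ^ N = (2 * π * r) ^ N :=
    div_mul_cancel₀ _ hs0.ne'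
  linear_combination h' - etaR (N * T) ^ (((N : ℝ) - 1) * ((N : ℝ) - 2) / 2)
    * qDet N r t (equidistant N r) x * L * Real.sqrt N ^ N * hdiv

theorem hN_eq_thetaProd (N : ℕ) {r : ℝ} (hr : 0 < r) (ts β t : ℝ) (x : Fin N → ℝ) :
    hN N r ts β t x = etaR (N * tauIm r ts t) ^ (-β * ((N : ℝ) - 1) * ((N : ℝ) - 2) / 4)
      * thetaProd N (tauIm r ts t) (fun j => x j / r) := by
  have hpi := Real.pi_pos
  rw [hN, thetaProd, mul_assoc]
  congr 2
  · congr 1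
    rw [bar, kappa, kappaUnit, ← Finset.sum_div]
    field_simp
  · refine Finset.prod_congr rfl fun j _ => Finset.prod_congr rfl fun k _ => ?_
    congr 1
    field_simp

theorem tauIm_pos {r ts t : ℝ} (hr : 0 < r) (ht : t < ts) : 0 < tauIm r ts t :=
  div_pos (sub_pos.mpr ht) (by have := Real.pi_pos; positivity)

theorem hN_eq_qDet {N : ℕ} (hN2 : 2 ≤ N) {r ts t : ℝ} (β : ℝ) (hr : 0 < r) (ht : t < ts)
    (x : Fin N → ℝ) :
    hN N r ts β t x
      = etaR (N * tauIm r ts t) ^ (-(β - 2) * ((N : ℝ) - 1) * ((N : ℝ) - 2) / 4)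
        * (2 * π * r / Real.sqrt N) ^ N * qDet N r (ts - t) (equidistant N r) x := by
  have hNR : (0 : ℝ) < N := by exact_mod_cast (show 0 < N by omega)
  have hη : 0 < etaR (N * tauIm r ts t) := etaR_pos (mul_pos hNR (tauIm_pos hr ht))
  rw [hN_eq_thetaProd N hr]
  unfold tauIm at hη ⊢
  rw [thetaProd_eq_qDet hN2 hr (sub_pos.mpr ht), ← mul_assoc,
    ← mul_assoc, ← Real.rpow_add hη]
  congr 3
  ring

/-! ### Smoothness and heat equations -/

theorem contDiffOn_re_gaussSeries (a : ℝ) (m n : ℕ) :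
    ContDiffOn ℝ n (fun z : ℝ × ℝ => (gaussSeries a m ((z.1 : ℂ), (z.2 : ℂ))).re)
      {z | 0 < z.2} := by
  have h := (contDiffOn_gaussSeries a n m).restrict_scalars ℝ
  have hg : ContDiff ℝ n fun z : ℝ × ℝ => ((z.1 : ℂ), (z.2 : ℂ)) :=
    (Complex.ofRealCLM.contDiff.comp contDiff_fst).prodMk
      (Complex.ofRealCLM.contDiff.comp contDiff_snd)
  exact Complex.reCLM.contDiff.comp_contDiffOn
    (h.comp hg.contDiffOn fun z hz => by simpa using hz)

theorem theta1R_eq_gaussSeries (v s : ℝ) :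
    theta1R v s = -(gaussSeries (-1 / 2) 0 (((2 * π * v + π : ℝ) : ℂ), ((π * s : ℝ) : ℂ))).re := by
  rw [theta1R, theta1_eq_gaussSeries, Complex.neg_re]
  push_cast
  rfl

theorem contDiffOn_theta1R (n : ℕ) :
    ContDiffOn ℝ n (fun z : ℝ × ℝ => theta1R z.1 z.2) {z | 0 < z.2} := by
  simp only [theta1R_eq_gaussSeries]
  refine ((contDiffOn_re_gaussSeries (-1 / 2) 0 n).comp
    (g := fun z : ℝ × ℝ => (gaussSeries (-1 / 2) 0 ((z.1 : ℂ), (z.2 : ℂ))).re)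
    (f := fun z : ℝ × ℝ => (2 * π * z.1 + π, π * z.2)) ?_ fun z hz => ?_).neg
  · exact ContDiff.contDiffOn (by fun_prop)
  · exact mul_pos Real.pi_pos hz

/-- η is holomorphic on the upper half-plane, hence smooth along the imaginary axis. -/
theorem contDiffOn_etaR (n : ℕ) : ContDiffOn ℝ n etaR (Ioi 0) := by
  have h1 : DifferentiableOn ℂ ModularForm.eta {z : ℂ | 0 < z.im} := fun z hz =>
    (ModularForm.differentiableAt_eta_of_mem_upperHalfPlaneSet hz).differentiableWithinAt
  have h2 : ContDiffOn ℂ n ModularForm.eta {z : ℂ | 0 < z.im} :=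
    h1.contDiffOn (isOpen_lt continuous_const Complex.continuous_im)
  have hg : ContDiff ℝ n fun s : ℝ => Complex.I * (s : ℂ) :=
    contDiff_const.mul Complex.ofRealCLM.contDiff
  exact Complex.reCLM.contDiff.comp_contDiffOn
    ((h2.restrict_scalars ℝ).comp hg.contDiffOn fun s hs => by simpa using hs)

theorem hasDerivAt_re_gaussSeries_fst (a : ℝ) (m : ℕ) (y : ℝ) {s : ℝ} (hs : 0 < s) :
    HasDerivAt (fun y : ℝ => (gaussSeries a m ((y : ℂ), (s : ℂ))).re)
      (gaussSeries a (m + 1) ((y : ℂ), (s : ℂ))).re y :=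
  (hasDerivAt_gaussSeries_fst a m y (s := s) (by simpa using hs)).real_of_complex

theorem hasDerivAt_re_gaussSeries_snd (a : ℝ) (m : ℕ) (y : ℝ) {s : ℝ} (hs : 0 < s) :
    HasDerivAt (fun s : ℝ => (gaussSeries a m ((y : ℂ), (s : ℂ))).re)
      (gaussSeries a (m + 2) ((y : ℂ), (s : ℂ))).re s :=
  (hasDerivAt_gaussSeries_snd a m y (s := s) (by simpa using hs)).real_of_complex

/-- The `m`-th derivative in `y` of `ϑ₁(y / 2πr; N τ(t))`. -/
def thetaAt (N : ℕ) (r ts : ℝ) (m : ℕ) (t y : ℝ) : ℝ :=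
  -(gaussSeries (-1 / 2) m (((y / r + π : ℝ) : ℂ), ((π * (N * tauIm r ts t) : ℝ) : ℂ))).re / r ^ m

theorem thetaAt_zero (N : ℕ) {r : ℝ} (hr : 0 < r) (ts t y : ℝ) :
    thetaAt N r ts 0 t y = theta1R (y / (2 * π * r)) (N * tauIm r ts t) := by
  have := Real.pi_ne_zero
  rw [thetaAt, theta1R_eq_gaussSeries, pow_zero, div_one]
  congr 5
  field_simp

theorem hasDerivAt_tauIm (r ts t : ℝ) :
    HasDerivAt (tauIm r ts) (-1 / (2 * π * r ^ 2)) t :=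
  ((hasDerivAt_id t).const_sub ts).div_const _

theorem hasDerivAt_thetaAt_space {N : ℕ} (hN : 0 < N) {r ts t : ℝ} (hr : 0 < r) (ht : t < ts)
    (m : ℕ) (y : ℝ) : HasDerivAt (thetaAt N r ts m t) (thetaAt N r ts (m + 1) t y) y := by
  have hs : 0 < π * (N * tauIm r ts t) := by
    have := tauIm_pos hr ht
    have := Real.pi_pos
    positivity
  have h := ((hasDerivAt_re_gaussSeries_fst (-1 / 2) m (y / r + π) hs).comp y
    (((hasDerivAt_id y).div_const r).add_const π)).neg.div_const (r ^ m)
  refine h.congr_deriv ?_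
  rw [thetaAt]
  field_simp
  ring

/-- The backward heat equation with diffusivity N/2: the factor N comes from the modulus Nτ(t), the
sign from the decrease of τ. -/
theorem hasDerivAt_thetaAt_time {N : ℕ} (hN : 0 < N) {r ts t : ℝ} (hr : 0 < r) (ht : t < ts)
    (m : ℕ) (y : ℝ) :
    HasDerivAt (fun t => thetaAt N r ts m t y) (-(N / 2) * thetaAt N r ts (m + 2) t y) t := by
  have hpi := Real.pi_pos
  have hs : 0 < π * (N * tauIm r ts t) := by
    have := tauIm_pos hr ht
    positivity
  have h := ((hasDerivAt_re_gaussSeries_snd (-1 / 2) m (y / r + π) hs).comp t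
    (((hasDerivAt_tauIm r ts t).const_mul (N : ℝ)).const_mul π)).neg.div_const (r ^ m)
  refine h.congr_deriv ?_
  rw [thetaAt]
  field_simp
  ring

/-- The `m`-th derivative in `x` of the wrapped heat kernel at remaining time `ts - t`. -/
def kernelAt (N : ℕ) (r ts v : ℝ) (m : ℕ) (t x : ℝ) : ℝ :=
  1 / (2 * π * r) * (gaussSeries (-(N / 2)) m (((x - v) / r : ℝ), ((ts - t) / (2 * r ^ 2) : ℝ))).re / r ^ m

theorem kernelAt_zero (N : ℕ) {r ts t : ℝ} (hr : 0 < r) (ht : t < ts) (v x : ℝ) :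
    kernelAt N r ts v 0 t x = pWrapped (parity N) r (ts - t) v x := by
  have h := ofReal_pWrapped N hr (sub_pos.mpr ht) v x
  rw [← gaussSeries_neg] at h
  have e : (1 / (2 * π * r) : ℂ) = ((1 / (2 * π * r) : ℝ) : ℂ) := by push_cast; rfl
  have h2 := congrArg Complex.re h
  rw [Complex.ofReal_re, e, Complex.re_ofReal_mul] at h2
  rw [h2, kernelAt, pow_zero, div_one]
  congr 4
  · push_cast
    ring
  · push_cast
    rfl

theorem hasDerivAt_kernelAt_space (N : ℕ) {r ts t : ℝ} (hr : 0 < r) (ht : t < ts) (v : ℝ)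
    (m : ℕ) (x : ℝ) : HasDerivAt (kernelAt N r ts v m t) (kernelAt N r ts v (m + 1) t x) x := by
  have hpi := Real.pi_pos
  have hs : 0 < (ts - t) / (2 * r ^ 2) := by
    have := sub_pos.mpr ht
    positivity
  have h := (((hasDerivAt_re_gaussSeries_fst (-(N / 2)) m ((x - v) / r) hs).comp x
    (((hasDerivAt_id x).sub_const v).div_const r)).const_mul (1 / (2 * π * r))).div_const (r ^ m)
  refine h.congr_deriv ?_
  rw [kernelAt]
  field_simp
  ring

theorem hasDerivAt_kernelAt_time (N : ℕ) {r ts t : ℝ} (hr : 0 < r) (ht : t < ts) (v : ℝ)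
    (m : ℕ) (x : ℝ) :
    HasDerivAt (fun t => kernelAt N r ts v m t x) (-(1 / 2) * kernelAt N r ts v (m + 2) t x) t := by
  have hpi := Real.pi_pos
  have hs : 0 < (ts - t) / (2 * r ^ 2) := by
    have := sub_pos.mpr ht
    positivity
  have h := (((hasDerivAt_re_gaussSeries_snd (-(N / 2)) m ((x - v) / r) hs).comp t
    (((hasDerivAt_id t).const_sub ts).div_const (2 * r ^ 2))).const_mul
      (1 / (2 * π * r))).div_const (r ^ m)
  refine h.congr_deriv ?_
  rw [kernelAt]
  field_simp
  ring

/-! ### The heat equation for products and determinants -/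

theorem hasFDerivAt_prod_coord {N : ℕ} {φ φ' : Fin N → ℝ → ℝ}
    (h : ∀ i s, HasDerivAt (φ i) (φ' i s) s) (x : Fin N → ℝ) :
    HasFDerivAt (fun x : Fin N → ℝ => ∏ i, φ i (x i))
      (∑ i, (∏ l ∈ Finset.univ.erase i, φ l (x l)) •
        (φ' i (x i) • (ContinuousLinearMap.proj i : (Fin N → ℝ) →L[ℝ] ℝ))) x := by
  refine HasFDerivAt.finsetProd fun i _ => ?_
  exact (h i (x i)).comp_hasFDerivAt x (hasFDerivAt_apply i x)

theorem prod_update_coord {N : ℕ} (φ : Fin N → ℝ → ℝ) (j : Fin N) (ψ : ℝ → ℝ) (x : Fin N → ℝ) :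
    ∏ i, Function.update φ j ψ i (x i) = ψ (x j) * ∏ l ∈ Finset.univ.erase j, φ l (x l) := by
  rw [← Finset.mul_prod_erase _ _ (Finset.mem_univ j), Function.update_self]
  congr 1
  refine Finset.prod_congr rfl fun l hl => ?_
  rw [Function.update_of_ne (Finset.ne_of_mem_erase hl)]

theorem pd_prod_coord {N : ℕ} {φ φ' : Fin N → ℝ → ℝ}
    (h : ∀ i s, HasDerivAt (φ i) (φ' i s) s) (j : Fin N) :
    pd j (fun x : Fin N → ℝ => ∏ i, φ i (x i))
      = fun x => ∏ i, Function.update φ j (φ' j) i (x i) := by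
  funext x
  rw [pd, (hasFDerivAt_prod_coord h x).fderiv, prod_update_coord]
  simp only [FunLike.coe_sum, Finset.sum_apply, FunLike.coe_smul,
    Pi.smul_apply, ContinuousLinearMap.proj_apply, smul_eq_mul, Pi.single_apply]
  rw [Finset.sum_eq_single j]
  · simp [mul_comm]
  · intro i _ hij
    simp [hij]
  · simp

theorem pd_sum {N : ℕ} {ι : Type*} (s : Finset ι) (c : ι → ℝ) {u : ι → (Fin N → ℝ) → ℝ} (j : Fin N)
    (h : ∀ i ∈ s, Differentiable ℝ (u i)) :
    pd j (fun x => ∑ i ∈ s, c i * u i x) = fun x => ∑ i ∈ s, c i * pd j (u i) x := by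
  funext x
  rw [pd, fderiv_fun_sum fun i hi => ((h i hi) x).const_mul (c i)]
  simp only [FunLike.coe_sum, Finset.sum_apply]
  refine Finset.sum_congr rfl fun i hi => ?_
  rw [fderiv_const_mul ((h i hi) x)]
  rfl

section Determinant

variable {N : ℕ} {A B C : Fin N → ℝ → ℝ → ℝ}

/-- Column l is the only one that depends on x_l, so in the Leibniz expansion both derivatives fall
on a single factor. -/
theorem pd_pd_det (t : ℝ) (hAB : ∀ j s, HasDerivAt (A j t) (B j t s) s)
    (hBC : ∀ j s, HasDerivAt (B j t) (C j t s) s) (l : Fin N) (x : Fin N → ℝ) :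
    pd l (pd l fun x => (Matrix.of fun j k => A j t (x k)).det) x
      = ∑ σ : Equiv.Perm (Fin N), ((σ.sign : ℤ) : ℝ)
        * (C (σ l) t (x l) * ∏ k ∈ Finset.univ.erase l, A (σ k) t (x k)) := by
  have h0 : (fun x : Fin N → ℝ => (Matrix.of fun j k => A j t (x k)).det)
      = fun x => ∑ σ : Equiv.Perm (Fin N), ((σ.sign : ℤ) : ℝ) * ∏ k, A (σ k) t (x k) := by
    funext x; rw [Matrix.det_apply']; rfl
  have hd0 : ∀ σ : Equiv.Perm (Fin N), Differentiable ℝ fun x : Fin N → ℝ => ∏ k, A (σ k) t (x k) :=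
    fun σ x => (hasFDerivAt_prod_coord (fun i s => hAB (σ i) s) x).differentiableAt
  have hupd : ∀ (σ : Equiv.Perm (Fin N)) i s, HasDerivAt
      (Function.update (fun k => A (σ k) t) l (B (σ l) t) i)
      (Function.update (fun k => B (σ k) t) l (C (σ l) t) i s) s := by
    intro σ i s
    by_cases hi : i = l
    · subst hi; simpa using hBC (σ i) s
    · simpa [hi] using hAB (σ i) s
  have hd1 : ∀ σ : Equiv.Perm (Fin N), Differentiable ℝ fun x : Fin N → ℝ =>
      ∏ k, Function.update (fun k => A (σ k) t) l (B (σ l) t) k (x k) :=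
    fun σ x => (hasFDerivAt_prod_coord (hupd σ) x).differentiableAt
  rw [h0, pd_sum _ _ l fun σ _ => hd0 σ]
  simp only [fun σ : Equiv.Perm (Fin N) => pd_prod_coord (fun i s => hAB (σ i) s) l]
  rw [pd_sum _ _ l fun σ _ => hd1 σ]
  refine Finset.sum_congr rfl fun σ _ => ?_
  rw [pd_prod_coord (hupd σ) l, Function.update_self, Function.update_idem]
  beta_reduce
  rw [prod_update_coord]

/-- If the entries satisfy a one-dimensional heat equation, the product rule in time yields the same
sum as the spatial Laplacian. -/
theorem hasDerivAt_det (t c : ℝ) (x : Fin N → ℝ)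
    (hAC : ∀ j s, HasDerivAt (fun t => A j t s) (c * C j t s) t) :
    HasDerivAt (fun t => (Matrix.of fun j k => A j t (x k)).det)
      (c * ∑ l, ∑ σ : Equiv.Perm (Fin N), ((σ.sign : ℤ) : ℝ)
        * (C (σ l) t (x l) * ∏ k ∈ Finset.univ.erase l, A (σ k) t (x k))) t := by
  have h0 : (fun t => (Matrix.of fun j k => A j t (x k)).det)
      = fun t => ∑ σ : Equiv.Perm (Fin N), ((σ.sign : ℤ) : ℝ) * ∏ k, A (σ k) t (x k) := by
    funext t; rw [Matrix.det_apply']; rfl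
  rw [h0, Finset.sum_comm, Finset.mul_sum]
  refine HasDerivAt.fun_sum fun σ _ => ?_
  have := (HasDerivAt.fun_finsetProd (u := Finset.univ) (f := fun k t => A (σ k) t (x k))
    (fun k _ => hAC (σ k) (x k))).const_mul ((σ.sign : ℤ) : ℝ)
  refine this.congr_deriv ?_
  rw [Finset.mul_sum, Finset.mul_sum]
  refine Finset.sum_congr rfl fun l _ => ?_
  rw [smul_eq_mul]
  ring

end Determinant

theorem qDet_eq_det_kernelAt (N : ℕ) {r ts t : ℝ} (hr : 0 < r) (ht : t < ts) (x : Fin N → ℝ) :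
    qDet N r (ts - t) (equidistant N r) x
      = (Matrix.of fun j k => kernelAt N r ts (equidistant N r j) 0 t (x k)).det := by
  simp only [qDet, kernelAt_zero N hr ht]

/-- `q_N` solves the backward heat equation. -/
theorem hasDerivAt_qDet (N : ℕ) {r ts t : ℝ} (hr : 0 < r) (ht : t < ts) (x : Fin N → ℝ) :
    HasDerivAt (fun t => qDet N r (ts - t) (equidistant N r) x)
      (-(1 / 2) * ∑ l, pd l (pd l (qDet N r (ts - t) (equidistant N r))) x) t := by
  have h1 := hasDerivAt_det (A := fun j t s => kernelAt N r ts (equidistant N r j) 0 t s)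
    (C := fun j t s => kernelAt N r ts (equidistant N r j) 2 t s) t (-(1 / 2)) x
    (fun j s => hasDerivAt_kernelAt_time N hr ht _ 0 s)
  have h2 : qDet N r (ts - t) (equidistant N r)
      = fun x => (Matrix.of fun j k => kernelAt N r ts (equidistant N r j) 0 t (x k)).det :=
    funext (qDet_eq_det_kernelAt N hr ht)
  have h3 := fun l => pd_pd_det (A := fun j t s => kernelAt N r ts (equidistant N r j) 0 t s)
      (B := fun j t s => kernelAt N r ts (equidistant N r j) 1 t s)
      (C := fun j t s => kernelAt N r ts (equidistant N r j) 2 t s) t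
      (fun j s => hasDerivAt_kernelAt_space N hr ht _ 0 s)
      (fun j s => hasDerivAt_kernelAt_space N hr ht _ 1 s) l x
  simp only [h2, h3]
  refine h1.congr_of_eventuallyEq ?_
  filter_upwards [Iio_mem_nhds ht] with t' ht'
  exact qDet_eq_det_kernelAt N hr ht' x

/-! ### The heat equation for the theta product -/

/-- `ϑ₁(x̄) ∏ ϑ₁(x_k - x_j)`. -/
def thetaH (N : ℕ) (r ts t : ℝ) (x : Fin N → ℝ) : ℝ :=
  theta1R (bar r x / (2 * π * r)) (N * tauIm r ts t)
    * ∏ j : Fin N, ∏ k ∈ Finset.Ioi j, theta1R ((x k - x j) / (2 * π * r)) (N * tauIm r ts t)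

theorem hN_eq_mul_thetaH (N : ℕ) (r ts β t : ℝ) (x : Fin N → ℝ) :
    hN N r ts β t x = etaR (N * tauIm r ts t) ^ (-β * ((N : ℝ) - 1) * ((N : ℝ) - 2) / 4)
      * thetaH N r ts t x := by
  rw [hN, thetaH, mul_assoc]

/-- The exponent `(N-1)(N-2)/2`. -/
def etaExp (N : ℕ) : ℝ := ((N : ℝ) - 1) * ((N : ℝ) - 2) / 2

theorem thetaH_eq_qDet {N : ℕ} (hN2 : 2 ≤ N) {r ts t : ℝ} (hr : 0 < r) (ht : t < ts)
    (x : Fin N → ℝ) :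
    thetaH N r ts t x = (2 * π * r / Real.sqrt N) ^ N * etaR (N * tauIm r ts t) ^ etaExp N
        * qDet N r (ts - t) (equidistant N r) x := by
  -- At β = 0 the η-prefactor of h_N disappears and the determinantal formula is about the theta
  -- product alone.
  have h0 := hN_eq_mul_thetaH N r ts 0 t x
  have h1 := hN_eq_qDet hN2 0 hr ht x
  rw [h0] at h1
  simp only [neg_zero, zero_mul, zero_div, Real.rpow_zero, one_mul, zero_sub, neg_neg] at h1
  rw [h1, etaExp, show (2 : ℝ) * ((N : ℝ) - 1) * ((N : ℝ) - 2) / 4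
    = ((N : ℝ) - 1) * ((N : ℝ) - 2) / 2 by ring]
  ring

theorem etaR_tauIm_pos {N : ℕ} (hN : 0 < N) {r ts t : ℝ} (hr : 0 < r) (ht : t < ts) :
    0 < etaR (N * tauIm r ts t) :=
  etaR_pos (mul_pos (by exact_mod_cast hN) (tauIm_pos hr ht))

theorem differentiableAt_etaR_tauIm {N : ℕ} (hN : 0 < N) {r ts t : ℝ} (hr : 0 < r) (ht : t < ts) :
    DifferentiableAt ℝ (fun t => etaR (N * tauIm r ts t)) t := by
  have hs : 0 < (N : ℝ) * tauIm r ts t := mul_pos (by exact_mod_cast hN) (tauIm_pos hr ht)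
  have h1 : DifferentiableAt ℝ etaR (N * tauIm r ts t) :=
    ((contDiffOn_etaR 1).differentiableOn (by simp)).differentiableAt (Ioi_mem_nhds hs)
  exact h1.comp (f := fun t => (N : ℝ) * tauIm r ts t) t
    ((hasDerivAt_tauIm r ts t).const_mul _).differentiableAt

/-- The logarithmic time derivative of `η(N τ(t))`. -/
def etaLogDeriv (N : ℕ) (r ts t : ℝ) : ℝ :=
  deriv (fun t => etaR (N * tauIm r ts t)) t / etaR (N * tauIm r ts t)

theorem hasDerivAt_etaR_rpow {N : ℕ} (hN : 0 < N) {r ts t : ℝ} (hr : 0 < r) (ht : t < ts) (p : ℝ) :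
    HasDerivAt (fun t => etaR (N * tauIm r ts t) ^ p)
      (p * etaLogDeriv N r ts t * etaR (N * tauIm r ts t) ^ p) t := by
  have hη := etaR_tauIm_pos hN hr ht
  have h := (differentiableAt_etaR_tauIm hN hr ht).hasDerivAt.rpow_const (p := p) (Or.inl hη.ne')
  refine h.congr_deriv ?_
  rw [etaLogDeriv, Real.rpow_sub_one hη.ne']
  ring

theorem pd_const_mul {N : ℕ} (c : ℝ) (f : (Fin N → ℝ) → ℝ) (j : Fin N) :
    pd j (fun x => c * f x) = fun x => c * pd j f x := by
  funext x
  have : (fun x => c * f x) = c • f := rfl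
  rw [pd, pd, this, fderiv_const_smul_field]
  rfl

/-- The heat equation for the theta product. -/
theorem hasDerivAt_thetaH {N : ℕ} (hN2 : 2 ≤ N) {r ts t : ℝ} (hr : 0 < r) (ht : t < ts)
    (x : Fin N → ℝ) :
    HasDerivAt (fun t => thetaH N r ts t x) (etaExp N * etaLogDeriv N r ts t * thetaH N r ts t x
      - 1 / 2 * ∑ l, pd l (pd l (thetaH N r ts t)) x) t := by
  have hfun : thetaH N r ts t = fun x => ((2 * π * r / Real.sqrt N) ^ N
      * etaR (N * tauIm r ts t) ^ etaExp N) * qDet N r (ts - t) (equidistant N r) x :=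
    funext (thetaH_eq_qDet hN2 hr ht)
  have h := ((hasDerivAt_etaR_rpow (by omega : 0 < N) hr ht (etaExp N)).const_mul
    ((2 * π * r / Real.sqrt N) ^ N)).mul (hasDerivAt_qDet N hr ht x)
  refine (h.congr_of_eventuallyEq (f₁ := fun t => thetaH N r ts t x) ?_).congr_deriv ?_
  · filter_upwards [Iio_mem_nhds ht] with t' ht'
    exact thetaH_eq_qDet hN2 hr ht' x
  rw [hfun]
  simp only [pd_const_mul, ← Finset.mul_sum]
  ring

/-! ### The affine forms `x_k - x_j` and `x̄` -/

/-- The affine forms `x_k - x_j` (at `some ⟨j, k⟩`) and `x̄` (at `none`). -/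
def affineForm {N : ℕ} (r : ℝ) : Option (Σ _ : Fin N, Fin N) → (Fin N → ℝ) → ℝ
  | none, x => bar r x
  | some p, x => x p.2 - x p.1

/-- The gradients of the affine forms. -/
def affineCoeff {N : ℕ} : Option (Σ _ : Fin N, Fin N) → Fin N → ℝ
  | none, _ => 1
  | some p, l => (if l = p.2 then 1 else 0) - (if l = p.1 then 1 else 0)

/-- The index set of the affine forms: pairs `j < k`, and the point `none`. -/
def formIndex (N : ℕ) : Finset (Option (Σ _ : Fin N, Fin N)) :=
  Finset.insertNone (Finset.univ.sigma fun j => Finset.Ioi j)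

theorem sum_formIndex {N : ℕ} (F : Option (Σ _ : Fin N, Fin N) → ℝ) :
    ∑ i ∈ formIndex N, F i = (∑ j : Fin N, ∑ k ∈ Finset.Ioi j, F (some ⟨j, k⟩)) + F none := by
  rw [formIndex, Finset.sum_insertNone, Finset.sum_sigma, add_comm]

theorem prod_formIndex {N : ℕ} (F : Option (Σ _ : Fin N, Fin N) → ℝ) :
    ∏ i ∈ formIndex N, F i = F none * ∏ j : Fin N, ∏ k ∈ Finset.Ioi j, F (some ⟨j, k⟩) := by
  rw [formIndex, Finset.prod_insertNone, Finset.prod_sigma]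

theorem hasFDerivAt_affineForm {N : ℕ} (r : ℝ) (i : Option (Σ _ : Fin N, Fin N))
    (x : Fin N → ℝ) : HasFDerivAt (affineForm r i)
      (∑ l, affineCoeff i l • (ContinuousLinearMap.proj (R := ℝ) (φ := fun _ : Fin N => ℝ) l)) x := by
  cases i with
  | none =>
    have h := (HasFDerivAt.fun_sum (u := Finset.univ)
      fun (l : Fin N) _ => hasFDerivAt_apply (𝕜 := ℝ) l x).sub_const (kappa N r)
    refine h.congr_fderiv ?_
    simp [affineCoeff]
  | some p =>
    refine ((hasFDerivAt_apply (𝕜 := ℝ) p.2 x).fun_sub (hasFDerivAt_apply p.1 x)).congr_fderiv ?_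
    ext v
    simp [affineCoeff, sub_mul, Finset.sum_sub_distrib]

theorem sum_affineCoeff_sq_some {N : ℕ} {j k : Fin N} (h : j < k) :
    ∑ l, affineCoeff (some ⟨j, k⟩) l ^ 2 = 2 := by
  have h1 : ∀ l, affineCoeff (some ⟨j, k⟩ : Option (Σ _ : Fin N, Fin N)) l ^ 2
      = (if l = k then 1 else 0) + (if l = j then 1 else 0) := by
    intro l
    simp only [affineCoeff]
    split_ifs with h1 h2
    · exact absurd (h2.symm.trans h1) h.ne
    all_goals norm_num
  simp only [h1, Finset.sum_add_distrib, Finset.sum_ite_eq', Finset.mem_univ, if_true]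
  norm_num

theorem sum_affineCoeff_sq_none {N : ℕ} :
    ∑ l, affineCoeff (none : Option (Σ _ : Fin N, Fin N)) l ^ 2 = N := by
  simp [affineCoeff]

theorem affineForm_mem {N : ℕ} {r : ℝ} {x : Fin N → ℝ} (hx : x ∈ alcove N r)
    {i : Option (Σ _ : Fin N, Fin N)} (hi : i ∈ formIndex N) :
    affineForm r i x ∈ Ioo 0 (2 * π * r) := by
  cases i with
  | none => exact hx.2.2
  | some p =>
    have hp : p.1 < p.2 := by simpa [formIndex] using hi
    have h1 := hx.1 hp
    have h2 := hx.2.1 p.1 p.2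
    exact ⟨by simp only [affineForm]; linarith, by simp only [affineForm]; linarith⟩

theorem isOpen_alcove (N : ℕ) (r : ℝ) : IsOpen (alcove N r) := by
  have h : alcove N r = (⋂ j, ⋂ k, {x : Fin N → ℝ | j < k → x j < x k})
      ∩ ((⋂ j, ⋂ k, {x : Fin N → ℝ | x k < x j + 2 * π * r})
        ∩ bar r ⁻¹' Ioo 0 (2 * π * r)) := by
    ext x
    simp only [alcove, mem_ofPred_eq, mem_inter_iff, mem_iInter, mem_preimage, StrictMono]
  rw [h]
  have hb : Continuous (bar r : (Fin N → ℝ) → ℝ) := by unfold bar; fun_prop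
  refine (isOpen_iInter_of_finite fun j => isOpen_iInter_of_finite fun k => ?_).inter
    ((isOpen_iInter_of_finite fun j => isOpen_iInter_of_finite fun k =>
      isOpen_lt (by fun_prop) (by fun_prop)).inter (isOpen_Ioo.preimage hb))
  by_cases hjk : j < k
  · simpa [hjk] using isOpen_lt (continuous_apply j) (continuous_apply k)
  · simp [hjk]

/-! ### Rules for partial derivatives -/

section PartialDerivatives

variable {N : ℕ} {f g : (Fin N → ℝ) → ℝ} {x : Fin N → ℝ}

theorem pd_congr (h : f =ᶠ[𝓝 x] g) (j : Fin N) : pd j f x = pd j g x := by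
  rw [pd, pd, h.fderiv_eq]

theorem pd_mul (hf : DifferentiableAt ℝ f x) (hg : DifferentiableAt ℝ g x) (j : Fin N) :
    pd j (fun x => f x * g x) x = pd j f x * g x + f x * pd j g x := by
  simp only [pd, fderiv_fun_mul hf hg, FunLike.coe_add, Pi.add_apply, FunLike.coe_smul,
    Pi.smul_apply, smul_eq_mul]
  ring

theorem pd_add (hf : DifferentiableAt ℝ f x) (hg : DifferentiableAt ℝ g x) (j : Fin N) :
    pd j (fun x => f x + g x) x = pd j f x + pd j g x := by
  simp only [pd, fderiv_fun_add hf hg, FunLike.coe_add, Pi.add_apply]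

theorem pd_const_mul_exp (c d : ℝ) (hf : DifferentiableAt ℝ f x) (j : Fin N) :
    pd j (fun x => c * Real.exp (d * f x)) x = d * pd j f x * (c * Real.exp (d * f x)) := by
  have h := ((hf.hasFDerivAt.const_mul d).exp).const_mul c
  rw [pd, h.fderiv, pd]
  simp only [FunLike.coe_smul, Pi.smul_apply, smul_eq_mul]
  ring

theorem hasFDerivAt_sum_affineForm (r : ℝ) (w : Option (Σ _ : Fin N, Fin N) → ℝ) {G G' : ℝ → ℝ}
    (h : ∀ i ∈ formIndex N, HasDerivAt G (G' (affineForm r i x)) (affineForm r i x)) :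
    HasFDerivAt (fun x => ∑ i ∈ formIndex N, w i * G (affineForm r i x))
      (∑ i ∈ formIndex N, w i • (G' (affineForm r i x) •
        (∑ l, affineCoeff i l • (ContinuousLinearMap.proj (R := ℝ) (φ := fun _ : Fin N => ℝ) l)))) x :=
  HasFDerivAt.fun_sum fun i hi =>
    ((h i hi).comp_hasFDerivAt x (hasFDerivAt_affineForm r i x)).const_mul (w i)

theorem pd_sum_affineForm (r : ℝ) (w : Option (Σ _ : Fin N, Fin N) → ℝ) {G G' : ℝ → ℝ}
    (h : ∀ i ∈ formIndex N, HasDerivAt G (G' (affineForm r i x)) (affineForm r i x)) (j : Fin N) :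
    pd j (fun x => ∑ i ∈ formIndex N, w i * G (affineForm r i x)) x
      = ∑ i ∈ formIndex N, (w i * affineCoeff i j) * G' (affineForm r i x) := by
  rw [pd, (hasFDerivAt_sum_affineForm r w h).fderiv]
  simp only [FunLike.coe_sum, Finset.sum_apply, FunLike.coe_smul, Pi.smul_apply, smul_eq_mul,
    ContinuousLinearMap.proj_apply, Pi.single_apply, mul_ite, mul_one, mul_zero,
    Finset.sum_ite_eq', Finset.mem_univ, if_true]
  exact Finset.sum_congr rfl fun i _ => by ring

end PartialDerivatives

/-! ### The potentials -/

section Potentials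

variable {N : ℕ} {r ts t : ℝ}

theorem thetaAt_zero_pos (hN : 0 < N) (hr : 0 < r) (ht : t < ts) {y : ℝ}
    (hy : y ∈ Ioo 0 (2 * π * r)) : 0 < thetaAt N r ts 0 t y := by
  have hL : 0 < 2 * π * r := by have := Real.pi_pos; positivity
  rw [thetaAt_zero N hr]
  exact theta1R_pos (mul_pos (by exact_mod_cast hN) (tauIm_pos hr ht)) (div_pos hy.1 hL)
    ((div_lt_one hL).mpr hy.2)

/-- The first derivative of `U_N(t, ·)`. -/
def potU₁ (N : ℕ) (r ts t y : ℝ) : ℝ := -thetaAt N r ts 1 t y / thetaAt N r ts 0 t y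

/-- The second derivative of `U_N(t, ·)`. -/
def potU₂ (N : ℕ) (r ts t y : ℝ) : ℝ :=
  (thetaAt N r ts 1 t y ^ 2 - thetaAt N r ts 2 t y * thetaAt N r ts 0 t y)
    / thetaAt N r ts 0 t y ^ 2

theorem potU_eq (hr : 0 < r) (t y : ℝ) :
    potU N r ts t y = -Real.log (thetaAt N r ts 0 t y) := by
  rw [potU, thetaAt_zero N hr]

theorem hasDerivAt_potU (hN : 0 < N) (hr : 0 < r) (ht : t < ts) {y : ℝ}
    (hy : y ∈ Ioo 0 (2 * π * r)) : HasDerivAt (potU N r ts t) (potU₁ N r ts t y) y := by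
  have h := ((hasDerivAt_thetaAt_space hN hr ht 0 y).log (thetaAt_zero_pos hN hr ht hy).ne').neg
  rw [show potU N r ts t = fun y => -Real.log (thetaAt N r ts 0 t y) from
    funext (potU_eq hr t)]
  exact h.congr_deriv (neg_div _ _).symm

theorem hasDerivAt_potU₁ (hN : 0 < N) (hr : 0 < r) (ht : t < ts) {y : ℝ}
    (hy : y ∈ Ioo 0 (2 * π * r)) : HasDerivAt (potU₁ N r ts t) (potU₂ N r ts t y) y := by
  have h0 := (thetaAt_zero_pos hN hr ht hy).ne'
  refine ((hasDerivAt_thetaAt_space hN hr ht 1 y).fun_neg.fun_div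
    (hasDerivAt_thetaAt_space hN hr ht 0 y) h0).congr_deriv ?_
  rw [potU₂]
  congr 1
  ring

theorem deriv_potU (hN : 0 < N) (hr : 0 < r) (ht : t < ts) {y : ℝ}
    (hy : y ∈ Ioo 0 (2 * π * r)) : deriv (potU N r ts t) y = potU₁ N r ts t y :=
  (hasDerivAt_potU hN hr ht hy).deriv

theorem deriv_deriv_potU (hN : 0 < N) (hr : 0 < r) (ht : t < ts) {y : ℝ}
    (hy : y ∈ Ioo 0 (2 * π * r)) : deriv (deriv (potU N r ts t)) y = potU₂ N r ts t y := by
  refine ((hasDerivAt_potU₁ hN hr ht hy).congr_of_eventuallyEq ?_).deriv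
  filter_upwards [isOpen_Ioo.mem_nhds hy] with z hz
  exact deriv_potU hN hr ht hz

/-- With θ = e^{-U}, the heat equation of θ gives ∂_t U = (N/2) θ''/θ, and θ''/θ = U'² - U''. -/
theorem hasDerivAt_potU_time (hN : 0 < N) (hr : 0 < r) (ht : t < ts) {y : ℝ}
    (hy : y ∈ Ioo 0 (2 * π * r)) : HasDerivAt (fun t => potU N r ts t y)
      (N / 2 * (potU₁ N r ts t y ^ 2 - potU₂ N r ts t y)) t := by
  have h0 := (thetaAt_zero_pos hN hr ht hy).ne'
  have h := ((hasDerivAt_thetaAt_time hN hr ht 0 y).log h0).fun_neg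
  simp only [potU_eq hr]
  refine h.congr_deriv ?_
  rw [potU₁, potU₂]
  field_simp
  ring

theorem potW_eq_sum (t : ℝ) (x : Fin N → ℝ) :
    potW N r ts t x = ∑ i ∈ formIndex N, potU N r ts t (affineForm r i x) := by
  rw [sum_formIndex]
  rfl

theorem differentiableAt_potW (hN : 0 < N) (hr : 0 < r) (ht : t < ts) {x : Fin N → ℝ}
    (hx : x ∈ alcove N r) : DifferentiableAt ℝ (potW N r ts t) x := by
  have h := hasFDerivAt_sum_affineForm r (fun _ => 1)
    (fun i hi => hasDerivAt_potU hN hr ht (affineForm_mem hx hi))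
  simp only [one_mul, ← potW_eq_sum] at h
  exact h.differentiableAt

theorem pd_potW (hN : 0 < N) (hr : 0 < r) (ht : t < ts) {x : Fin N → ℝ}
    (hx : x ∈ alcove N r) (j : Fin N) : pd j (potW N r ts t) x
      = ∑ i ∈ formIndex N, affineCoeff i j * potU₁ N r ts t (affineForm r i x) := by
  have h := pd_sum_affineForm r (fun _ => 1)
    (fun i hi => hasDerivAt_potU hN hr ht (affineForm_mem hx hi)) j
  simpa only [one_mul, ← potW_eq_sum] using h

theorem pd_potW_eventuallyEq (hN : 0 < N) (hr : 0 < r) (ht : t < ts) {x : Fin N → ℝ}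
    (hx : x ∈ alcove N r) (j : Fin N) : pd j (potW N r ts t) =ᶠ[𝓝 x]
      fun x => ∑ i ∈ formIndex N, affineCoeff i j * potU₁ N r ts t (affineForm r i x) := by
  filter_upwards [(isOpen_alcove N r).mem_nhds hx] with z hz
  exact pd_potW hN hr ht hz j

theorem differentiableAt_pd_potW (hN : 0 < N) (hr : 0 < r) (ht : t < ts) {x : Fin N → ℝ}
    (hx : x ∈ alcove N r) (j : Fin N) : DifferentiableAt ℝ (pd j (potW N r ts t)) x :=
  ((hasFDerivAt_sum_affineForm r (fun i => affineCoeff i j) (fun _ hi =>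
    hasDerivAt_potU₁ hN hr ht (affineForm_mem hx hi))).congr_of_eventuallyEq
      (pd_potW_eventuallyEq hN hr ht hx j)).differentiableAt

/-- The weights 2 and N are the squared lengths of the gradients of x_k - x_j and x̄. -/
theorem sum_pd_pd_potW (hN : 0 < N) (hr : 0 < r) (ht : t < ts) {x : Fin N → ℝ}
    (hx : x ∈ alcove N r) : ∑ j, pd j (pd j (potW N r ts t)) x
      = 2 * (∑ j : Fin N, ∑ k ∈ Finset.Ioi j, potU₂ N r ts t (x k - x j))
        + N * potU₂ N r ts t (bar r x) := by
  have h : ∀ j, pd j (pd j (potW N r ts t)) x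
      = ∑ i ∈ formIndex N, affineCoeff i j ^ 2 * potU₂ N r ts t (affineForm r i x) := by
    intro j
    rw [pd_congr (pd_potW_eventuallyEq hN hr ht hx j), pd_sum_affineForm r
      (fun i => affineCoeff i j) (fun i hi => hasDerivAt_potU₁ hN hr ht (affineForm_mem hx hi))]
    simp only [sq]
  simp only [h]
  rw [Finset.sum_comm]
  simp only [← Finset.sum_mul]
  rw [sum_formIndex, sum_affineCoeff_sq_none, Finset.mul_sum]
  congr 1
  refine Finset.sum_congr rfl fun j _ => ?_
  rw [Finset.mul_sum]
  refine Finset.sum_congr rfl fun k hk => ?_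
  rw [sum_affineCoeff_sq_some (Finset.mem_Ioi.mp hk)]
  rfl

theorem hasDerivAt_potW_time (hN : 0 < N) (hr : 0 < r) (ht : t < ts) {x : Fin N → ℝ}
    (hx : x ∈ alcove N r) : HasDerivAt (fun t => potW N r ts t x) (∑ i ∈ formIndex N,
      N / 2 * (potU₁ N r ts t (affineForm r i x) ^ 2 - potU₂ N r ts t (affineForm r i x))) t := by
  simp only [potW_eq_sum]
  exact HasDerivAt.fun_sum fun i hi => hasDerivAt_potU_time hN hr ht (affineForm_mem hx hi)

/-- 2∂_t W contributes N(U'² - U'') per form, while ΔW contributes 2U'' per difference and N U'' for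
x̄. The U'' of x̄ cancels and each difference keeps -(N - 2)U'', which is the bracket in V_N^{(β)}.
-/
theorem potV_eq (hN : 0 < N) (hr : 0 < r) (β : ℝ) (ht : t < ts) {x : Fin N → ℝ}
    (hx : x ∈ alcove N r) : potV N r ts β t x
      = β * (β - 2) / 8 * (2 * deriv (fun t => potW N r ts t x) t
        + ∑ j, pd j (pd j (potW N r ts t)) x) := by
  have hN0 : (N : ℝ) ≠ 0 := by exact_mod_cast hN.ne'
  rw [(hasDerivAt_potW_time hN hr ht hx).deriv, sum_pd_pd_potW hN hr ht hx, potV,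
    ← Finset.mul_sum, Finset.sum_sub_distrib, sum_formIndex, sum_formIndex,
    deriv_potU hN hr ht hx.2.2]
  have h1 : ∀ j : Fin N, ∀ k ∈ Finset.Ioi j, x k - x j ∈ Ioo 0 (2 * π * r) := fun j k hk =>
    affineForm_mem hx (i := some ⟨j, k⟩) (by simpa [formIndex] using hk)
  rw [Finset.sum_congr rfl fun j _ => Finset.sum_congr rfl fun k hk => by
      rw [deriv_potU hN hr ht (h1 j k hk)],
    Finset.sum_congr rfl fun j _ => Finset.sum_congr rfl fun k hk =>
      deriv_deriv_potU hN hr ht (h1 j k hk)]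
  simp only [affineForm]
  field_simp
  ring

theorem thetaH_eq_exp (hN : 0 < N) (hr : 0 < r) (ht : t < ts) {x : Fin N → ℝ}
    (hx : x ∈ alcove N r) : thetaH N r ts t x = Real.exp (-potW N r ts t x) := by
  have h : thetaH N r ts t x = ∏ i ∈ formIndex N, thetaAt N r ts 0 t (affineForm r i x) := by
    rw [prod_formIndex]
    simp only [thetaAt_zero N hr]
    rfl
  rw [h, potW_eq_sum, ← Finset.sum_neg_distrib, Real.exp_sum]
  refine Finset.prod_congr rfl fun i hi => ?_
  rw [potU_eq hr, neg_neg, Real.exp_log (thetaAt_zero_pos hN hr ht (affineForm_mem hx hi))]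

/-- The heat equation for `h_N` in terms of the potential. -/
theorem deriv_potW_time (hN2 : 2 ≤ N) (hr : 0 < r) (ht : t < ts) {x : Fin N → ℝ}
    (hx : x ∈ alcove N r) : deriv (fun t => potW N r ts t x) t
      = -(etaExp N * etaLogDeriv N r ts t) - 1 / 2 * ∑ j, pd j (pd j (potW N r ts t)) x
        + 1 / 2 * ∑ j, pd j (potW N r ts t) x ^ 2 := by
  have hN : 0 < N := by omega
  have hW := (hasDerivAt_potW_time hN hr ht hx).differentiableAt.hasDerivAt
  have h1 : HasDerivAt (fun t => thetaH N r ts t x)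
      (Real.exp (-potW N r ts t x) * -deriv (fun t => potW N r ts t x) t) t := by
    refine hW.fun_neg.exp.congr_of_eventuallyEq ?_
    filter_upwards [Iio_mem_nhds ht] with t' ht'
    exact thetaH_eq_exp hN hr ht' hx
  -- Two expressions for the time derivative of e^{-W}: the heat equation and the chain rule.
  -- Dividing by e^{-W} turns the linear equation into the nonlinear one for W.
  have h2 := (hasDerivAt_thetaH hN2 hr ht x).unique h1
  have h3 : ∀ j, ∀ z ∈ alcove N r, pd j (thetaH N r ts t) z
      = -pd j (potW N r ts t) z * (1 * Real.exp (-1 * potW N r ts t z)) := by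
    intro j z hz
    have : thetaH N r ts t =ᶠ[𝓝 z] fun z => 1 * Real.exp (-1 * potW N r ts t z) := by
      filter_upwards [(isOpen_alcove N r).mem_nhds hz] with y hy
      rw [thetaH_eq_exp hN hr ht hy, one_mul, neg_one_mul]
    rw [pd_congr this, pd_const_mul_exp _ _ (differentiableAt_potW hN hr ht hz)]
    ring
  have h4 : ∀ j, pd j (pd j (thetaH N r ts t)) x
      = (-pd j (pd j (potW N r ts t)) x + pd j (potW N r ts t) x ^ 2)
        * Real.exp (-potW N r ts t x) := by
    intro j
    have hd := differentiableAt_potW hN hr ht hx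
    have e : pd j (thetaH N r ts t) =ᶠ[𝓝 x] fun z => pd j (potW N r ts t) z
        * (-1 * Real.exp (-1 * potW N r ts t z)) := by
      filter_upwards [(isOpen_alcove N r).mem_nhds hx] with y hy
      rw [h3 j y hy]
      ring
    rw [pd_congr e, pd_mul (differentiableAt_pd_potW hN hr ht hx j)
      ((hd.const_mul _).exp.const_mul _), pd_const_mul_exp _ _ hd, neg_one_mul (potW N r ts t x)]
    ring
  simp only [h4, ← Finset.sum_mul, Finset.sum_add_distrib, Finset.sum_neg_distrib,
    thetaH_eq_exp hN hr ht hx] at h2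
  have he := (Real.exp_pos (-potW N r ts t x)).ne'
  have h5 : Real.exp (-potW N r ts t x) * (deriv (fun t => potW N r ts t x) t
      - (-(etaExp N * etaLogDeriv N r ts t) - 1 / 2 * ∑ j, pd j (pd j (potW N r ts t)) x
        + 1 / 2 * ∑ j, pd j (potW N r ts t) x ^ 2)) = 0 := by
    linear_combination h2
  linarith [(mul_eq_zero.mp h5).resolve_left he]

end Potentials

/-! ### Conjugation of the operators by the multiplier -/

section Conjugation

variable {N : ℕ} {r ts t β : ℝ}

theorem hN_pos (hN0 : 0 < N) (hr : 0 < r) (β : ℝ) (ht : t < ts) {x : Fin N → ℝ}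
    (hx : x ∈ alcove N r) : 0 < hN N r ts β t x := by
  rw [hN_eq_mul_thetaH, thetaH_eq_exp hN0 hr ht hx]
  exact mul_pos (Real.rpow_pos_of_pos (etaR_tauIm_pos hN0 hr ht) _) (Real.exp_pos _)

theorem multiplier_pos (hN0 : 0 < N) (hr : 0 < r) (β : ℝ) {t' : ℝ} (ht' : t' < ts)
    {x' : Fin N → ℝ} (hx' : x' ∈ alcove N r) (ht : t < ts) {x : Fin N → ℝ}
    (hx : x ∈ alcove N r) : 0 < multiplier N r ts β t' x' t x :=
  Real.rpow_pos_of_pos (div_pos (hN_pos hN0 hr β ht hx) (hN_pos hN0 hr β ht' hx')) _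

/-- All dependence on x sits in exp(-(β/2)W); the rest is a function of t through η. -/
theorem multiplier_eq (hN0 : 0 < N) (hr : 0 < r) (β : ℝ) {t' : ℝ} (ht' : t' < ts)
    {x' : Fin N → ℝ} (hx' : x' ∈ alcove N r) (ht : t < ts) {x : Fin N → ℝ}
    (hx : x ∈ alcove N r) : multiplier N r ts β t' x' t x
      = (hN N r ts β t' x' ^ (-(β / 2))
        * etaR (N * tauIm r ts t) ^ (-(β ^ 2 / 4) * etaExp N))
        * Real.exp (-(β / 2) * potW N r ts t x) := by
  have hη := etaR_tauIm_pos hN0 hr ht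
  rw [multiplier, Real.div_rpow (hN_pos hN0 hr β ht hx).le (hN_pos hN0 hr β ht' hx').le,
    hN_eq_mul_thetaH N r ts β t, thetaH_eq_exp hN0 hr ht hx,
    Real.mul_rpow (Real.rpow_nonneg hη.le _) (Real.exp_pos _).le, ← Real.rpow_mul hη.le,
    ← Real.exp_mul, div_eq_mul_inv, ← Real.rpow_neg (hN_pos hN0 hr β ht' hx').le,
    show -β * ((N : ℝ) - 1) * ((N : ℝ) - 2) / 4 * (β / 2) = -(β ^ 2 / 4) * etaExp N by
      rw [etaExp]; ring,
    show -potW N r ts t x * (β / 2) = -(β / 2) * potW N r ts t x by ring]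
  ring

theorem differentiableAt_pd {f : (Fin N → ℝ) → ℝ} {D : Set (Fin N → ℝ)} (hD : IsOpen D)
    (hf : ContDiffOn ℝ 2 f D) {x : Fin N → ℝ} (hx : x ∈ D) (j : Fin N) :
    DifferentiableAt ℝ (pd j f) x := by
  have h1 : ContDiffAt ℝ 1 (fderiv ℝ f) x :=
    (hf.contDiffAt (hD.mem_nhds hx)).fderiv_right (by norm_num)
  exact (h1.differentiableAt (by norm_num)).clm_apply (differentiableAt_const _)

/-- The drift is a gradient, and for this exponent the first-order terms -(β/2)∇W·∇f from the
Laplacian and +(β/2)∇W·∇f from the divergence cancel. -/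
theorem kolmogorovOp_const_mul_exp (hN0 : 0 < N) (hr : 0 < r) (ht : t < ts) (c : ℝ)
    {f M : (Fin N → ℝ) → ℝ} (hf : ContDiffOn ℝ 2 f (alcove N r))
    (hM : ∀ x ∈ alcove N r, M x = c * Real.exp (-(β / 2) * potW N r ts t x))
    {x : Fin N → ℝ} (hx : x ∈ alcove N r) :
    kolmogorovOp N r ts β t (fun x => M x * f x) x
      = M x * (1 / 2 * ∑ j, pd j (pd j f) x
        + (β / 4 * ∑ j, pd j (pd j (potW N r ts t)) x
          - β ^ 2 / 8 * ∑ j, pd j (potW N r ts t) x ^ 2) * f x) := by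
  have hD := isOpen_alcove N r
  have hfd : ∀ y ∈ alcove N r, DifferentiableAt ℝ f y := fun y hy =>
    (hf.contDiffAt (hD.mem_nhds hy)).differentiableAt (by norm_num)
  have hMe : ∀ y ∈ alcove N r, M =ᶠ[𝓝 y]
      fun x => c * Real.exp (-(β / 2) * potW N r ts t x) := fun y hy => by
    filter_upwards [hD.mem_nhds hy] with z hz using hM z hz
  have hMd : ∀ y ∈ alcove N r, DifferentiableAt ℝ M y := fun y hy =>
    ((((differentiableAt_potW hN0 hr ht hy).const_mul _).exp.const_mul c).congr_of_eventuallyEq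
      (hMe y hy))
  have hMp : ∀ j, ∀ y ∈ alcove N r, pd j M y = -(β / 2) * pd j (potW N r ts t) y * M y := by
    intro j y hy
    rw [pd_congr (hMe y hy), pd_const_mul_exp _ _ (differentiableAt_potW hN0 hr ht hy), hM y hy]
  have h1 : ∀ j, pd j (pd j fun x => M x * f x) x
      = (-(β / 2) * pd j (pd j (potW N r ts t)) x + β ^ 2 / 4 * pd j (potW N r ts t) x ^ 2)
          * (M x * f x) - β * pd j (potW N r ts t) x * (M x * pd j f x)
        + M x * pd j (pd j f) x := by
    intro j
    have e : (pd j fun x => M x * f x) =ᶠ[𝓝 x] fun y =>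
        -(β / 2) * (pd j (potW N r ts t) y * (M y * f y)) + M y * pd j f y := by
      filter_upwards [hD.mem_nhds hx] with y hy
      rw [pd_mul (hMd y hy) (hfd y hy), hMp j y hy]
      ring
    have d1 := differentiableAt_pd_potW hN0 hr ht hx j
    have d2 := hMd x hx
    have d3 := hfd x hx
    have d4 := differentiableAt_pd hD hf hx j
    rw [pd_congr e, pd_add ((d1.fun_mul (d2.fun_mul d3)).const_mul _) (d2.fun_mul d4),
      pd_const_mul]
    beta_reduce
    rw [pd_mul d1 (d2.fun_mul d3), pd_mul d2 d3, pd_mul d2 d4, hMp j x hx]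
    ring
  have h2 : ∀ j, pd j (fun y => pd j (potW N r ts t) y * (M y * f y)) x
      = pd j (pd j (potW N r ts t)) x * (M x * f x)
        - β / 2 * (pd j (potW N r ts t) x ^ 2 * (M x * f x))
        + pd j (potW N r ts t) x * (M x * pd j f x) := by
    intro j
    have d1 := differentiableAt_pd_potW hN0 hr ht hx j
    have d2 := hMd x hx
    have d3 := hfd x hx
    rw [pd_mul d1 (d2.fun_mul d3), pd_mul d2 d3, hMp j x hx]
    ring
  rw [kolmogorovOp]
  simp only [h1, h2]
  simp only [mul_add, mul_sub, add_mul, sub_mul, Finset.mul_sum, Finset.sum_mul,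
    ← Finset.sum_add_distrib, ← Finset.sum_sub_distrib]
  exact Finset.sum_congr rfl fun j _ => by ring

/-- Multiplication by the multiplier conjugates `∂_t + ℋ` into `∂_t - ℒ`. -/
theorem deriv_sub_kolmogorovOp (hN2 : 2 ≤ N) (hr : 0 < r) (β : ℝ) {t' : ℝ} (ht' : t' < ts)
    {x' : Fin N → ℝ} (hx' : x' ∈ alcove N r) (ht : t < ts) {x : Fin N → ℝ}
    (hx : x ∈ alcove N r) {f : ℝ → (Fin N → ℝ) → ℝ} (hf : ContDiffOn ℝ 2 (f t) (alcove N r))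
    (hft : DifferentiableAt ℝ (fun t => f t x) t) :
    deriv (fun s => multiplier N r ts β t' x' s x * f s x) t
        - kolmogorovOp N r ts β t (fun x => multiplier N r ts β t' x' t x * f t x) x
      = multiplier N r ts β t' x' t x
        * (deriv (fun s => f s x) t + hamiltonian N r ts β t (f t) x) := by
  have hN0 : 0 < N := by omega
  have hW := (hasDerivAt_potW_time hN0 hr ht hx).differentiableAt.hasDerivAt
  have hM : HasDerivAt (fun s => multiplier N r ts β t' x' s x)
      ((-(β ^ 2 / 4) * etaExp N * etaLogDeriv N r ts t
        - β / 2 * deriv (fun t => potW N r ts t x) t) * multiplier N r ts β t' x' t x) t := by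
    have h := (((hasDerivAt_etaR_rpow hN0 hr ht (-(β ^ 2 / 4) * etaExp N)).const_mul
      (hN N r ts β t' x' ^ (-(β / 2)))).fun_mul (hW.const_mul (-(β / 2))).exp)
    refine (h.congr_of_eventuallyEq ?_).congr_deriv ?_
    · filter_upwards [Iio_mem_nhds ht] with s hs
      exact multiplier_eq hN0 hr β ht' hx' hs hx
    · rw [multiplier_eq hN0 hr β ht' hx' ht hx]
      ring
  rw [(hM.fun_mul hft.hasDerivAt).deriv, kolmogorovOp_const_mul_exp hN0 hr ht _ hf
    (fun y hy => multiplier_eq hN0 hr β ht' hx' ht hy) hx, hamiltonian, potV_eq hN0 hr β ht hx]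
  have h1 := deriv_potW_time hN2 hr ht hx
  -- After the substitution of V through `potV_eq`, the defect is -(β²/4) times the nonlinear
  -- equation for W; its η term is supplied by the η-power in the multiplier.
  linear_combination (-(β ^ 2 / 4)) * (multiplier N r ts β t' x' t x * f t x) * h1

end Conjugation

/-! ### Functions of class `C^{1,2}` -/

section Regularity

variable {N : ℕ} {D : Set (Fin N → ℝ)} {a b : ℝ} {u v : ℝ → (Fin N → ℝ) → ℝ}

theorem pd_congr_on (hD : IsOpen D) {f g : (Fin N → ℝ) → ℝ} (h : EqOn f g D) (j : Fin N) :
    EqOn (pd j f) (pd j g) D := fun x hx => by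
  refine pd_congr ?_ j
  filter_upwards [hD.mem_nhds hx] with y hy using h hy

theorem deriv_time_congr (h : ∀ t ∈ Ioo a b, EqOn (u t) (v t) D) {t : ℝ} (ht : t ∈ Ioo a b)
    {x : Fin N → ℝ} (hx : x ∈ D) : deriv (fun s => u s x) t = deriv (fun s => v s x) t := by
  refine EventuallyEq.deriv_eq ?_
  filter_upwards [isOpen_Ioo.mem_nhds ht] with s hs using h s hs hx

theorem IsC12On.congr (hu : IsC12On u a b D) (hD : IsOpen D)
    (h : ∀ t ∈ Ioo a b, EqOn (u t) (v t) D) : IsC12On v a b D where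
  continuousOn := hu.continuousOn.congr fun z hz => (h z.1 hz.1 hz.2).symm
  time_differentiable x hx := (hu.time_differentiable x hx).congr fun t ht => (h t ht hx).symm
  space_contDiff t ht := (hu.space_contDiff t ht).congr fun _ hx => (h t ht hx).symm
  time_continuousOn := hu.time_continuousOn.congr fun _ hz =>
    (deriv_time_congr h hz.1 hz.2).symm
  pd_continuousOn j := (hu.pd_continuousOn j).congr fun z hz =>
    (pd_congr_on hD (h z.1 hz.1) j hz.2).symm
  pd2_continuousOn j k := (hu.pd2_continuousOn j k).congr fun z hz =>
    (pd_congr_on hD (pd_congr_on hD (h z.1 hz.1) j) k hz.2).symm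

theorem IsC12On.mul (hu : IsC12On u a b D) (hv : IsC12On v a b D) (hD : IsOpen D) :
    IsC12On (fun t x => u t x * v t x) a b D := by
  have hud : ∀ t ∈ Ioo a b, ∀ x ∈ D, DifferentiableAt ℝ (u t) x := fun t ht x hx =>
    ((hu.space_contDiff t ht).contDiffAt (hD.mem_nhds hx)).differentiableAt (by norm_num)
  have hvd : ∀ t ∈ Ioo a b, ∀ x ∈ D, DifferentiableAt ℝ (v t) x := fun t ht x hx =>
    ((hv.space_contDiff t ht).contDiffAt (hD.mem_nhds hx)).differentiableAt (by norm_num)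
  have h1 : ∀ t ∈ Ioo a b, ∀ j, EqOn (pd j fun x => u t x * v t x)
      (fun x => pd j (u t) x * v t x + u t x * pd j (v t) x) D := fun t ht j x hx =>
    pd_mul (hud t ht x hx) (hvd t ht x hx) j
  have h2 : ∀ t ∈ Ioo a b, ∀ j k, EqOn (pd k (pd j fun x => u t x * v t x))
      (fun x => (pd k (pd j (u t)) x * v t x + pd j (u t) x * pd k (v t) x)
        + (pd k (u t) x * pd j (v t) x + u t x * pd k (pd j (v t)) x)) D := by
    intro t ht j k x hx
    have d1 := hud t ht x hx
    have d2 := hvd t ht x hx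
    have d3 := differentiableAt_pd hD (hu.space_contDiff t ht) hx j
    have d4 := differentiableAt_pd hD (hv.space_contDiff t ht) hx j
    rw [pd_congr_on hD (h1 t ht j) k hx, pd_add (d3.fun_mul d2) (d1.fun_mul d4), pd_mul d3 d2,
      pd_mul d1 d4]
  have cu := hu.continuousOn
  have cv := hv.continuousOn
  refine ⟨cu.mul cv, fun x hx => (hu.time_differentiable x hx).mul (hv.time_differentiable x hx),
    fun t ht => (hu.space_contDiff t ht).mul (hv.space_contDiff t ht), ?_, fun j => ?_,
    fun j k => ?_⟩
  · refine ((hu.time_continuousOn.mul cv).add (cu.mul hv.time_continuousOn)).congr fun z hz => ?_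
    exact deriv_fun_mul
      ((hu.time_differentiable z.2 hz.2).differentiableAt (isOpen_Ioo.mem_nhds hz.1))
      ((hv.time_differentiable z.2 hz.2).differentiableAt (isOpen_Ioo.mem_nhds hz.1))
  · exact (((hu.pd_continuousOn j).mul cv).add (cu.mul (hv.pd_continuousOn j))).congr
      fun z hz => h1 z.1 hz.1 j hz.2
  · exact ((((hu.pd2_continuousOn j k).mul cv).add
      ((hu.pd_continuousOn j).mul (hv.pd_continuousOn k))).add
      (((hu.pd_continuousOn k).mul (hv.pd_continuousOn j)).add
        (cu.mul (hv.pd2_continuousOn j k)))).congr fun z hz => h2 z.1 hz.1 j k hz.2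

theorem pd_eq_fderiv_prod {F : ℝ × (Fin N → ℝ) → ℝ} {t : ℝ} {x : Fin N → ℝ}
    (h : DifferentiableAt ℝ F (t, x)) (j : Fin N) :
    pd j (fun x => F (t, x)) x = fderiv ℝ F (t, x) (0, Pi.single j 1) := by
  have h1 := h.hasFDerivAt.comp x (hasFDerivAt_prodMk_right t x)
  rw [pd, show (fun x => F (t, x)) = F ∘ fun x => (t, x) from rfl, h1.fderiv]
  rfl

theorem deriv_eq_fderiv_prod {F : ℝ × (Fin N → ℝ) → ℝ} {t : ℝ} {x : Fin N → ℝ}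
    (h : DifferentiableAt ℝ F (t, x)) :
    deriv (fun t => F (t, x)) t = fderiv ℝ F (t, x) (1, 0) := by
  have hl : HasFDerivAt (fun s : ℝ => (s, x)) (ContinuousLinearMap.inl ℝ ℝ (Fin N → ℝ)) t :=
    hasFDerivAt_prodMk_left t x
  have h1 := h.hasFDerivAt.comp (f := fun s : ℝ => (s, x)) t hl
  exact h1.hasDerivAt.deriv

theorem isC12On_of_contDiffOn (hD : IsOpen D)
    (h : ContDiffOn ℝ 2 (fun z : ℝ × (Fin N → ℝ) => u z.1 z.2) (Ioo a b ×ˢ D)) :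
    IsC12On u a b D := by
  have hΩ : IsOpen (Ioo a b ×ˢ D) := isOpen_Ioo.prod hD
  have hd : ∀ t ∈ Ioo a b, ∀ x ∈ D,
      DifferentiableAt ℝ (fun z : ℝ × (Fin N → ℝ) => u z.1 z.2) (t, x) := fun t ht x hx =>
    (h.contDiffAt (hΩ.mem_nhds ⟨ht, hx⟩)).differentiableAt (by norm_num)
  have hf : ContDiffOn ℝ 1 (fderiv ℝ fun z : ℝ × (Fin N → ℝ) => u z.1 z.2) (Ioo a b ×ˢ D) :=
    h.fderiv_of_isOpen hΩ (by norm_num)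
  have h1 : ∀ j, ContDiffOn ℝ 1 (fun z => fderiv ℝ (fun z : ℝ × (Fin N → ℝ) => u z.1 z.2) z
      (0, Pi.single j 1)) (Ioo a b ×ˢ D) := fun j => hf.clm_apply contDiffOn_const
  have e1 : ∀ j, ∀ t ∈ Ioo a b, EqOn (pd j (u t)) (fun x =>
      fderiv ℝ (fun z : ℝ × (Fin N → ℝ) => u z.1 z.2) (t, x) (0, Pi.single j 1)) D :=
    fun j t ht x hx => pd_eq_fderiv_prod (hd t ht x hx) j
  refine ⟨h.continuousOn, fun x hx t ht => ?_, fun t ht => ?_, ?_, fun j => ?_, fun j k => ?_⟩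
  · have hl : DifferentiableAt ℝ (fun s : ℝ => (s, x)) t := by fun_prop
    exact ((hd t ht x hx).comp (f := fun s : ℝ => (s, x)) t hl).differentiableWithinAt
  · exact h.comp (f := fun x => (t, x)) (contDiff_prodMk_right t).contDiffOn
      fun x hx => ⟨ht, hx⟩
  · exact (hf.clm_apply contDiffOn_const).continuousOn.congr fun z hz =>
      deriv_eq_fderiv_prod (hd z.1 hz.1 z.2 hz.2)
  · exact (h1 j).continuousOn.congr fun z hz => e1 j z.1 hz.1 hz.2
  · have h2 : ContDiffOn ℝ 0 (fderiv ℝ fun z => fderiv ℝ (fun z : ℝ × (Fin N → ℝ) => u z.1 z.2) z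
      (0, Pi.single j 1)) (Ioo a b ×ˢ D) := (h1 j).fderiv_of_isOpen hΩ (by norm_num)
    refine (h2.clm_apply (contDiffOn_const (c := (0, Pi.single k 1)))).continuousOn.congr
      fun z hz => ?_
    rw [pd_congr_on hD (e1 j z.1 hz.1) k hz.2]
    exact pd_eq_fderiv_prod (((h1 j).contDiffAt (hΩ.mem_nhds hz)).differentiableAt (by norm_num)) k

end Regularity

/-! ### Regularity of the multiplier and equivalence of the two equations -/

section Multiplier

variable {N : ℕ} {r ts : ℝ}

theorem contDiff_tauIm : ContDiff ℝ 2 fun z : ℝ × (Fin N → ℝ) => (N : ℝ) * tauIm r ts z.1 := by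
  unfold tauIm
  fun_prop

theorem contDiffOn_etaR_tauIm (hN0 : 0 < N) (hr : 0 < r) :
    ContDiffOn ℝ 2 (fun z : ℝ × (Fin N → ℝ) => etaR (N * tauIm r ts z.1))
      (Iio ts ×ˢ univ) := by
  refine ContDiffOn.comp (t := Ioi 0) (g := etaR) (contDiffOn_etaR 2)
    contDiff_tauIm.contDiffOn fun z hz => ?_
  exact mul_pos (by exact_mod_cast hN0) (tauIm_pos hr hz.1)

theorem contDiffOn_theta1R_tauIm (hN0 : 0 < N) (hr : 0 < r) {g : (Fin N → ℝ) → ℝ}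
    (hg : ContDiff ℝ 2 g) : ContDiffOn ℝ 2
      (fun z : ℝ × (Fin N → ℝ) => theta1R (g z.2 / (2 * π * r)) (N * tauIm r ts z.1))
      (Iio ts ×ˢ univ) := by
  have hg2 : ContDiff ℝ 2 fun z : ℝ × (Fin N → ℝ) =>
      (g z.2 / (2 * π * r), (N : ℝ) * tauIm r ts z.1) :=
    ((hg.comp contDiff_snd).div_const _).prodMk contDiff_tauIm
  have h0 : ContDiffOn ℝ 2 (fun z : ℝ × ℝ => theta1R z.1 z.2) {z | 0 < z.2} := by
    exact_mod_cast contDiffOn_theta1R 2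
  have hmaps : MapsTo (fun z : ℝ × (Fin N → ℝ) =>
      (g z.2 / (2 * π * r), (N : ℝ) * tauIm r ts z.1)) (Iio ts ×ˢ univ) {z | 0 < z.2} := by
    intro z hz
    have : 0 < (N : ℝ) * tauIm r ts z.1 := mul_pos (by exact_mod_cast hN0) (tauIm_pos hr hz.1)
    exact this
  have h := h0.comp hg2.contDiffOn hmaps
  exact h

theorem contDiffOn_hN (hN0 : 0 < N) (hr : 0 < r) (β : ℝ) : ContDiffOn ℝ 2
    (fun z : ℝ × (Fin N → ℝ) => hN N r ts β z.1 z.2) (Iio ts ×ˢ univ) := by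
  have h1 := (contDiffOn_etaR_tauIm (ts := ts) hN0 hr).rpow_const_of_ne
    (p := -β * ((N : ℝ) - 1) * ((N : ℝ) - 2) / 4)
    fun z hz => (etaR_tauIm_pos hN0 hr hz.1).ne'
  have h2 := contDiffOn_theta1R_tauIm (N := N) (ts := ts) hN0 hr (g := bar r)
    (by unfold bar; fun_prop)
  have h3 : ContDiffOn ℝ 2 (fun z : ℝ × (Fin N → ℝ) => ∏ j : Fin N, ∏ k ∈ Finset.Ioi j,
      theta1R ((z.2 k - z.2 j) / (2 * π * r)) (N * tauIm r ts z.1)) (Iio ts ×ˢ univ) :=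
    contDiffOn_prod fun j _ => contDiffOn_prod fun k _ =>
      contDiffOn_theta1R_tauIm hN0 hr (g := fun x => x k - x j) (by fun_prop)
  exact (h1.mul h2).mul h3

/-- Continuity holds for all x, including the zeros of h_N at the boundary, because the exponent β/2
is positive. Smoothness is claimed only in the alcove, where h_N > 0. -/
theorem continuousOn_multiplier (hN0 : 0 < N) (hr : 0 < r) {β : ℝ} (hβ : 0 < β) (t' : ℝ)
    (x' : Fin N → ℝ) : ContinuousOn
      (fun z : ℝ × (Fin N → ℝ) => multiplier N r ts β t' x' z.1 z.2) (Iio ts ×ˢ univ) :=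
  ((contDiffOn_hN hN0 hr β).continuousOn.div_const _).rpow_const
    fun _ _ => Or.inr (by positivity)

theorem contDiffOn_multiplier (hN0 : 0 < N) (hr : 0 < r) (β : ℝ) {t' : ℝ} (ht' : t' < ts)
    {x' : Fin N → ℝ} (hx' : x' ∈ alcove N r) : ContDiffOn ℝ 2
      (fun z : ℝ × (Fin N → ℝ) => multiplier N r ts β t' x' z.1 z.2)
      (Ioo t' ts ×ˢ alcove N r) := by
  refine (((contDiffOn_hN hN0 hr β).mono
    (prod_mono Ioo_subset_Iio_self (subset_univ _))).div_const _).rpow_const_of_ne fun z hz => ?_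
  exact (div_pos (hN_pos hN0 hr β hz.1.2 hz.2) (hN_pos hN0 hr β ht' hx')).ne'

theorem SolvesKolmogorov.congr {β t' : ℝ} {u v : ℝ → (Fin N → ℝ) → ℝ}
    (hu : SolvesKolmogorov N r ts β t' u)
    (h : ∀ t ∈ Ioo t' ts, EqOn (u t) (v t) (alcove N r)) : SolvesKolmogorov N r ts β t' v := by
  have hD := isOpen_alcove N r
  refine ⟨hu.1.congr hD h, fun t ht x hx => ?_⟩
  have e : ∀ j, EqOn (fun y => pd j (potW N r ts t) y * u t y)
      (fun y => pd j (potW N r ts t) y * v t y) (alcove N r) := fun j y hy => by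
    simp only [h t ht hy]
  rw [← hu.2 t ht x hx, ← deriv_time_congr h ht hx, kolmogorovOp, kolmogorovOp]
  simp only [pd_congr_on hD (e _) _ hx, pd_congr_on hD (pd_congr_on hD (h t ht) _) _ hx]

theorem solvesSchrodinger_iff (hN2 : 2 ≤ N) (hr : 0 < r) (β : ℝ) {t' : ℝ} (ht' : t' < ts)
    {x' : Fin N → ℝ} (hx' : x' ∈ alcove N r) (f : ℝ → (Fin N → ℝ) → ℝ) :
    SolvesSchrodinger N r ts β t' f ↔
      SolvesKolmogorov N r ts β t' fun t x => multiplier N r ts β t' x' t x * f t x := by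
  have hN0 : 0 < N := by omega
  have hD := isOpen_alcove N r
  have hm := contDiffOn_multiplier hN0 hr β ht' hx'
  have hpos : ∀ t ∈ Ioo t' ts, ∀ x ∈ alcove N r, 0 < multiplier N r ts β t' x' t x :=
    fun t ht x hx => multiplier_pos hN0 hr β ht' hx' ht.2 hx
  have hconj : IsC12On f t' ts (alcove N r) → ∀ t ∈ Ioo t' ts, ∀ x ∈ alcove N r, _ :=
    fun hf t ht x hx => deriv_sub_kolmogorovOp hN2 hr β ht' hx' ht.2 hx (hf.space_contDiff t ht)
      ((hf.time_differentiable x hx).differentiableAt (isOpen_Ioo.mem_nhds ht))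
  constructor
  · rintro ⟨hf, he⟩
    refine ⟨(isC12On_of_contDiffOn hD hm).mul hf hD, fun t ht x hx => ?_⟩
    rw [hconj hf t ht x hx, he t ht x hx, mul_zero]
  · rintro ⟨hg, he⟩
    -- For the converse the regularity of f is recovered by dividing by the positive multiplier.
    have hi : IsC12On (fun t x => (multiplier N r ts β t' x' t x)⁻¹) t' ts (alcove N r) :=
      isC12On_of_contDiffOn hD (hm.inv fun z hz => (hpos z.1 hz.1 z.2 hz.2).ne')
    have hf : IsC12On f t' ts (alcove N r) := (hi.mul hg hD).congr hD fun t ht x hx =>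
      inv_mul_cancel_left₀ (hpos t ht x hx).ne' _
    refine ⟨hf, fun t ht x hx => ?_⟩
    have h := he t ht x hx
    rw [hconj hf t ht x hx] at h
    exact (mul_eq_zero.mp h).resolve_left (hpos t ht x hx).ne'

end Multiplier

/-! ### Initial and boundary conditions -/

section Conditions

open MeasureTheory

variable {N : ℕ} {r ts t' β : ℝ} {x' : Fin N → ℝ}

/-- N x_j is the sum of the coordinates, confined by the condition on x̄, plus the differences x_j -
x_k, each of size at most 2πr. Without that condition the alcove would be unbounded along (1, …, 1).
-/
theorem isBounded_alcove (hN0 : 0 < N) (r : ℝ) : Bornology.IsBounded (alcove N r) := by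
  have hN1 : (1 : ℝ) ≤ N := by exact_mod_cast hN0
  refine (Metric.isBounded_closedBall (x := (0 : Fin N → ℝ))
    (r := 2 * π * r + |kappa N r| + 2 * π * r)).subset fun x hx => ?_
  have hL : 0 < 2 * π * r := hx.2.2.1.trans hx.2.2.2
  rw [mem_closedBall_zero_iff, pi_norm_le_iff_of_nonneg (by positivity)]
  intro j
  have hs : ∑ k, x k = bar r x + kappa N r := by rw [bar]; ring
  have h1 : (N : ℝ) * x j = (bar r x + kappa N r) + ∑ k, (x j - x k) := by
    rw [← hs, Finset.sum_sub_distrib]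
    simp
  have hd : ∀ k, |x j - x k| ≤ 2 * π * r := fun k => by
    have := hx.2.1 j k
    have := hx.2.1 k j
    rw [abs_le]
    constructor <;> linarith
  have h2 : |∑ k, (x j - x k)| ≤ N * (2 * π * r) := by
    refine (Finset.abs_sum_le_sum_abs _ _).trans ((Finset.sum_le_sum fun k _ => hd k).trans ?_)
    simp
  have h3 : |bar r x| ≤ 2 * π * r := by
    rw [abs_of_pos hx.2.2.1]
    exact hx.2.2.2.le
  have h4 : (N : ℝ) * |x j| ≤ 2 * π * r + |kappa N r| + N * (2 * π * r) := by
    calc (N : ℝ) * |x j| = |(N : ℝ) * x j| := by rw [abs_mul, Nat.abs_cast]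
      _ ≤ |bar r x| + |kappa N r| + |∑ k, (x j - x k)| := by
        rw [h1]
        exact (abs_add_le _ _).trans (add_le_add_left (abs_add_le _ _) _)
      _ ≤ _ := by linarith
  have h5 : 2 * π * r + |kappa N r| ≤ N * (2 * π * r + |kappa N r|) :=
    le_mul_of_one_le_left (by positivity) hN1
  rw [Real.norm_eq_abs]
  refine le_of_mul_le_mul_left (a := (N : ℝ)) ?_ (by linarith)
  linarith

theorem isCompact_closure_alcove (hN0 : 0 < N) (r : ℝ) : IsCompact (closure (alcove N r)) :=
  (isBounded_alcove hN0 r).isCompact_closure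

theorem measurableSet_alcove (N : ℕ) (r : ℝ) : MeasurableSet (alcove N r) :=
  (isOpen_alcove N r).measurableSet

theorem integrableOn_continuous_mul (hN0 : 0 < N) {g u : (Fin N → ℝ) → ℝ} (hg : Continuous g)
    (hu : IntegrableOn u (alcove N r)) : IntegrableOn (fun x => g x * u x) (alcove N r) :=
  hu.continuousOn_mul_of_subset hg.continuousOn (isCompact_closure_alcove hN0 r)
    (measurableSet_alcove N r) subset_closure

theorem continuous_of_continuousOn_prod {g : ℝ × (Fin N → ℝ) → ℝ}
    (hg : ContinuousOn g (Iio ts ×ˢ univ)) {t : ℝ} (ht : t < ts) :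
    Continuous fun x => g (t, x) := by
  rw [← continuousOn_univ]
  exact hg.comp (by fun_prop) fun x _ => ⟨ht, mem_univ x⟩

/-- Weak convergence to the point mass also holds for test functions that depend continuously
on time. -/
theorem StartsAtDelta.tendsto_of_continuousOn (hN0 : 0 < N) {u : ℝ → (Fin N → ℝ) → ℝ}
    (hu : StartsAtDelta N r ts t' x' u) (hpos : PositiveInside N r ts t' u) (ht' : t' < ts)
    {g : ℝ × (Fin N → ℝ) → ℝ} (hg : ContinuousOn g (Iio ts ×ˢ univ)) :
    Tendsto (fun t => ∫ x in alcove N r, g (t, x) * u t x) (𝓝[>] t') (𝓝 (g (t', x'))) := by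
  have hA := measurableSet_alcove N r
  have hIoo : Ioo t' ts ∈ 𝓝[>] t' := Ioo_mem_nhdsGT ht'
  have h1 : Tendsto (fun t => ∫ x in alcove N r, u t x) (𝓝[>] t') (𝓝 1) := by
    simpa using hu.2 (fun _ => 1) continuous_const
  have h2 := hu.2 (fun x => g (t', x)) (continuous_of_continuousOn_prod hg ht')
  have h3 : Tendsto (fun t => ∫ x in alcove N r, (g (t, x) - g (t', x)) * u t x) (𝓝[>] t')
      (𝓝 0) := by
    rw [Metric.tendsto_nhds]
    intro ε hε
    -- On the compact closure g(t, ·) → g(t', ·) uniformly. With error ε/4 and total mass below 2,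
    -- the difference of the integrals stays below ε.
    obtain ⟨v, hv, hvg⟩ := (isCompact_closure_alcove hN0 r).mem_uniformity_of_prod
      (f := fun t x => g (t, x)) (s := Iio ts) (q := t')
      (hg.mono (prod_mono le_rfl (subset_univ _))) ht'
      (Metric.dist_mem_uniformity (show 0 < ε / 4 by positivity))
    have hv' : v ∈ 𝓝[>] t' := by
      rw [nhdsWithin_eq_nhds.mpr (Iio_mem_nhds ht')] at hv
      exact mem_nhdsWithin_of_mem_nhds hv
    have hlt : ∀ᶠ t in 𝓝[>] t', ∫ x in alcove N r, u t x < 2 :=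
      h1.eventually (gt_mem_nhds (by norm_num))
    filter_upwards [hv', hlt, hIoo] with t htv htu htI
    rw [dist_zero_right]
    have hb : ‖∫ x in alcove N r, (g (t, x) - g (t', x)) * u t x‖
        ≤ ∫ x in alcove N r, ε / 4 * u t x := by
      refine norm_integral_le_of_norm_le ((hu.1 t htI).const_mul _) ?_
      filter_upwards [ae_restrict_mem hA] with x hx
      rw [norm_mul, Real.norm_of_nonneg (hpos t htI x hx).le]
      exact mul_le_mul_of_nonneg_right (hvg t htv x (subset_closure hx)).le (hpos t htI x hx).le
    rw [integral_const_mul] at hb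
    nlinarith
  have h4 := h2.add h3
  rw [add_zero] at h4
  refine h4.congr' ?_
  filter_upwards [hIoo] with t ht
  have c1 := continuous_of_continuousOn_prod hg ht'
  have c2 : Continuous fun x => g (t, x) - g (t', x) :=
    (continuous_of_continuousOn_prod hg ht.2).sub c1
  rw [← integral_add (integrableOn_continuous_mul hN0 c1 (hu.1 t ht))
    (integrableOn_continuous_mul hN0 c2 (hu.1 t ht))]
  exact integral_congr_ae (Eventually.of_forall fun x => by ring)

theorem multiplier_self (hN0 : 0 < N) (hr : 0 < r) (β : ℝ) (ht' : t' < ts)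
    (hx' : x' ∈ alcove N r) : multiplier N r ts β t' x' t' x' = 1 := by
  rw [multiplier, div_self (hN_pos hN0 hr β ht' hx').ne', Real.one_rpow]

/-- Solutions of the Schrödinger problem give solutions of the Kolmogorov problem. -/
theorem IsSchrodingerSolution.multiplier_mul (hN2 : 2 ≤ N) (hr : 0 < r) (hβ : 0 < β)
    (ht' : t' < ts) (hx' : x' ∈ alcove N r) {ψ : ℝ → (Fin N → ℝ) → ℝ}
    (hψ : IsSchrodingerSolution N r ts β t' x' ψ) :
    IsKolmogorovSolution N r ts β t' x' fun t x => multiplier N r ts β t' x' t x * ψ t x := by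
  have hN0 : 0 < N := by omega
  have hm := continuousOn_multiplier (ts := ts) hN0 hr hβ t' x'
  refine ⟨(solvesSchrodinger_iff hN2 hr β ht' hx' ψ).mp hψ.equation, ⟨fun t ht => ?_,
    fun φ hφ => ?_⟩, fun t ht x hx => ?_⟩
  · exact integrableOn_continuous_mul hN0 (continuous_of_continuousOn_prod hm ht.2)
      (hψ.initial.1 t ht)
  · have c : ContinuousOn (fun z : ℝ × (Fin N → ℝ) => φ z.2 * multiplier N r ts β t' x' z.1 z.2)
        (Iio ts ×ˢ univ) := (hφ.comp continuous_snd).continuousOn.mul hm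
    have h := hψ.initial.tendsto_of_continuousOn hN0 hψ.positive ht' c
    simp only [multiplier_self hN0 hr β ht' hx', mul_one, mul_assoc] at h
    exact h
  · exact mul_pos (multiplier_pos hN0 hr β ht' hx' ht.2 hx) (hψ.positive t ht x hx)

/-- A function below `ψ` whose product with the multiplier tends to the point mass also tends to
the point mass. -/
theorem StartsAtDelta.of_le (hN2 : 2 ≤ N) (hr : 0 < r) (hβ : 0 < β) (ht' : t' < ts)
    (hx' : x' ∈ alcove N r) {p ψ f : ℝ → (Fin N → ℝ) → ℝ} (hp : StartsAtDelta N r ts t' x' p)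
    (hψ : StartsAtDelta N r ts t' x' ψ) (hf : PositiveInside N r ts t' f)
    (hfψ : ∀ t ∈ Ioo t' ts, ∀ x ∈ alcove N r, f t x ≤ ψ t x)
    (hfp : ∀ t ∈ Ioo t' ts, ∀ x ∈ alcove N r, p t x = multiplier N r ts β t' x' t x * f t x) :
    StartsAtDelta N r ts t' x' f := by
  have hN0 : 0 < N := by omega
  have hA := measurableSet_alcove N r
  have hm := continuousOn_multiplier (ts := ts) hN0 hr hβ t' x'
  have hmpos : ∀ t ∈ Ioo t' ts, ∀ x ∈ alcove N r, 0 < multiplier N r ts β t' x' t x :=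
    fun t ht x hx => multiplier_pos hN0 hr β ht' hx' ht.2 hx
  have hψpos : PositiveInside N r ts t' ψ := fun t ht x hx =>
    (hf t ht x hx).trans_le (hfψ t ht x hx)
  have hfi : ∀ t ∈ Ioo t' ts, IntegrableOn (f t) (alcove N r) := by
    intro t ht
    -- Measurability of f comes from p/m and its domination from ψ; m⁻¹ may be unbounded near the
    -- boundary, so integrability of p alone would not suffice.
    have hmi : ContinuousOn (fun x => (multiplier N r ts β t' x' t x)⁻¹) (alcove N r) :=
      (continuous_of_continuousOn_prod hm ht.2).continuousOn.inv₀
        fun x hx => (hmpos t ht x hx).ne'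
    have hmeas := (hmi.aestronglyMeasurable (μ := volume) hA).mul (hp.1 t ht).1
    refine (hψ.1 t ht).mono' (hmeas.congr ?_) ?_
    · filter_upwards [ae_restrict_mem hA] with x hx
      rw [Pi.mul_apply, hfp t ht x hx, inv_mul_cancel_left₀ (hmpos t ht x hx).ne']
    · filter_upwards [ae_restrict_mem hA] with x hx
      rw [Real.norm_of_nonneg (hf t ht x hx).le]
      exact hfψ t ht x hx
  refine ⟨hfi, fun φ hφ => ?_⟩
  have hφ' : ContinuousOn (fun z : ℝ × (Fin N → ℝ) => |φ z.2|) (Iio ts ×ˢ univ) :=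
    (hφ.comp continuous_snd).abs.continuousOn
  have c1 : ContinuousOn (fun z : ℝ × (Fin N → ℝ) =>
      |φ z.2| * multiplier N r ts β t' x' z.1 z.2) (Iio ts ×ˢ univ) := hφ'.mul hm
  have c2 : ContinuousOn (fun z : ℝ × (Fin N → ℝ) =>
      |φ z.2| * |1 - multiplier N r ts β t' x' z.1 z.2|) (Iio ts ×ˢ univ) :=
    hφ'.mul (continuousOn_const.sub hm).abs
  have l1 := hψ.tendsto_of_continuousOn hN0 hψpos ht' c1
  have l2 := hψ.tendsto_of_continuousOn hN0 hψpos ht' c2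
  have l3 := hp.2 (fun x => |φ x|) hφ.abs
  have l4 := (l1.sub l3).add l2
  simp only [multiplier_self hN0 hr β ht' hx', mul_one, sub_self, abs_zero, mul_zero,
    add_zero] at l4
  -- No mass is lost between f and ψ: ψ - f ≤ m(ψ - f) + |1 - m|ψ. Here mψ and mf = p have the same
  -- limit against |φ|, and |1 - m|ψ tends to 0 because m = 1 at the starting point.
  have l5 : Tendsto (fun t => ∫ x in alcove N r, φ x * (ψ t x - f t x)) (𝓝[>] t') (𝓝 0) := by
    refine squeeze_zero_norm' ?_ l4
    filter_upwards [Ioo_mem_nhdsGT ht'] with t ht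
    set m : (Fin N → ℝ) → ℝ := fun x => multiplier N r ts β t' x' t x
    have i1 : IntegrableOn (fun x => |φ x| * m x * ψ t x) (alcove N r) :=
      integrableOn_continuous_mul hN0 (continuous_of_continuousOn_prod c1 ht.2) (hψ.1 t ht)
    have i2 : IntegrableOn (fun x => |φ x| * |1 - m x| * ψ t x) (alcove N r) :=
      integrableOn_continuous_mul hN0 (continuous_of_continuousOn_prod c2 ht.2) (hψ.1 t ht)
    have i3 := integrableOn_continuous_mul hN0 hφ.abs (hp.1 t ht)
    have i4 : IntegrableOn (fun x => |φ x| * m x * ψ t x - |φ x| * p t x) (alcove N r) :=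
      i1.sub i3
    rw [← integral_sub i1 i3, ← integral_add i4 i2]
    refine norm_integral_le_of_norm_le (i4.add i2) ?_
    filter_upwards [ae_restrict_mem hA] with x hx
    have hd := sub_nonneg.mpr (hfψ t ht x hx)
    have hψf : ψ t x - f t x ≤ ψ t x := by linarith [hf t ht x hx]
    rw [hfp t ht x hx]
    rw [norm_mul, Real.norm_eq_abs, Real.norm_of_nonneg hd]
    change _ ≤ |φ x| * m x * ψ t x - |φ x| * (m x * f t x) + |φ x| * |1 - m x| * ψ t x
    have h1 : ψ t x - f t x ≤ m x * (ψ t x - f t x) + |1 - m x| * ψ t x := by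
      have h2 : (1 - m x) * (ψ t x - f t x) ≤ |1 - m x| * ψ t x :=
        mul_le_mul (le_abs_self _) hψf hd (abs_nonneg _)
      linarith
    calc |φ x| * (ψ t x - f t x) ≤ |φ x| * (m x * (ψ t x - f t x) + |1 - m x| * ψ t x) :=
          mul_le_mul_of_nonneg_left h1 (abs_nonneg _)
      _ = _ := by ring
  have l6 := (hψ.2 φ hφ).sub l5
  rw [sub_zero] at l6
  refine l6.congr' ?_
  filter_upwards [Ioo_mem_nhdsGT ht'] with t ht
  have i5 : IntegrableOn (fun x => φ x * (ψ t x - f t x)) (alcove N r) :=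
    integrableOn_continuous_mul hN0 hφ ((hψ.1 t ht).sub (hfi t ht))
  rw [← integral_sub (integrableOn_continuous_mul hN0 hφ (hψ.1 t ht)) i5]
  exact integral_congr_ae (Eventually.of_forall fun x => by ring)

/-- The minimality of p is used against mψ, the minimality of ψ against p/m. The first inequality
makes the second test function admissible: nothing is assumed about p at the boundary, but p/m ≤ ψ
forces p/m to vanish there. -/
theorem transitionDensity_eq (hN2 : 2 ≤ N) (hr : 0 < r) (hβ : 0 < β) (ht' : t' < ts)
    (hx' : x' ∈ alcove N r) {p ψ : ℝ → (Fin N → ℝ) → ℝ}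
    (hp : IsTransitionDensity N r ts β t' x' p) (hψ : IsPsi N r ts β t' x' ψ) {t : ℝ}
    (ht : t ∈ Ioo t' ts) {x : Fin N → ℝ} (hx : x ∈ alcove N r) :
    p t x = multiplier N r ts β t' x' t x * ψ t x := by
  have hN0 : 0 < N := by omega
  have hmpos : ∀ t ∈ Ioo t' ts, ∀ x ∈ alcove N r, 0 < multiplier N r ts β t' x' t x :=
    fun t ht x hx => multiplier_pos hN0 hr β ht' hx' ht.2 hx
  have hle := hp.2 _ (hψ.1.multiplier_mul hN2 hr hβ ht' hx')
  set f : ℝ → (Fin N → ℝ) → ℝ := fun t x => (multiplier N r ts β t' x' t x)⁻¹ * p t x with hf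
  have hpf : ∀ t ∈ Ioo t' ts, ∀ x ∈ alcove N r,
      p t x = multiplier N r ts β t' x' t x * f t x := fun t ht x hx =>
    (mul_inv_cancel_left₀ (hmpos t ht x hx).ne' _).symm
  have hfpos : PositiveInside N r ts t' f := fun t ht x hx =>
    mul_pos (inv_pos.mpr (hmpos t ht x hx)) (hp.1.positive t ht x hx)
  have hfψ : ∀ t ∈ Ioo t' ts, ∀ x ∈ alcove N r, f t x ≤ ψ t x := fun t ht x hx =>
    (inv_mul_le_iff₀ (hmpos t ht x hx)).mpr (hle t ht x hx)
  have hfsol : IsSchrodingerSolution N r ts β t' x' f := by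
    refine ⟨(solvesSchrodinger_iff hN2 hr β ht' hx' f).mpr
      (hp.1.equation.congr fun t ht x hx => hpf t ht x hx),
      hp.1.initial.of_le hN2 hr hβ ht' hx' hψ.1.initial hfpos hfψ hpf, hfpos, fun t ht y hy => ?_⟩
    refine squeeze_zero' ?_ ?_ (hψ.1.boundary t ht y hy)
    · filter_upwards [self_mem_nhdsWithin] with z hz using (hfpos z.1 hz.1 z.2 hz.2).le
    · filter_upwards [self_mem_nhdsWithin] with z hz using hfψ z.1 hz.1 z.2 hz.2
  refine le_antisymm (hle t ht x hx) ?_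
  rw [hpf t ht x hx]
  exact mul_le_mul_of_nonneg_left (hψ.2 f hfsol t ht x hx) (hmpos t ht x hx).le

/-- The multiplier has a finite limit at boundary points, so it preserves convergence to 0. -/
theorem VanishesAtBoundary.multiplier_mul (hN0 : 0 < N) (hr : 0 < r) (hβ : 0 < β)
    {p ψ : ℝ → (Fin N → ℝ) → ℝ} (hψ : VanishesAtBoundary N r ts t' ψ)
    (h : ∀ t ∈ Ioo t' ts, ∀ x ∈ alcove N r,
      p t x = multiplier N r ts β t' x' t x * ψ t x) : VanishesAtBoundary N r ts t' p := by
  intro t ht y hy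
  have hm : ContinuousAt (fun z : ℝ × (Fin N → ℝ) => multiplier N r ts β t' x' z.1 z.2) (t, y) :=
    (continuousOn_multiplier hN0 hr hβ t' x').continuousAt
      (prod_mem_nhds (Iio_mem_nhds ht.2) univ_mem)
  have h1 := (hm.tendsto.mono_left nhdsWithin_le_nhds).mul (hψ t ht y hy)
  rw [mul_zero] at h1
  refine h1.congr' ?_
  filter_upwards [self_mem_nhdsWithin] with z hz using (h z.1 hz.1 z.2 hz.2).symm

end Conditions

end EllipticDyson

end

/-! ### The proposition -/

open EllipticDyson in
theorem proposition3p2 (N : ℕ) (hN2 : 2 ≤ N) (r ts β : ℝ) (hr : 0 < r) (hts : 0 < ts)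
    (hβ : 0 < β) :
    -- (i)
    (∀ t' ∈ Ico 0 ts, ∀ x' ∈ alcove N r,
      -- the two equations correspond to each other under multiplication
      (∀ f : ℝ → (Fin N → ℝ) → ℝ,
        SolvesSchrodinger N r ts β t' f ↔
          SolvesKolmogorov N r ts β t' fun t x => multiplier N r ts β t' x' t x * f t x) ∧
      -- solutions of the Schrödinger-type problem give positive fundamental solutions
      (∀ ψ : ℝ → (Fin N → ℝ) → ℝ, IsSchrodingerSolution N r ts β t' x' ψ →
        IsKolmogorovSolution N r ts β t' x' fun t x => multiplier N r ts β t' x' t x * ψ t x) ∧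
      -- the transition density, inside the alcove and at its boundary
      (∀ p ψ : ℝ → (Fin N → ℝ) → ℝ, IsTransitionDensity N r ts β t' x' p →
        IsPsi N r ts β t' x' ψ →
        (∀ t ∈ Ioo t' ts, ∀ x ∈ alcove N r, p t x
          = (hN N r ts β t x / hN N r ts β t' x') ^ (β / 2) * ψ t x) ∧
        VanishesAtBoundary N r ts t' p)) ∧
    -- (ii)
    (∀ t ∈ Ico 0 ts, ∀ x : Fin N → ℝ,
      hN N r ts β t x
        = etaR (N * tauIm r ts t) ^ (-(β - 2) * ((N : ℝ) - 1) * ((N : ℝ) - 2) / 4)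
          * (2 * π * r / Real.sqrt N) ^ N
          * qDet N r (ts - t) (equidistant N r) x) := by
  refine ⟨fun t' ht' x' hx' => ⟨fun f => solvesSchrodinger_iff hN2 hr β ht'.2 hx' f,
    fun ψ hψ => hψ.multiplier_mul hN2 hr hβ ht'.2 hx', fun p ψ hp hψ => ?_⟩,
    fun t ht x => hN_eq_qDet hN2 β hr ht.2 x⟩
  have h : ∀ t ∈ Ioo t' ts, ∀ x ∈ alcove N r,
      p t x = multiplier N r ts β t' x' t x * ψ t x := fun t ht x hx =>
    transitionDensity_eq hN2 hr hβ ht'.2 hx' hp hψ ht hx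
  exact ⟨h, hψ.1.boundary.multiplier_mul (by omega) hr hβ h⟩
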